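/- **Setting.** Let $\mathbb{C}(\mathbb{Z})$ be the space of two-sided complex sequences and $(\Delta x)_t=x_{t-1}$. Let $\mathscr{X}_s$ be the union of all $s$-dimensional linear subspaces $X\subseteq\mathbb{C}(\mathbb{Z})$ that are shift-invariant, i.e. $\Delta X\subseteq X$. One observes $$y_t=x_t+\sigma\xi_t,\qquad |t|\le N,$$ where $\sigma\ge 0$ and the $\xi_t$ are i.i.d. standard complex Gaussians, normalized so that $\operatorname{Re}\xi_t$ and $\operatorname{Im}\xi_t$ are independent $\mathcal N(0,1)$. For an estimator $\hat x=\hat x(y)$ and $\delta\in(0,1)$, let $$\mathsf{Risk}_{N,\delta}(\hat x|X)=\inf\Big\{\varepsilon>0:\ \mathrm{Prob}\Big(\tfrac1{2N+1}\sum_{|t|\le N}|\hat x_t-x_t|^2>\varepsilon\Big)\le\delta\ \ \forall x\in X\Big\}$$ and let $\mathsf{Risk}^\star_{N,\delta}(X)$ be the infimum of $\mathsf{Risk}_{N,\delta}(\hat x|X)$ over all measurable $X$-valued estimators $\hat x$. **Estimator.** Write $\|u\|_{m,2}^2=\sum_{|t|\le m}|u_t|^2$, $(\varphi*y)_t=\sum_\tau\varphi_\tau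 y_{t-\tau}$, $(\mathcal F_m[u])_k=(2m+1)^{-1/2}\sum_{|\tau|\le m}e^{-2\pi i k\tau/(2m+1)}u_\tau$ for $0\le k\le 2m$, and $c_\star=2.16\pi^2+6$. Call $\varphi$ an optimal filter of halfwidth $m$ at center $h$ if it minimizes $\|\Delta^{-h}[\varphi*y-y]\|_{m,2}$ over all $\varphi$ that vanish outside $[-m,m]$ and satisfy $$\max\{\|\mathcal F_m[\varphi]\|_1,\ 18s\,\|\mathcal F_m[\varphi]\|_\infty\}\le\frac{18c_\star s}{\sqrt{2m+1}}.$$ Let $n\ge 9s$ where $n,s$ are powers of $3$ (the power $3^0=1$ is allowed). Put $n_k=n3^{-k}$, $h_k=2n-2n_k$, $K=\log_3(n/(9s))$. From the observations $(y_t)_{|t|\le 2n}$ define $\hat x^{\mathsf{full}}$ on $[-2n,2n]$ by * $\hat x^{\mathsf{full}}_t=(\hat\varphi^{(0)}*y)_t$ for $|t|\le n$, with $\hat\varphi^{(0)}$ an optimal filter of halfwidth $n$ at center $0$; * for $1\le k\le K$, $\hat x^{\mathsf{full}}_t=(\hat\varphi^{(k,+)}*y)_t$ for $2n-n_{k-1}<t\le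 2n-n_k$ and $\hat x^{\mathsf{full}}_t=(\hat\varphi^{(k,-)}*y)_t$ for $n_k-2n\le t<n_{k-1}-2n$, with $\hat\varphi^{(k,\pm)}$ an optimal filter of halfwidth $n_k$ at center $\pm h_k$; * $\hat x^{\mathsf{full}}_t=y_t$ for $2n-9s<|t|\le 2n$. **Claim.** (i) Let $n\ge 9s$ with $n,s$ powers of $3$. The optimal filters above exist. For any choice of them, any $\delta\in(0,1)$, $\sigma\ge0$ and $x\in\mathscr X_s$, with probability at least $1-\delta$, $$\|\hat x^{\mathsf{full}}-x\|_{2n,2}^2\le B:=160\,c_\star^2\sigma^2\big(4s\log(2n+1)+10s+\log(\delta^{-1})\big)\log^2(9e^4s)\,\log_3(n/s).$$ Consequently $\mathsf{Risk}_{2n,\delta}(\hat x^{\mathsf{full}}|\mathscr X_s)\le B/(4n+1)$. (ii) There is a universal constant $C>0$ such that for all integers $n\ge s\ge1$ (not necessarily powers of $3$), all $\delta\in(0,1)$ and all $\sigma\ge0$, $$\mathsf{Risk}^\star_{n,\delta}(\mathscr X_s)\le C\,\frac{\sigma^2}{2n+1}\big(s\log(en)+\log(\delta^{-1})\big)\log^2(es)\,\log(en/s).$$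 -/

import Mathlib

open MeasureTheory ProbabilityTheory
open scoped ENNReal

noncomputable section

namespace Denoise

/-! ### Two-sided sequences, shift-invariant subspaces -/

/-- The delay (unit shift) operator on two-sided complex sequences. -/
def delay (u : ℤ → ℂ) : ℤ → ℂ := fun t => u (t - 1)

/-- A linear subspace of the space of all two-sided sequences is shift-invariant when it is an
invariant subspace of the delay operator. -/
def IsShiftInvariant (X : Submodule ℂ (ℤ → ℂ)) : Prop := ∀ u ∈ X, delay u ∈ X

/-- The class of signals: the union of all shift-invariant subspaces of dimension `s`. -/
def signalClass (s : ℕ) : Set (ℤ → ℂ) :=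
  {x | ∃ X : Submodule ℂ (ℤ → ℂ),
    IsShiftInvariant X ∧ FiniteDimensional ℂ X ∧ Module.finrank ℂ X = s ∧ x ∈ X}

/-- Sequences that vanish outside `{-n, ..., n}`. -/
def BandLimited (n : ℕ) (u : ℤ → ℂ) : Prop := ∀ t : ℤ, (n : ℤ) < |t| → u t = 0

/-- The discrete convolution `(u * v)_t = ∑_τ u_τ v_{t-τ}`; it is only used with a finitely
supported `u`, so that the sum has finitely many nonzero terms. -/
def conv (u v : ℤ → ℂ) : ℤ → ℂ := fun t => ∑ᶠ τ : ℤ, u τ * v (t - τ)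

/-- The `ℓ²` seminorm on the slice `{-n, ..., n}`. -/
def l2 (n : ℕ) (u : ℤ → ℂ) : ℝ :=
  Real.sqrt (∑ t ∈ Finset.Icc (-(n : ℤ)) (n : ℤ), ‖u t‖ ^ 2)

/-- The unitary discrete Fourier transform of the slice `{-n, ..., n}`,
indexed by `{0, ..., 2n}`. -/
def dft (n : ℕ) (u : ℤ → ℂ) : Fin (2 * n + 1) → ℂ := fun k =>
  ((Real.sqrt (2 * (n : ℝ) + 1) : ℝ) : ℂ)⁻¹ *
    ∑ τ ∈ Finset.Icc (-(n : ℤ)) (n : ℤ),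
      Complex.exp (-(2 * (Real.pi : ℂ) * Complex.I * ((k : ℕ) : ℂ) * (τ : ℂ)) /
        (2 * (n : ℂ) + 1)) * u τ

/-- The `ℓ¹` norm of a finite complex vector. -/
def norm1 {d : ℕ} (a : Fin d → ℂ) : ℝ := ∑ k, ‖a k‖

/-- The `ℓ^∞` norm of a finite complex vector (Mathlib's norm on a finite product of copies
of `ℂ` is the maximum of the moduli). -/
def normInf {d : ℕ} (a : Fin d → ℂ) : ℝ := ‖a‖

/-! ### The estimators -/

/-- The constant `2.16 π² + 6`. -/
def cStar : ℝ := 2.16 * Real.pi ^ 2 + 6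

/-- The filters over which the residual is minimized. -/
def Feasible (m s : ℕ) (φ : ℤ → ℂ) : Prop :=
  BandLimited m φ ∧
    max (norm1 (dft m φ)) (18 * (s : ℝ) * normInf (dft m φ)) ≤
      18 * cStar * (s : ℝ) / Real.sqrt (2 * (m : ℝ) + 1)

/-- The `ℓ²` norm of the residual `φ * y - y` on the interval `{h - m, ..., h + m}`. -/
def residual (m : ℕ) (h : ℤ) (y φ : ℤ → ℂ) : ℝ :=
  l2 m (fun t => conv φ y (t + h) - y (t + h))

/-- `φ` is an optimal filter of halfwidth `m` on the interval `{h - m, ..., h + m}`. (Minimizing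
the norm or its square is the same.) -/
def IsOptimalFilter (m s : ℕ) (h : ℤ) (y φ : ℤ → ℂ) : Prop :=
  Feasible m s φ ∧ ∀ ψ : ℤ → ℂ, Feasible m s ψ → residual m h y φ ≤ residual m h y ψ

/-- The halfwidths `n_k = n 3^{-k}` (an exact division where it is used). -/
def scale (n k : ℕ) : ℕ := n / 3 ^ k

/-- The centers `h_k = 2n - 2 n_k`. -/
def center (n k : ℕ) : ℤ := 2 * (n : ℤ) - 2 * (scale n k : ℤ)

/-- The number of scales `K = log₃ (n / (9 s))` (exact when `n ≥ 9 s` and `n`, `s` are powers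
of 3). -/
def numScales (n s : ℕ) : ℕ := Nat.log 3 (n / (9 * s))

/-- `z` is the multiscale full-domain estimate computed from the observations `y`: on `[-n, n]`
it is the core estimate; on the interval `(2n - n_{k-1}, 2n - n_k]` and on its mirror image,
`1 ≤ k ≤ K`, it is the output of the filter that is optimal at scale `n_k` around `h_k`,
resp. `-h_k`; on the two remaining edges it equals the observations. -/
def IsFullEstimate (n s : ℕ) (y z : ℤ → ℂ) : Prop :=
  ∃ (φ : ℤ → ℂ) (φpos φneg : ℕ → ℤ → ℂ),
    IsOptimalFilter n s 0 y φ ∧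
    (∀ k ∈ Finset.Icc 1 (numScales n s),
      IsOptimalFilter (scale n k) s (center n k) y (φpos k) ∧
      IsOptimalFilter (scale n k) s (-center n k) y (φneg k)) ∧
    (∀ t : ℤ, |t| ≤ (n : ℤ) → z t = conv φ y t) ∧
    (∀ k ∈ Finset.Icc 1 (numScales n s), ∀ t : ℤ,
      2 * (n : ℤ) - (scale n (k - 1) : ℤ) < t → t ≤ 2 * (n : ℤ) - (scale n k : ℤ) →
        z t = conv (φpos k) y t) ∧
    (∀ k ∈ Finset.Icc 1 (numScales n s), ∀ t : ℤ,
      (scale n k : ℤ) - 2 * (n : ℤ) ≤ t → t < (scale n (k - 1) : ℤ) - 2 * (n : ℤ) →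
        z t = conv (φneg k) y t) ∧
    (∀ t : ℤ, 2 * (n : ℤ) - 9 * (s : ℤ) < |t| → |t| ≤ 2 * (n : ℤ) → z t = y t)

/-! ### Observations and risk -/

/-- The observation domain `{-N, ..., N}`. -/
abbrev Window (N : ℕ) : Type := Finset.Icc (-(N : ℤ)) (N : ℤ)

/-- Extension by zero of a sequence observed on `{-N, ..., N}`. -/
def extend {N : ℕ} (y : Window N → ℂ) : ℤ → ℂ := fun t =>
  if h : t ∈ Finset.Icc (-(N : ℤ)) (N : ℤ) then y ⟨t, h⟩ else 0

/-- The law of a standard complex Gaussian: the real and the imaginary part are independent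
real standard Gaussians, so that the squared modulus has the chi-square law with two degrees
of freedom. -/
def complexGaussian : Measure ℂ :=
  ((gaussianReal 0 1).prod (gaussianReal 0 1)).map (fun p : ℝ × ℝ => (⟨p.1, p.2⟩ : ℂ))

/-- The law of the noise on `{-N, ..., N}`: independent standard complex Gaussians. -/
def noiseLaw (N : ℕ) : Measure (Window N → ℂ) := Measure.pi (fun _ => complexGaussian)

/-- The observations `y_t = x_t + σ ξ_t`, `|t| ≤ N`. -/
def observe {N : ℕ} (σ : ℝ) (x : ℤ → ℂ) (ξ : Window N → ℂ) : Window N → ℂ :=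
  fun t => x (t : ℤ) + (σ : ℂ) * ξ t

/-- An estimator on `[-2n, 2n]` that outputs, for any observations, a multiscale full-domain
estimate (with an arbitrary choice among the optimal filters). -/
def IsFullEstimator (n s : ℕ) (xhat : (Window (2 * n) → ℂ) → ℤ → ℂ) : Prop :=
  ∀ y : Window (2 * n) → ℂ, IsFullEstimate n s (extend y) (xhat y)

/-- The worst-case `δ`-risk over `X` of an estimator based on the observations on
`{-N, ..., N}`: the infimum of the `ε > 0` such that for all `x ∈ X` the mean-squared error on
`{-N, ..., N}` exceeds `ε` with probability at most `δ`. It is `∞` if no finite `ε` will do. -/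
def deltaRisk (N : ℕ) (δ σ : ℝ) (xhat : (Window N → ℂ) → ℤ → ℂ) (X : Set (ℤ → ℂ)) : ℝ≥0∞ :=
  sInf {ε : ℝ≥0∞ | 0 < ε ∧ ∀ x ∈ X,
    noiseLaw N {ξ | ε < ENNReal.ofReal
      ((l2 N (fun t => xhat (observe σ x ξ) t - x t)) ^ 2 / (2 * (N : ℝ) + 1))} ≤
        ENNReal.ofReal δ}

/-- The minimax `δ`-risk over `X`: the infimum of the worst-case `δ`-risk over all measurable
estimators with values in `X`. -/
def minimaxRisk (N : ℕ) (δ σ : ℝ) (X : Set (ℤ → ℂ)) : ℝ≥0∞ :=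
  ⨅ (xhat : (Window N → ℂ) → ℤ → ℂ) (_ : Measurable xhat) (_ : ∀ y, xhat y ∈ X),
    deltaRisk N δ σ xhat X

/-- The bound on the squared `ℓ²` error on `[-2n, 2n]`. -/
def errorBound (n s : ℕ) (δ σ : ℝ) : ℝ :=
  160 * cStar ^ 2 * σ ^ 2 *
    (4 * (s : ℝ) * Real.log (2 * (n : ℝ) + 1) + 10 * (s : ℝ) + Real.log δ⁻¹) *
    Real.log (9 * Real.exp 4 * (s : ℝ)) ^ 2 * Real.logb 3 ((n : ℝ) / (s : ℝ))

end Denoise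

end

namespace Denoise

/-! ### Gaussian quadratic forms -/

/-! Both claims rest on one deterministic object and one supremum. The object is a reproducing
filter (`exists_reproducing_filter`): for a shift-invariant subspace of dimension at most `d`,
averaging the rows of an orthogonal projector gives a filter that fixes the subspace and whose
Fourier transform is O(1/√(2m+1)) in sup norm and O(d/√(2m+1)) in `ℓ¹`. Having both bounds, rather
than an `ℓ¹` bound alone, is what keeps the losses logarithmic.

The supremum is that of a noise functional over all filters with such a spectrum. A data-driven
filter depends on the noise, so tail bounds for a fixed filter do not apply. But a linear functional
on the set cut out by the two norms is dominated by its value at a filter with only `r` nonzero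
Fourier coefficients, each a corner of a square (`exists_atom_re_le`). There are at most
`(4(2m+1))^r` such filters, so a union bound costs about `r log m`. For one sparse filter, the
symbol between grid points is a sum of `r` Dirichlet kernels, hence O(log r)
(`sum_norm_dirichlet_le`); its energy is `2r/(2m+1)`, so over an interval of `2m+1` points the
Frobenius norm squared is O(r). Chernoff bounds for Gaussian quadratic forms turn these two numbers
into tails.

Claim (i). Comparing the residual of an optimal filter with that of the reproducing filter bounds
the squared error by the energy of the filtered noise, the chaos `⟨ξ, φ * ξ⟩`, and the correlation
of the noise with the bias `x - φ * x`, which remains in the fixed subspace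
(`norm_sq_le_of_residual_le`, `optimalFilter_error_le`). The intervals of the filters cover
everything but at most `18s` edge points, where the raw noise is paid; summing over the scales gives
the factor `log₃(n/s)` (`fullEstimate_error_le`, `fullEstimator_tail`).

Claim (ii) does not use the filtering estimator. It uses a measurable approximate least-squares fit,
whose deviation from the truth lies in a shift-invariant subspace of dimension at most `2s`. This
subspace is random, so the correlation with the noise must be bounded uniformly over all such
subspaces (`exists_uniform_bad_event`). The window is cut into dyadic shells by distance to its
endpoints; on each shell the deviation equals its image under a reproducing filter short enough to
stay inside the window. Moving the filter onto the noise reduces the supremum to sparse filters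
again, and Cauchy–Schwarz over about `log(n/s)` shells yields the last factor. -/

theorem complexGaussian_eq_stdGaussian : complexGaussian = stdGaussian ℂ := by
  rw [stdGaussian_eq_map_pi_orthonormalBasis Complex.orthonormalBasisOneI, complexGaussian]
  have h := (measurePreserving_finTwoArrow (gaussianReal 0 1)).map_eq
  have hm : Measurable (fun p : ℝ × ℝ => (⟨p.1, p.2⟩ : ℂ)) :=
    Complex.measurableEquivRealProd.symm.measurable
  rw [← h, Measure.map_map hm (by fun_prop)]
  congr 1
  funext x
  simp [Complex.ext_iff]

instance : IsProbabilityMeasure complexGaussian := by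
  rw [complexGaussian_eq_stdGaussian]; infer_instance

section Quadratic

variable {ι : Type*} [Fintype ι]

/-- Characteristic functions multiply over coordinates, and the product depends only on the
Euclidean norm. Recognising `stdGaussian` makes its invariance under isometries available. -/
theorem map_toLp_pi_complexGaussian :
    (Measure.pi (fun _ : ι => complexGaussian)).map (WithLp.toLp 2) =
      stdGaussian (PiLp 2 (fun _ : ι => ℂ)) := by
  have : IsProbabilityMeasure
      ((Measure.pi (fun _ : ι => complexGaussian)).map (WithLp.toLp 2)) :=
    Measure.isProbabilityMeasure_map (by fun_prop)
  apply Measure.ext_of_charFun (E := PiLp 2 (fun _ : ι => ℂ))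
  ext t
  simp_rw [complexGaussian_eq_stdGaussian, charFun_stdGaussian, charFun_pi, charFun_stdGaussian,
    ← Complex.exp_sum, ← Complex.ofReal_pow, PiLp.norm_sq_eq_of_L2]
  simp [Finset.sum_div, neg_div]

/-- The standard complex Gaussian law is invariant under unitary changes of coordinates. -/
theorem map_repr_pi_complexGaussian (b : OrthonormalBasis ι ℂ (EuclideanSpace ℂ ι)) :
    (Measure.pi (fun _ : ι => complexGaussian)).map
      (fun ξ => WithLp.ofLp (b.repr (WithLp.toLp 2 ξ))) =
      Measure.pi (fun _ : ι => complexGaussian) := by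
  -- `stdGaussian_map` is applied to a real isometry, so the unitary map is first viewed over the
  -- real scalars.
  let f : PiLp 2 (fun _ : ι => ℂ) ≃ₗᵢ[ℝ] PiLp 2 (fun _ : ι => ℂ) :=
    { toFun := b.repr
      invFun := b.repr.symm
      left_inv := b.repr.left_inv
      right_inv := b.repr.right_inv
      map_add' := b.repr.map_add
      map_smul' := fun r x => by
        have := b.repr.map_smul (r : ℂ) x
        simpa using this
      norm_map' := b.repr.norm_map }
  have hf : Measurable f := f.continuous.measurable
  have h1 : (fun ξ : ι → ℂ => WithLp.ofLp (b.repr (WithLp.toLp 2 ξ))) =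
      WithLp.ofLp ∘ f ∘ WithLp.toLp 2 := rfl
  rw [h1, ← Measure.map_map (by fun_prop) (by fun_prop), ← Measure.map_map hf (by fun_prop),
    map_toLp_pi_complexGaussian, stdGaussian_map f, ← map_toLp_pi_complexGaussian,
    Measure.map_map (by fun_prop) (by fun_prop)]
  exact Measure.map_id

theorem integrable_exp_mul_sq_gaussianReal {a : ℝ} (ha : a < 1 / 2) :
    Integrable (fun x => Real.exp (a * x ^ 2)) (gaussianReal 0 1) ∧
      ∫ x, Real.exp (a * x ^ 2) ∂(gaussianReal 0 1) = Real.sqrt ((1 - 2 * a)⁻¹) := by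
  have hb : 0 < 1 / 2 - a := by linarith
  have key : (fun x => gaussianPDFReal 0 1 x • Real.exp (a * x ^ 2)) =
      fun x => (Real.sqrt (2 * Real.pi))⁻¹ * Real.exp (-(1 / 2 - a) * x ^ 2) := by
    funext x
    rw [gaussianPDFReal, smul_eq_mul, mul_assoc, ← Real.exp_add]
    norm_num
    ring_nf
    tauto
  constructor
  · rw [gaussianReal_of_var_ne_zero _ one_ne_zero]
    rw [integrable_withDensity_iff_integrable_smul' (measurable_gaussianPDF 0 1)
      (by simp [gaussianPDF])]
    simp_rw [toReal_gaussianPDF]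
    rw [key]
    exact (integrable_exp_neg_mul_sq hb).const_mul _
  · rw [integral_gaussianReal_eq_integral_smul one_ne_zero, key, integral_const_mul,
      integral_gaussian, ← Real.sqrt_inv, ← Real.sqrt_mul (by positivity)]
    congr 1
    have : 1 - 2 * a ≠ 0 := by linarith
    have : 1 / 2 - a ≠ 0 := by linarith
    field_simp

theorem integrable_exp_mul_sq_complexGaussian {a : ℝ} (ha : a < 1 / 2) :
    Integrable (fun z : ℂ => Real.exp (a * ‖z‖ ^ 2)) complexGaussian ∧
      ∫ z : ℂ, Real.exp (a * ‖z‖ ^ 2) ∂complexGaussian = (1 - 2 * a)⁻¹ := by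
  obtain ⟨h1, h2⟩ := integrable_exp_mul_sq_gaussianReal ha
  have hm : Measurable (fun p : ℝ × ℝ => (⟨p.1, p.2⟩ : ℂ)) :=
    Complex.measurableEquivRealProd.symm.measurable
  have hsm : Continuous (fun z : ℂ => Real.exp (a * ‖z‖ ^ 2)) := by fun_prop
  have hc : (fun z : ℂ => Real.exp (a * ‖z‖ ^ 2)) ∘ (fun p : ℝ × ℝ => (⟨p.1, p.2⟩ : ℂ)) =
      fun p => Real.exp (a * p.1 ^ 2) * Real.exp (a * p.2 ^ 2) := by
    funext p
    simp only [Function.comp_apply, Complex.sq_norm, Complex.normSq_mk, ← Real.exp_add]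
    ring_nf
  unfold complexGaussian
  constructor
  · rw [integrable_map_measure hsm.aestronglyMeasurable hm.aemeasurable, hc]
    exact h1.mul_prod h1
  · rw [integral_map hm.aemeasurable hsm.aestronglyMeasurable]
    have : ∀ p : ℝ × ℝ, Real.exp (a * ‖(⟨p.1, p.2⟩ : ℂ)‖ ^ 2) =
      Real.exp (a * p.1 ^ 2) * Real.exp (a * p.2 ^ 2) := fun p => congrFun hc p
    simp_rw [this]
    rw [integral_prod_mul (fun x => Real.exp (a * x ^ 2)) (fun x => Real.exp (a * x ^ 2)), h2,
      Real.mul_self_sqrt]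
    rw [inv_nonneg]; linarith

/-- Since `(1 - x)(1 + x + x²) = 1 - x³`, the linear lower bound for `exp` suffices for negative
`x`, while positive `x` needs the quadratic one. This converts the moment generating function of
`‖ξ‖²` into first and second moments of the eigenvalues. -/
theorem inv_one_sub_le_exp {x : ℝ} (h : |x| ≤ 1 / 2) : (1 - x)⁻¹ ≤ Real.exp (x + x ^ 2) := by
  obtain ⟨h1, h2⟩ := abs_le.mp h
  have h3 : 0 < 1 - x := by linarith
  rw [inv_le_iff_one_le_mul₀ h3]
  have h4 := Real.quadratic_le_exp_of_nonneg (x := x + x ^ 2)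
  rcases le_total 0 x with hx | hx
  · have := h4 (by positivity)
    nlinarith [mul_le_mul_of_nonneg_right this h3.le, mul_nonneg hx hx,
      mul_nonneg (mul_nonneg hx hx) hx, mul_nonneg (mul_nonneg hx hx) (mul_nonneg hx hx)]
  · have h5 := Real.add_one_le_exp (x + x ^ 2)
    nlinarith [mul_le_mul_of_nonneg_right h5 h3.le, mul_nonneg (neg_nonneg.2 hx) (sq_nonneg x)]

/-- Chernoff bound for a diagonal Gaussian quadratic form. -/
theorem pi_complexGaussian_diagonal_tail (h : ι → ℝ) {Λ : ℝ} (hΛ : 0 < Λ) (hh : ∀ i, |h i| ≤ Λ)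
    (t : ℝ) :
    (Measure.pi (fun _ : ι => complexGaussian)) {ξ | t < ∑ i, h i * ‖ξ i‖ ^ 2} ≤
      ENNReal.ofReal (Real.exp (-t / (4 * Λ) + ∑ i, (h i / (2 * Λ) + (h i / (2 * Λ)) ^ 2))) := by
  set μ := Measure.pi (fun _ : ι => complexGaussian)
  -- The Chernoff parameter is `1/(4Λ)`, so that the arguments of `(1 - x)⁻¹` stay within `[-1/2,
  -- 1/2]`.
  have hx : ∀ i, |h i / (2 * Λ)| ≤ 1 / 2 := fun i => by
    rw [abs_div, abs_of_pos (by positivity : 0 < 2 * Λ), div_le_iff₀ (by positivity)]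
    linarith [hh i]
  have ha : ∀ i, h i / (4 * Λ) < 1 / 2 := fun i => by
    rw [div_lt_iff₀ (by positivity)]
    linarith [le_abs_self (h i), hh i]
  have hexp : (fun ξ : ι → ℂ => Real.exp (1 / (4 * Λ) * ∑ i, h i * ‖ξ i‖ ^ 2)) =
      fun ξ => ∏ i, Real.exp (h i / (4 * Λ) * ‖ξ i‖ ^ 2) := by
    funext ξ
    rw [← Real.exp_sum, Finset.mul_sum]
    congr 1
    refine Finset.sum_congr rfl fun i _ => by ring
  have hint : Integrable (fun ξ : ι → ℂ => Real.exp (1 / (4 * Λ) * ∑ i, h i * ‖ξ i‖ ^ 2)) μ := by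
    rw [hexp]
    exact Integrable.fintype_prod (f := fun i z => Real.exp (h i / (4 * Λ) * ‖z‖ ^ 2))
      fun i => (integrable_exp_mul_sq_complexGaussian (ha i)).1
  have hmgf : mgf (fun ξ : ι → ℂ => ∑ i, h i * ‖ξ i‖ ^ 2) μ (1 / (4 * Λ)) ≤
      Real.exp (∑ i, (h i / (2 * Λ) + (h i / (2 * Λ)) ^ 2)) := by
    rw [mgf, hexp, integral_fintype_prod_eq_prod (fun i z => Real.exp (h i / (4 * Λ) * ‖z‖ ^ 2)),
      Real.exp_sum]
    refine Finset.prod_le_prod (fun i _ => integral_nonneg fun z => (Real.exp_pos _).le)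
      fun i _ => ?_
    rw [(integrable_exp_mul_sq_complexGaussian (ha i)).2]
    have : 2 * (h i / (4 * Λ)) = h i / (2 * Λ) := by field_simp; ring
    rw [this]
    exact inv_one_sub_le_exp (hx i)
  have h1 := measure_ge_le_exp_mul_mgf t (by positivity : 0 ≤ 1 / (4 * Λ)) hint
  have h2 : μ.real {ξ | t < ∑ i, h i * ‖ξ i‖ ^ 2} ≤
      Real.exp (-t / (4 * Λ) + ∑ i, (h i / (2 * Λ) + (h i / (2 * Λ)) ^ 2)) := by
    have hsub : {ξ : ι → ℂ | t < ∑ i, h i * ‖ξ i‖ ^ 2} ⊆ {ξ | t ≤ ∑ i, h i * ‖ξ i‖ ^ 2} :=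
      fun ξ hξ => le_of_lt (Set.mem_ofPred_eq ▸ hξ)
    refine (measureReal_mono hsub (measure_ne_top _ _)).trans (h1.trans ?_)
    rw [Real.exp_add]
    have : -(1 / (4 * Λ)) * t = -t / (4 * Λ) := by ring
    rw [this]
    gcongr
  rw [← ofReal_measureReal]
  exact ENNReal.ofReal_le_ofReal h2

/-- Chernoff bound for a Hermitian Gaussian quadratic form, in terms of the eigenvalues. -/
theorem pi_complexGaussian_eigenvalues_tail [DecidableEq ι] {H : Matrix ι ι ℂ}
    (hH : H.IsHermitian) {Λ : ℝ} (hΛ : 0 < Λ) (hh : ∀ i, |hH.eigenvalues i| ≤ Λ) (t : ℝ) :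
    (Measure.pi (fun _ : ι => complexGaussian)) {ξ | t < (star ξ ⬝ᵥ H.mulVec ξ).re} ≤
      ENNReal.ofReal (Real.exp (-t / (4 * Λ) +
        ∑ i, (hH.eigenvalues i / (2 * Λ) + (hH.eigenvalues i / (2 * Λ)) ^ 2))) := by
  set b := hH.eigenvectorBasis
  have hform : ∀ ξ : ι → ℂ, (star ξ ⬝ᵥ H.mulVec ξ).re =
      ∑ i, hH.eigenvalues i * ‖(WithLp.ofLp (b.repr (WithLp.toLp 2 ξ))) i‖ ^ 2 := by
    intro ξ
    have h1 : star ξ ⬝ᵥ H.mulVec ξ =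
        inner ℂ (WithLp.toLp 2 ξ) (WithLp.toLp 2 (H.mulVec ξ)) := by
      rw [EuclideanSpace.inner_toLp_toLp, dotProduct_comm]
    rw [h1, ← b.sum_inner_mul_inner, Complex.re_sum]
    refine Finset.sum_congr rfl fun i _ => ?_
    have h2 : inner ℂ (b i) (WithLp.toLp 2 (H.mulVec ξ)) =
        (hH.eigenvalues i : ℂ) * inner ℂ (b i) (WithLp.toLp 2 ξ) := by
      rw [EuclideanSpace.inner_eq_star_dotProduct, EuclideanSpace.inner_eq_star_dotProduct]
      have h3 := hH.mulVec_eigenvectorBasis i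
      simp only
      have h4 : Matrix.vecMul (star (WithLp.ofLp (b i))) H =
          star (H.mulVec (WithLp.ofLp (b i))) := by
        rw [Matrix.star_mulVec, hH.eq]
      rw [dotProduct_comm, Matrix.dotProduct_mulVec, h4, h3]
      simp only [star_smul, smul_dotProduct, star_trivial, Complex.real_smul]
      rw [dotProduct_comm]
    rw [h2, b.repr_apply_apply, ← inner_conj_symm (WithLp.toLp 2 ξ) (b i)]
    rw [mul_left_comm, ← Complex.normSq_eq_conj_mul_self, Complex.normSq_eq_norm_sq]
    norm_cast
  have hm : Measurable (fun ξ : ι → ℂ => WithLp.ofLp (b.repr (WithLp.toLp 2 ξ))) := by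
    have : Measurable b.repr := b.repr.continuous.measurable
    fun_prop
  have hdiag := pi_complexGaussian_diagonal_tail hH.eigenvalues hΛ hh t
  rw [← map_repr_pi_complexGaussian b] at hdiag
  refine le_trans (le_of_eq ?_) hdiag
  rw [Measure.map_apply hm (measurableSet_lt (by fun_prop) (by fun_prop))]
  simp_rw [hform]
  rfl

/-- Both sides are the trace of `H²`, computed in the eigenbasis and from the entries. -/
theorem sum_eigenvalues_sq [DecidableEq ι] {H : Matrix ι ι ℂ} (hH : H.IsHermitian) :
    ∑ i, hH.eigenvalues i ^ 2 = ∑ i, ∑ j, ‖H i j‖ ^ 2 := by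
  have h1 : (H * H).trace = ∑ i, ((hH.eigenvalues i ^ 2 : ℝ) : ℂ) := by
    have h2 : H * H = Unitary.conjStarAlgAut ℂ (Matrix ι ι ℂ) hH.eigenvectorUnitary
        (Matrix.diagonal (RCLike.ofReal ∘ hH.eigenvalues) *
          Matrix.diagonal (RCLike.ofReal ∘ hH.eigenvalues)) := by
      rw [map_mul, ← hH.spectral_theorem]
    rw [h2, Unitary.conjStarAlgAut_apply, Matrix.trace_mul_cycle]
    simp [Matrix.trace, pow_two]
  have h3 : (H * H).trace = ∑ i, ∑ j, ((‖H i j‖ ^ 2 : ℝ) : ℂ) := by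
    rw [Matrix.trace]
    refine Finset.sum_congr rfl fun i _ => ?_
    rw [Matrix.diag_apply, Matrix.mul_apply]
    refine Finset.sum_congr rfl fun j _ => ?_
    have h5 := hH.apply i j
    rw [← h5, Complex.star_def, ← Complex.normSq_eq_conj_mul_self, RCLike.norm_conj,
      Complex.normSq_eq_norm_sq]
  rw [h1] at h3
  exact_mod_cast h3

theorem abs_eigenvalues_le [DecidableEq ι] {H : Matrix ι ι ℂ} (hH : H.IsHermitian) {Λ : ℝ}
    (hop : ∀ v : ι → ℂ, |(star v ⬝ᵥ H.mulVec v).re| ≤ Λ * ∑ i, ‖v i‖ ^ 2) (i : ι) :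
    |hH.eigenvalues i| ≤ Λ := by
  have h1 := hop (hH.eigenvectorBasis i)
  have h2 := hH.eigenvalues_eq i
  have h3 : ∑ j, ‖(hH.eigenvectorBasis i) j‖ ^ 2 = 1 := by
    rw [← EuclideanSpace.norm_sq_eq, hH.eigenvectorBasis.orthonormal.1 i, one_pow]
  rw [h3, mul_one] at h1
  rw [h2]
  exact h1

/-- Tail bound for the real part of a Gaussian chaos `ξ* A ξ`. -/
theorem pi_complexGaussian_chaos_tail (A : ι → ι → ℂ) {Λ F τ : ℝ} (hΛ : 0 < Λ)
    (hop : ∀ v : ι → ℂ, |(∑ i, ∑ j, star (v i) * (A i j * v j)).re| ≤ Λ * ∑ i, ‖v i‖ ^ 2)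
    (hF : ∑ i, ∑ j, ‖A i j‖ ^ 2 ≤ F) (hτ : (∑ i, A i i).re ≤ τ) (L : ℝ) :
    (Measure.pi (fun _ : ι => complexGaussian))
      {ξ | 2 * τ + F / Λ + 4 * Λ * L < (∑ i, ∑ j, star (ξ i) * (A i j * ξ j)).re} ≤
      ENNReal.ofReal (Real.exp (-L)) := by
  classical
  -- Only the Hermitian part of `A` enters the real part of the form; taking it preserves the real
  -- part of the trace and does not increase the Frobenius norm.
  let H : Matrix ι ι ℂ := Matrix.of fun i j => (A i j + star (A j i)) / 2
  have hH : H.IsHermitian := by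
    ext i j
    simp [H, Matrix.conjTranspose_apply, add_comm]
  have hform : ∀ v : ι → ℂ, (star v ⬝ᵥ H.mulVec v).re =
      (∑ i, ∑ j, star (v i) * (A i j * v j)).re := by
    intro v
    have e1 : star v ⬝ᵥ H.mulVec v = (∑ i, ∑ j, star (v i) * (A i j * v j) +
        star (∑ i, ∑ j, star (v i) * (A i j * v j))) / 2 := by
      simp only [dotProduct, Matrix.mulVec, H, Matrix.of_apply, star_sum, star_mul', star_star, Pi.star_apply]
      rw [Finset.sum_comm (f := fun i j => v i * (star (A i j) * star (v j))),
        ← Finset.sum_add_distrib, Finset.sum_div]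
      refine Finset.sum_congr rfl fun i _ => ?_
      rw [← Finset.sum_add_distrib, Finset.sum_div, Finset.mul_sum]
      refine Finset.sum_congr rfl fun j _ => ?_
      ring
    rw [e1, Complex.div_ofNat_re, Complex.add_re, Complex.star_def, Complex.conj_re]
    ring
  have hev := abs_eigenvalues_le hH (Λ := Λ) fun v => by rw [hform]; exact hop v
  have htr : ∑ i, hH.eigenvalues i ≤ τ := by
    have h1 := hH.trace_eq_sum_eigenvalues
    have h2 : H.trace.re = (∑ i, A i i).re := by
      simp [Matrix.trace, H]
    rw [h1] at h2
    rw [← h2] at hτ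
    simpa using hτ
  have hsq : ∑ i, hH.eigenvalues i ^ 2 ≤ F := by
    rw [sum_eigenvalues_sq hH]
    refine le_trans ?_ hF
    have h1 : ∀ i j, ‖H i j‖ ^ 2 ≤ (‖A i j‖ ^ 2 + ‖A j i‖ ^ 2) / 2 := fun i j => by
      have h2 : ‖H i j‖ ≤ (‖A i j‖ + ‖A j i‖) / 2 := by
        simp only [H, Matrix.of_apply, norm_div, Complex.norm_ofNat]
        have := norm_add_le (A i j) (star (A j i))
        rw [norm_star] at this
        linarith
      have h3 := pow_le_pow_left₀ (norm_nonneg _) h2 2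
      nlinarith [sq_nonneg (‖A i j‖ - ‖A j i‖)]
    calc ∑ i, ∑ j, ‖H i j‖ ^ 2 ≤ ∑ i, ∑ j, (‖A i j‖ ^ 2 + ‖A j i‖ ^ 2) / 2 :=
          Finset.sum_le_sum fun i _ => Finset.sum_le_sum fun j _ => h1 i j
      _ = ∑ i, ∑ j, ‖A i j‖ ^ 2 := by
          simp_rw [← Finset.sum_div, Finset.sum_add_distrib]
          rw [Finset.sum_comm (f := fun i j => ‖A j i‖ ^ 2)]
          ring
  have hmain := pi_complexGaussian_eigenvalues_tail hH hΛ hev (2 * τ + F / Λ + 4 * Λ * L)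
  simp_rw [hform] at hmain
  refine hmain.trans (ENNReal.ofReal_le_ofReal (Real.exp_le_exp.2 ?_))
  have e2 : ∑ i, (hH.eigenvalues i / (2 * Λ) + (hH.eigenvalues i / (2 * Λ)) ^ 2) =
      (∑ i, hH.eigenvalues i) / (2 * Λ) + (∑ i, hH.eigenvalues i ^ 2) / (4 * Λ ^ 2) := by
    rw [Finset.sum_add_distrib, Finset.sum_div, Finset.sum_div]
    congr 1
    refine Finset.sum_congr rfl fun i _ => by ring
  have e3 : -(2 * τ + F / Λ + 4 * Λ * L) / (4 * Λ) = -L - τ / (2 * Λ) - F / (4 * Λ ^ 2) := by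
    field_simp
    ring
  rw [e2, e3]
  have h5 : (∑ i, hH.eigenvalues i) / (2 * Λ) ≤ τ / (2 * Λ) := by gcongr
  have h6 : (∑ i, hH.eigenvalues i ^ 2) / (4 * Λ ^ 2) ≤ F / (4 * Λ ^ 2) := by gcongr
  linarith

/-- Tail bound for the squared norm of a linear image of a Gaussian vector. -/
theorem pi_complexGaussian_norm_sq_tail {κ : Type*} [Fintype κ] (A : κ → ι → ℂ) {V F : ℝ}
    (hV : 0 < V)
    (hop : ∀ v : ι → ℂ, ∑ k, ‖∑ i, A k i * v i‖ ^ 2 ≤ V * ∑ i, ‖v i‖ ^ 2)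
    (hF : ∑ k, ∑ i, ‖A k i‖ ^ 2 ≤ F) (L : ℝ) :
    (Measure.pi (fun _ : ι => complexGaussian))
      {ξ | 3 * F + 4 * V * L < ∑ k, ‖∑ i, A k i * ξ i‖ ^ 2} ≤
      ENNReal.ofReal (Real.exp (-L)) := by
  classical
  let M : Matrix κ ι ℂ := Matrix.of A
  let H : Matrix ι ι ℂ := M.conjTranspose * M
  have hH : H.IsHermitian := Matrix.isHermitian_conjTranspose_mul_self M
  have hform : ∀ v : ι → ℂ, (star v ⬝ᵥ H.mulVec v).re = ∑ k, ‖∑ i, A k i * v i‖ ^ 2 := by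
    intro v
    have e1 : star v ⬝ᵥ H.mulVec v = star (M.mulVec v) ⬝ᵥ M.mulVec v := by
      rw [← Matrix.mulVec_mulVec, Matrix.dotProduct_mulVec, Matrix.star_mulVec]
    rw [e1, dotProduct, Complex.re_sum]
    refine Finset.sum_congr rfl fun k _ => ?_
    rw [Pi.star_apply, Complex.star_def, ← Complex.normSq_eq_conj_mul_self,
      Complex.normSq_eq_norm_sq, Complex.ofReal_re]
    rfl
  have hev := abs_eigenvalues_le hH (Λ := V) fun v => by
    rw [hform, abs_of_nonneg (by positivity)]; exact hop v
  have hpos : ∀ i, 0 ≤ hH.eigenvalues i := fun i => by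
    rw [hH.eigenvalues_eq i]
    refine le_of_le_of_eq ?_ (hform _).symm
    positivity
  have htr : ∑ i, hH.eigenvalues i ≤ F := by
    refine le_trans (le_of_eq ?_) hF
    have h1 := hH.trace_eq_sum_eigenvalues
    have h2 : H.trace = ∑ i, ∑ k, ((‖A k i‖ ^ 2 : ℝ) : ℂ) := by
      rw [Matrix.trace]
      refine Finset.sum_congr rfl fun i _ => ?_
      rw [Matrix.diag_apply]
      change (M.conjTranspose * M) i i = _
      rw [Matrix.mul_apply]
      refine Finset.sum_congr rfl fun k _ => ?_
      rw [Matrix.conjTranspose_apply, Complex.star_def, ← Complex.normSq_eq_conj_mul_self,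
        Complex.normSq_eq_norm_sq]
      rfl
    rw [h1] at h2
    rw [Finset.sum_comm]
    have h7 := congrArg Complex.re h2
    simp only [Complex.re_sum, Complex.ofReal_re] at h7
    exact h7
  have hmain := pi_complexGaussian_eigenvalues_tail hH hV hev (3 * F + 4 * V * L)
  simp_rw [hform] at hmain
  refine hmain.trans (ENNReal.ofReal_le_ofReal (Real.exp_le_exp.2 ?_))
  -- Here the eigenvalues lie in `[0, V]`, so `x + x² ≤ 3x/2` and the trace alone controls both
  -- orders. This is the source of `3 * F`.
  have e2 : ∑ i, (hH.eigenvalues i / (2 * V) + (hH.eigenvalues i / (2 * V)) ^ 2) ≤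
      ∑ i, hH.eigenvalues i * (3 / (4 * V)) := by
    refine Finset.sum_le_sum fun i _ => ?_
    have h3 : hH.eigenvalues i / (2 * V) ≤ 1 / 2 := by
      rw [div_le_iff₀ (by positivity)]
      linarith [le_abs_self (hH.eigenvalues i), hev i]
    have h4 : 0 ≤ hH.eigenvalues i / (2 * V) := div_nonneg (hpos i) (by positivity)
    have h5 : hH.eigenvalues i * (3 / (4 * V)) = hH.eigenvalues i / (2 * V) * (3 / 2) := by
      field_simp; ring
    rw [h5]
    nlinarith
  rw [← Finset.sum_mul] at e2
  have h6 : (∑ i, hH.eigenvalues i) * (3 / (4 * V)) ≤ F * (3 / (4 * V)) := by gcongr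
  have e3 : -(3 * F + 4 * V * L) / (4 * V) = -L - F * (3 / (4 * V)) := by
    field_simp
    ring
  rw [e3]
  linarith

end Quadratic

/-! ### Characters and the discrete Fourier transform -/

/-- The character `τ ↦ exp(iθτ)` of the integers. -/
noncomputable def chi (θ : ℝ) (τ : ℤ) : ℂ := Complex.exp (((θ * τ : ℝ) : ℂ) * Complex.I)

theorem norm_chi (θ : ℝ) (τ : ℤ) : ‖chi θ τ‖ = 1 := Complex.norm_exp_ofReal_mul_I _

theorem chi_add (θ : ℝ) (a b : ℤ) : chi θ (a + b) = chi θ a * chi θ b := by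
  rw [chi, chi, chi, ← Complex.exp_add]; push_cast; ring_nf

theorem chi_add_freq (θ η : ℝ) (a : ℤ) : chi (θ + η) a = chi θ a * chi η a := by
  rw [chi, chi, chi, ← Complex.exp_add]; push_cast; ring_nf

theorem star_chi (θ : ℝ) (τ : ℤ) : star (chi θ τ) = chi (-θ) τ := by
  rw [chi, chi, Complex.star_def, ← Complex.exp_conj]
  simp

theorem chi_zero (θ : ℝ) : chi θ 0 = 1 := by simp [chi]

theorem chi_zero_freq (τ : ℤ) : chi 0 τ = 1 := by simp [chi]

theorem chi_neg (θ : ℝ) (τ : ℤ) : chi θ (-τ) = chi (-θ) τ := by simp [chi]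

theorem chi_natCast (θ : ℝ) (j : ℕ) : chi θ j = chi θ 1 ^ j := by
  rw [chi, chi, ← Complex.exp_nat_mul]; push_cast; ring_nf

theorem chi_swap (x : ℝ) (a b : ℤ) : chi (x * a) b = chi (x * b) a := by
  rw [chi, chi]; congr 3; ring

theorem sum_Icc_eq_sum_range {E : Type*} [AddCommMonoid E] (m : ℕ) (f : ℤ → E) :
    ∑ τ ∈ Finset.Icc (-(m : ℤ)) m, f τ = ∑ j ∈ Finset.range (2 * m + 1), f ((j : ℤ) - m) := by
  refine (Finset.sum_bij (fun (j : ℕ) _ => (j : ℤ) - m) ?_ ?_ ?_ fun _ _ => rfl).symm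
  · intro j hj
    rw [Finset.mem_range] at hj
    rw [Finset.mem_Icc]; omega
  · intro a _ b _ h
    simpa using h
  · intro t ht
    rw [Finset.mem_Icc] at ht
    refine ⟨(t + m).toNat, ?_, ?_⟩
    · rw [Finset.mem_range]; omega
    · omega

/-- The ratio of this geometric sum is an `M`-th root of unity, different from 1 because `M` does
not divide `d`. -/
theorem sum_range_chi {M : ℕ} {d : ℤ} (hd : d ≠ 0) (hM : |d| < M) :
    ∑ j ∈ Finset.range M, chi (2 * Real.pi / M * d) j = 0 := by
  have hM0 : M ≠ 0 := by rintro rfl; have := abs_nonneg d; omega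
  have hp := Complex.isPrimitiveRoot_exp M hM0
  have h1 : chi (2 * Real.pi / M * d) 1 = Complex.exp (2 * Real.pi * Complex.I / M) ^ d := by
    rw [chi, ← Complex.exp_int_mul]; push_cast; congr 1; ring
  have h2 : chi (2 * Real.pi / M * d) 1 ≠ 1 := by
    rw [h1, Ne, hp.zpow_eq_one_iff_dvd]
    intro h
    exact hd (Int.eq_zero_of_abs_lt_dvd h hM)
  have h3 : chi (2 * Real.pi / M * d) 1 ^ M = 1 := by
    rw [h1, ← zpow_natCast, ← zpow_mul, mul_comm d, zpow_mul, zpow_natCast, hp.pow_eq_one, one_zpow]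
  simp_rw [chi_natCast]
  have h4 := mul_neg_geom_sum (chi (2 * Real.pi / M * d) 1) M
  rw [h3, sub_self, mul_eq_zero] at h4
  exact h4.resolve_left (sub_ne_zero.2 h2.symm)

/-- The `k`-th frequency of the grid of `M` points. -/
noncomputable def freq (M k : ℕ) : ℝ := 2 * Real.pi / M * (k : ℤ)

theorem sum_freq_chi (m : ℕ) {a b : ℤ} (ha : a ∈ Finset.Icc (-(m : ℤ)) m)
    (hb : b ∈ Finset.Icc (-(m : ℤ)) m) :
    ∑ k : Fin (2 * m + 1), chi (freq (2 * m + 1) k) (a - b) =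
      if a = b then ((2 * m + 1 : ℕ) : ℂ) else 0 := by
  rw [Finset.mem_Icc] at ha hb
  split_ifs with h
  · simp [h, chi_zero]
  · rw [Fin.sum_univ_eq_sum_range (fun k => chi (freq (2 * m + 1) k) (a - b))]
    simp_rw [freq, chi_swap _ _ (a - b)]
    refine sum_range_chi (sub_ne_zero.2 h) ?_
    rw [abs_lt]; push_cast; constructor <;> omega

theorem sum_Icc_chi (m : ℕ) (k l : Fin (2 * m + 1)) :
    ∑ τ ∈ Finset.Icc (-(m : ℤ)) m, chi (freq (2 * m + 1) k) τ * star (chi (freq (2 * m + 1) l) τ) =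
      if k = l then ((2 * m + 1 : ℕ) : ℂ) else 0 := by
  simp_rw [star_chi, ← chi_add_freq]
  split_ifs with h
  · simp [h, chi_zero_freq]
    have : ((m : ℤ) + 1 + m).toNat = 2 * m + 1 := by omega
    rw [this]; push_cast; ring
  · rw [sum_Icc_eq_sum_range]
    have h1 : freq (2 * m + 1) k + -freq (2 * m + 1) l =
        2 * Real.pi / (2 * m + 1 : ℕ) * (((k : ℕ) : ℤ) - ((l : ℕ) : ℤ) : ℤ) := by
      rw [freq, freq]; push_cast; ring
    rw [h1]
    simp_rw [sub_eq_add_neg _ (m : ℤ), chi_add, ← Finset.sum_mul]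
    rw [sum_range_chi, zero_mul]
    · intro h2
      apply h
      ext
      omega
    · have := k.2
      have := l.2
      rw [abs_lt]; constructor <;> omega

/-- The symbol (Fourier series) of the restriction of `φ` to `{-m, ..., m}`. -/
noncomputable def symbol (m : ℕ) (φ : ℤ → ℂ) (θ : ℝ) : ℂ :=
  ∑ τ ∈ Finset.Icc (-(m : ℤ)) m, chi (-θ) τ * φ τ

theorem dft_eq_symbol (m : ℕ) (u : ℤ → ℂ) (k : Fin (2 * m + 1)) :
    dft m u k = ((Real.sqrt (2 * (m : ℝ) + 1) : ℝ) : ℂ)⁻¹ * symbol m u (freq (2 * m + 1) k) := by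
  rw [dft, symbol]
  congr 1
  refine Finset.sum_congr rfl fun τ _ => ?_
  rw [chi, freq]
  congr 2
  push_cast
  ring

theorem sum_norm_sq_symbol (m : ℕ) (u : ℤ → ℂ) :
    ∑ k : Fin (2 * m + 1), ‖symbol m u (freq (2 * m + 1) k)‖ ^ 2 =
      (2 * m + 1) * ∑ τ ∈ Finset.Icc (-(m : ℤ)) m, ‖u τ‖ ^ 2 := by
  have h : ∑ k : Fin (2 * m + 1), ((‖symbol m u (freq (2 * m + 1) k)‖ ^ 2 : ℝ) : ℂ) =
      ((2 * m + 1 : ℕ) : ℂ) * ∑ τ ∈ Finset.Icc (-(m : ℤ)) m, ((‖u τ‖ ^ 2 : ℝ) : ℂ) := by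
    have h1 : ∀ k : Fin (2 * m + 1), ((‖symbol m u (freq (2 * m + 1) k)‖ ^ 2 : ℝ) : ℂ) =
        ∑ a ∈ Finset.Icc (-(m : ℤ)) m, ∑ b ∈ Finset.Icc (-(m : ℤ)) m,
          star (u a) * u b * chi (freq (2 * m + 1) k) (a - b) := by
      intro k
      rw [← Complex.normSq_eq_norm_sq, Complex.normSq_eq_conj_mul_self, ← Complex.star_def, symbol,
        star_sum, Finset.sum_mul_sum]
      refine Finset.sum_congr rfl fun a _ => Finset.sum_congr rfl fun b _ => ?_
      rw [star_mul', star_chi, neg_neg, sub_eq_add_neg, chi_add, chi_neg]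
      ring
    simp_rw [h1]
    rw [Finset.sum_comm, Finset.mul_sum]
    refine Finset.sum_congr rfl fun a ha => ?_
    rw [Finset.sum_comm, Finset.sum_eq_single a]
    · rw [← Finset.mul_sum, sum_freq_chi m ha ha, if_pos rfl, ← Complex.normSq_eq_norm_sq,
        Complex.normSq_eq_conj_mul_self, ← Complex.star_def]
      ring
    · intro b hb hba
      rw [← Finset.mul_sum, sum_freq_chi m ha hb, if_neg (Ne.symm hba), mul_zero]
    · exact fun h => absurd ha h
  exact_mod_cast h

theorem sum_norm_sq_dft (m : ℕ) (u : ℤ → ℂ) :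
    ∑ k, ‖dft m u k‖ ^ 2 = ∑ τ ∈ Finset.Icc (-(m : ℤ)) m, ‖u τ‖ ^ 2 := by
  have hpos : (0 : ℝ) < 2 * m + 1 := by positivity
  simp_rw [dft_eq_symbol, norm_mul, mul_pow]
  rw [← Finset.mul_sum, sum_norm_sq_symbol, norm_inv, Complex.norm_real, Real.norm_eq_abs, inv_pow,
    sq_abs, Real.sq_sqrt hpos.le, ← mul_assoc, inv_mul_cancel₀ hpos.ne', one_mul]

/-- Fourier inversion. -/
theorem dft_inversion (m : ℕ) (u : ℤ → ℂ) {τ : ℤ} (hτ : τ ∈ Finset.Icc (-(m : ℤ)) m) :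
    u τ = ∑ k, dft m u k *
      (((Real.sqrt (2 * (m : ℝ) + 1) : ℝ) : ℂ)⁻¹ * chi (freq (2 * m + 1) k) τ) := by
  have hpos : (0 : ℝ) < 2 * m + 1 := by positivity
  have hs : ((Real.sqrt (2 * (m : ℝ) + 1) : ℝ) : ℂ) * ((Real.sqrt (2 * (m : ℝ) + 1) : ℝ) : ℂ) =
      ((2 * m + 1 : ℕ) : ℂ) := by
    rw [← Complex.ofReal_mul, Real.mul_self_sqrt hpos.le]; push_cast; rfl
  have hne : ((2 * m + 1 : ℕ) : ℂ) ≠ 0 := by exact_mod_cast (Nat.succ_ne_zero (2 * m))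
  have h1 : ∀ k : Fin (2 * m + 1), dft m u k *
      (((Real.sqrt (2 * (m : ℝ) + 1) : ℝ) : ℂ)⁻¹ * chi (freq (2 * m + 1) k) τ) =
      ∑ a ∈ Finset.Icc (-(m : ℤ)) m,
        ((2 * m + 1 : ℕ) : ℂ)⁻¹ * u a * chi (freq (2 * m + 1) k) (τ - a) := by
    intro k
    rw [dft_eq_symbol, symbol, ← hs, mul_inv]
    rw [mul_mul_mul_comm, Finset.sum_mul, Finset.mul_sum]
    refine Finset.sum_congr rfl fun a _ => ?_
    rw [sub_eq_add_neg, chi_add, chi_neg]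
    ring
  simp_rw [h1]
  rw [Finset.sum_comm, Finset.sum_eq_single τ]
  · rw [← Finset.mul_sum, sum_freq_chi m hτ hτ, if_pos rfl]
    field_simp
  · intro b hb hbτ
    rw [← Finset.mul_sum, sum_freq_chi m hτ hb, if_neg (Ne.symm hbτ), mul_zero]
  · exact fun h => absurd hτ h

/-- Parseval's identity for a trigonometric sum. -/
theorem sum_norm_sq_trigonometric (m : ℕ) (a : Fin (2 * m + 1) → ℂ) :
    ∑ τ ∈ Finset.Icc (-(m : ℤ)) m, ‖∑ k, a k * chi (freq (2 * m + 1) k) τ‖ ^ 2 =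
      (2 * m + 1) * ∑ k, ‖a k‖ ^ 2 := by
  have h : ∑ τ ∈ Finset.Icc (-(m : ℤ)) m,
      ((‖∑ k, a k * chi (freq (2 * m + 1) k) τ‖ ^ 2 : ℝ) : ℂ) =
      ((2 * m + 1 : ℕ) : ℂ) * ∑ k, ((‖a k‖ ^ 2 : ℝ) : ℂ) := by
    have h1 : ∀ τ : ℤ, ((‖∑ k, a k * chi (freq (2 * m + 1) k) τ‖ ^ 2 : ℝ) : ℂ) =
        ∑ k, ∑ l, star (a l) * a k *
          (chi (freq (2 * m + 1) k) τ * star (chi (freq (2 * m + 1) l) τ)) := by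
      intro τ
      rw [← Complex.normSq_eq_norm_sq, ← Complex.mul_conj, ← Complex.star_def,
        star_sum, Finset.sum_mul_sum]
      refine Finset.sum_congr rfl fun a _ => Finset.sum_congr rfl fun b _ => ?_
      rw [star_mul']
      ring
    simp_rw [h1]
    rw [Finset.sum_comm, Finset.mul_sum]
    refine Finset.sum_congr rfl fun k _ => ?_
    rw [Finset.sum_comm, Finset.sum_eq_single k]
    · rw [← Finset.mul_sum, sum_Icc_chi, if_pos rfl, ← Complex.normSq_eq_norm_sq,
        Complex.normSq_eq_conj_mul_self, ← Complex.star_def]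
      ring
    · intro l _ hl
      rw [← Finset.mul_sum, sum_Icc_chi, if_neg (Ne.symm hl), mul_zero]
    · exact fun h => absurd (Finset.mem_univ _) h
  exact_mod_cast h

/-! ### Convolutions -/

theorem bandLimited_iff {n : ℕ} {u : ℤ → ℂ} :
    BandLimited n u ↔ ∀ t, t ∉ Finset.Icc (-(n : ℤ)) n → u t = 0 := by
  refine forall_congr' fun t => ?_
  rw [Finset.mem_Icc, ← abs_le, not_le]

theorem finsum_eq_sum_of_bandLimited {n : ℕ} {u : ℤ → ℂ} (hu : BandLimited n u) :
    ∑ᶠ t, u t = ∑ t ∈ Finset.Icc (-(n : ℤ)) n, u t := by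
  refine finsum_eq_sum_of_support_subset _ fun t ht => ?_
  by_contra h
  exact ht (bandLimited_iff.1 hu t (by simpa using h))

theorem BandLimited.mono {n N : ℕ} {u : ℤ → ℂ} (hu : BandLimited n u) (h : n ≤ N) :
    BandLimited N u := fun t ht => hu t (by omega)

theorem conv_eq_sum {m : ℕ} {φ : ℤ → ℂ} (hφ : BandLimited m φ) (v : ℤ → ℂ) (t : ℤ) :
    conv φ v t = ∑ τ ∈ Finset.Icc (-(m : ℤ)) m, φ τ * v (t - τ) :=
  finsum_eq_sum_of_bandLimited (fun τ hτ => by rw [hφ τ hτ, zero_mul])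

theorem conv_comm (φ v : ℤ → ℂ) (t : ℤ) : conv φ v t = conv v φ t := by
  rw [conv, conv, ← finsum_comp_equiv (Equiv.subLeft t)]
  refine finsum_congr fun τ => ?_
  simp [mul_comm]

theorem conv_bandLimited {m N : ℕ} {φ v : ℤ → ℂ} (hφ : BandLimited m φ) (hv : BandLimited N v) :
    BandLimited (N + m) (conv φ v) := by
  intro t ht
  rw [conv_eq_sum hφ]
  refine Finset.sum_eq_zero fun τ hτ => ?_
  rw [hv, mul_zero]
  rw [Finset.mem_Icc, ← abs_le] at hτ
  have := abs_sub_abs_le_abs_sub t τ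
  push_cast at ht
  omega

theorem symbol_eq_finsum {m : ℕ} {u : ℤ → ℂ} (hu : BandLimited m u) (θ : ℝ) :
    symbol m u θ = ∑ᶠ τ, chi (-θ) τ * u τ :=
  (finsum_eq_sum_of_bandLimited (u := fun τ => chi (-θ) τ * u τ)
    (fun τ hτ => by simp [hu τ hτ])).symm

/-- The enlarged window contains the whole support of the convolution, so nothing wraps around and
the product formula is exact at every `θ`, on the grid or off it. -/
theorem symbol_conv {m N : ℕ} {φ v : ℤ → ℂ} (hφ : BandLimited m φ) (hv : BandLimited N v) (θ : ℝ) :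
    symbol (N + m) (conv φ v) θ = symbol m φ θ * symbol (N + m) v θ := by
  have hv' := hv.mono (Nat.le_add_right N m)
  have h1 : symbol (N + m) (conv φ v) θ = ∑ τ ∈ Finset.Icc (-(m : ℤ)) m,
      ∑ t ∈ Finset.Icc (-((N + m : ℕ) : ℤ)) (N + m : ℕ), chi (-θ) t * (φ τ * v (t - τ)) := by
    rw [symbol, Finset.sum_comm]
    refine Finset.sum_congr rfl fun t _ => ?_
    rw [conv_eq_sum hφ, Finset.mul_sum]
  rw [h1, symbol, Finset.sum_mul]
  refine Finset.sum_congr rfl fun τ hτ => ?_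
  rw [Finset.mem_Icc, ← abs_le] at hτ
  rw [← finsum_eq_sum_of_bandLimited, symbol_eq_finsum hv',
    ← finsum_comp_equiv (Equiv.addRight τ), mul_finsum']
  · refine finsum_congr fun t => ?_
    simp only [Equiv.coe_addRight, add_sub_cancel_right, chi_add]
    ring
  · refine (Finset.finite_toSet (Finset.Icc (-((N + m : ℕ) : ℤ)) (N + m : ℕ))).subset fun t ht => ?_
    by_contra h
    exact ht (by
      simp only
      rw [bandLimited_iff.1 hv' t (by simpa using h), mul_zero])
  · intro t ht
    have := abs_sub_abs_le_abs_sub t τ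
    push_cast at ht
    have hz : v (t - τ) = 0 := hv _ (by omega)
    simp [hz]

/-- The convolution by a filter is bounded on `ℓ²` by the maximum of its symbol. -/
theorem sum_norm_sq_conv_le {m N : ℕ} {φ v : ℤ → ℂ} (hφ : BandLimited m φ) (hv : BandLimited N v)
    {Λ : ℝ} (hΛ : ∀ θ, ‖symbol m φ θ‖ ≤ Λ) (J : Finset ℤ) :
    ∑ t ∈ J, ‖conv φ v t‖ ^ 2 ≤ Λ ^ 2 * ∑ t ∈ Finset.Icc (-(N : ℤ)) N, ‖v t‖ ^ 2 := by
  have hb := conv_bandLimited hφ hv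
  have h1 : ∑ t ∈ J, ‖conv φ v t‖ ^ 2 ≤
      ∑ t ∈ Finset.Icc (-((N + m : ℕ) : ℤ)) (N + m : ℕ), ‖conv φ v t‖ ^ 2 := by
    refine (Finset.sum_le_sum_of_subset_of_nonneg Finset.subset_union_left
      fun _ _ _ => by positivity).trans
      (le_of_eq (Finset.sum_subset (s₁ := Finset.Icc (-((N + m : ℕ) : ℤ)) (N + m : ℕ))
        (s₂ := J ∪ Finset.Icc (-((N + m : ℕ) : ℤ)) (N + m : ℕ))
        Finset.subset_union_right fun t _ ht => ?_).symm)
    rw [bandLimited_iff.1 hb t ht]; simp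
  have h2 : ∑ t ∈ Finset.Icc (-((N + m : ℕ) : ℤ)) (N + m : ℕ), ‖v t‖ ^ 2 =
      ∑ t ∈ Finset.Icc (-(N : ℤ)) N, ‖v t‖ ^ 2 := by
    refine (Finset.sum_subset (fun t ht => ?_) fun t _ ht => ?_).symm
    · rw [Finset.mem_Icc] at *; push_cast; omega
    · rw [bandLimited_iff.1 hv t ht]; simp
  refine h1.trans ?_
  -- Parseval is used on the grid of the enlarged window, not on that of `φ`; hence the symbol of
  -- `φ` has to be bounded at all frequencies.
  rw [← h2, ← sum_norm_sq_dft, ← sum_norm_sq_dft, Finset.mul_sum]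
  refine Finset.sum_le_sum fun k _ => ?_
  rw [dft_eq_symbol, dft_eq_symbol, symbol_conv hφ hv, mul_left_comm, norm_mul, mul_pow]
  gcongr
  exact hΛ _

/-! ### Reproducing filters of shift-invariant subspaces -/

/-- The delay is injective and maps the finite-dimensional `X` into itself, hence onto itself; so
forward shifts stay in `X` as well. -/
theorem IsShiftInvariant.translate_mem {X : Submodule ℂ (ℤ → ℂ)} (hX : IsShiftInvariant X)
    [FiniteDimensional ℂ X] {x : ℤ → ℂ} (hx : x ∈ X) (a : ℤ) : (fun t => x (t + a)) ∈ X := by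
  let D : (ℤ → ℂ) ≃ₗ[ℂ] (ℤ → ℂ) := LinearEquiv.funCongrLeft ℂ ℂ (Equiv.subRight (1 : ℤ))
  have hmap : X.map D.toLinearMap = X := by
    refine Submodule.eq_of_le_of_finrank_eq ?_ (LinearEquiv.finrank_map_eq D X)
    rintro _ ⟨u, hu, rfl⟩
    exact hX u hu
  have hsucc : ∀ u ∈ X, (fun t => u (t + 1)) ∈ X := by
    intro u hu
    rw [← hmap] at hu
    obtain ⟨w, hw, rfl⟩ := hu
    have e : (fun t => D.toLinearMap w (t + 1)) = w := by
      funext t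
      exact congrArg w (add_sub_cancel_right t 1)
    rwa [e]
  have hnat : ∀ n : ℕ, (fun t => x (t + n)) ∈ X ∧ (fun t => x (t - n)) ∈ X := by
    intro n
    induction n with
    | zero => simpa using hx
    | succ n ih =>
      refine ⟨?_, ?_⟩
      · convert hsucc _ ih.1 using 3
        push_cast; ring
      · convert hX _ ih.2 using 1
        funext t
        simp only [delay]
        congr 1
        push_cast; ring
  obtain ⟨n, rfl | rfl⟩ := a.eq_nat_or_neg
  · exact (hnat n).1
  · simpa [sub_eq_add_neg] using (hnat n).2

/-- The projector onto the restriction of `X` to `{0, ..., m}` in coordinates. -/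
theorem exists_projector (X : Submodule ℂ (ℤ → ℂ)) [FiniteDimensional ℂ X] {d : ℕ}
    (hd : Module.finrank ℂ X ≤ d) (I : Finset ℤ) :
    ∃ (κ : ℕ) (β : Fin κ → ℤ → ℂ), κ ≤ d ∧
      (∀ i t, t ∉ I → β i t = 0) ∧
      (∀ i, ∑ t ∈ I, ‖β i t‖ ^ 2 = 1) ∧
      (∀ v : ℤ → ℂ, ∑ i, ‖∑ t ∈ I, star (β i t) * v t‖ ^ 2 ≤ ∑ t ∈ I, ‖v t‖ ^ 2) ∧
      ∀ x ∈ X, ∀ t ∈ I, x t = ∑ i, β i t * ∑ t' ∈ I, star (β i t') * x t' := by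
  let R : (ℤ → ℂ) →ₗ[ℂ] EuclideanSpace ℂ I :=
    { toFun := fun x => WithLp.toLp 2 fun t => x t
      map_add' := fun _ _ => rfl
      map_smul' := fun _ _ => rfl }
  have hR : ∀ x (t : I), R x t = x t := fun _ _ => rfl
  let V := X.map R
  have : FiniteDimensional ℂ V := inferInstance
  let b := stdOrthonormalBasis ℂ V
  let β : Fin (Module.finrank ℂ V) → ℤ → ℂ := fun i t =>
    if h : t ∈ I then (b i : EuclideanSpace ℂ I) ⟨t, h⟩ else 0
  have hβ : ∀ i (t : I), β i t = (b i : EuclideanSpace ℂ I) t := fun i t => by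
    simp [β, t.2]
  have hinner : ∀ i (v : ℤ → ℂ), inner ℂ (b i : EuclideanSpace ℂ I) (R v) =
      ∑ t ∈ I, star (β i t) * v t := by
    intro i v
    rw [← Finset.sum_coe_sort I (fun t => star (β i t) * v t), PiLp.inner_apply]
    refine Finset.sum_congr rfl fun t _ => ?_
    rw [hβ, hR]
    simp [mul_comm]
  have hnorm : ∀ v : ℤ → ℂ, ‖R v‖ ^ 2 = ∑ t ∈ I, ‖v t‖ ^ 2 := by
    intro v
    rw [EuclideanSpace.norm_sq_eq, ← Finset.sum_coe_sort I (fun t => ‖v t‖ ^ 2)]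
    rfl
  have horth : Orthonormal ℂ (fun i => (b i : EuclideanSpace ℂ I)) :=
    b.orthonormal.comp_linearIsometry V.subtypeₗᵢ
  refine ⟨_, β, (Submodule.finrank_map_le R X).trans hd, fun i t ht => by simp [β, ht], ?_, ?_, ?_⟩
  · intro i
    have h1 := horth.1 i
    have h2 : ∑ t ∈ I, ‖β i t‖ ^ 2 = ‖(b i : EuclideanSpace ℂ I)‖ ^ 2 := by
      rw [EuclideanSpace.norm_sq_eq, ← Finset.sum_coe_sort I (fun t => ‖β i t‖ ^ 2)]
      exact Finset.sum_congr rfl fun t _ => by rw [hβ]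
    rw [h2, h1, one_pow]
  · intro v
    rw [← hnorm]
    simp_rw [← hinner]
    exact horth.sum_inner_products_le (R v)
  · intro x hx t ht
    have h1 := b.sum_repr' ⟨R x, Submodule.mem_map_of_mem hx⟩
    have h2 := congrArg (fun y : V => (y : EuclideanSpace ℂ I) ⟨t, ht⟩) h1
    simp only [Submodule.coe_sum, Submodule.coe_smul, Submodule.coe_inner] at h2
    have h3 : R x ⟨t, ht⟩ = x t := rfl
    rw [← h3, ← h2]
    simp only [WithLp.ofLp_sum, WithLp.ofLp_smul, Finset.sum_apply, Pi.smul_apply, smul_eq_mul]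
    refine Finset.sum_congr rfl fun i _ => ?_
    rw [hinner, mul_comm, ← hβ]

/-- A shift-invariant subspace of dimension at most `d` is reproduced by a filter whose Fourier
spectrum is small in `ℓ^∞` and in `ℓ¹`: average the rows of an orthogonal projector along its
diagonals. -/
theorem exists_reproducing_filter {X : Submodule ℂ (ℤ → ℂ)} (hX : IsShiftInvariant X)
    [FiniteDimensional ℂ X] {d : ℕ} (hd : Module.finrank ℂ X ≤ d) (m : ℕ) :
    ∃ φ : ℤ → ℂ, BandLimited m φ ∧ (∀ x ∈ X, ∀ t, conv φ x t = x t) ∧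
      normInf (dft m φ) ≤ 1 / Real.sqrt (2 * m + 1) ∧
      norm1 (dft m φ) ≤ 2 * d / Real.sqrt (2 * m + 1) := by
  obtain ⟨κ, β, hκ, hsupp, hunit, hbessel, hrep⟩ := exists_projector X hd (Finset.Icc (0 : ℤ) m)
  set I := Finset.Icc (0 : ℤ) m
  have hIsub : I ⊆ Finset.Icc (-(m : ℤ)) m := Finset.Icc_subset_Icc_left (by omega)
  have hcard : I.card = m + 1 := by simp [I]
  have hm1 : ((m : ℂ) + 1) ≠ 0 := by exact_mod_cast Nat.succ_ne_zero m
  -- By shift invariance each row `t` of the projector, its entry at `t'` placed at lag `t - t'`, is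
  -- already a reproducing filter. Averaging the `m + 1` rows keeps this property and makes the
  -- symbol a sum of squares, hence nonnegative.
  let φ : ℤ → ℂ := fun τ => ((m : ℂ) + 1)⁻¹ *
    ∑ t ∈ I, ∑ t' ∈ I, if τ = t - t' then ∑ i, β i t * star (β i t') else 0
  have hband : BandLimited m φ := by
    intro τ hτ
    refine mul_eq_zero_of_right _ (Finset.sum_eq_zero fun t ht => Finset.sum_eq_zero fun t' ht' => ?_)
    rw [if_neg]
    rintro rfl
    rw [Finset.mem_Icc] at ht ht'
    have : |t - t'| ≤ m := by rw [abs_le]; constructor <;> omega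
    omega
  have hsum : ∀ f : ℤ → ℂ, ∑ τ ∈ Finset.Icc (-(m : ℤ)) m, φ τ * f τ = ((m : ℂ) + 1)⁻¹ *
      ∑ t ∈ I, ∑ t' ∈ I, (∑ i, β i t * star (β i t')) * f (t - t') := by
    intro f
    simp only [φ, mul_assoc, Finset.sum_mul]
    rw [← Finset.mul_sum]
    congr 1
    rw [Finset.sum_comm]
    refine Finset.sum_congr rfl fun t ht => ?_
    rw [Finset.sum_comm]
    refine Finset.sum_congr rfl fun t' ht' => ?_
    rw [Finset.sum_eq_single (t - t')]
    · rw [if_pos rfl, Finset.sum_mul]; simp only [mul_assoc]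
    · intro b _ hb
      rw [if_neg hb, zero_mul]
    · intro h
      exfalso; apply h
      rw [Finset.mem_Icc] at *
      omega
  have hsymb : ∀ θ, symbol m φ θ =
      (((m + 1 : ℝ)⁻¹ * ∑ i, ‖symbol m (β i) θ‖ ^ 2 : ℝ) : ℂ) := by
    intro θ
    have h1 : symbol m φ θ = ∑ τ ∈ Finset.Icc (-(m : ℤ)) m, φ τ * chi (-θ) τ :=
      Finset.sum_congr rfl fun τ _ => mul_comm _ _
    rw [h1, hsum]
    push_cast
    congr 1
    have h2 : ∀ i, ((‖symbol m (β i) θ‖ : ℂ)) ^ 2 =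
        ∑ t ∈ I, ∑ t' ∈ I, β i t * star (β i t') * chi (-θ) (t - t') := by
      intro i
      have h3 : symbol m (β i) θ = ∑ t ∈ I, chi (-θ) t * β i t :=
        (Finset.sum_subset hIsub fun t _ ht => by rw [hsupp i t ht, mul_zero]).symm
      rw [h3, ← Complex.mul_conj', ← Complex.star_def, star_sum, Finset.sum_mul_sum]
      refine Finset.sum_congr rfl fun t _ => Finset.sum_congr rfl fun t' _ => ?_
      rw [star_mul', star_chi, sub_eq_add_neg, chi_add, chi_neg, neg_neg]
      ring
    simp_rw [h2, Finset.sum_mul]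
    rw [Finset.sum_comm (s := Finset.univ)]
    refine Finset.sum_congr rfl fun t _ => ?_
    rw [Finset.sum_comm]
  have hle1 : ∀ θ, ‖symbol m φ θ‖ ≤ 1 := by
    intro θ
    rw [hsymb, Complex.norm_real, Real.norm_of_nonneg (by positivity),
      inv_mul_le_iff₀ (by positivity), mul_one]
    -- An exponential has energy `m + 1` on `I`, which cancels the normalization of the average.
    have h1 := hbessel (chi θ)
    simp_rw [norm_chi] at h1
    simp only [one_pow, Finset.sum_const, hcard, nsmul_eq_mul, mul_one] at h1
    push_cast at h1
    refine le_trans (le_of_eq (Finset.sum_congr rfl fun i _ => ?_)) h1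
    rw [← norm_star, symbol, star_sum]
    congr 2
    rw [← Finset.sum_subset hIsub fun t _ ht => by rw [hsupp i t ht, mul_zero, star_zero]]
    refine Finset.sum_congr rfl fun t _ => ?_
    rw [star_mul', star_chi, neg_neg, mul_comm]
  have hpos : (0 : ℝ) < 2 * m + 1 := by positivity
  have hsq : 0 < Real.sqrt (2 * m + 1) := Real.sqrt_pos.2 hpos
  have hdft : ∀ k, ‖dft m φ k‖ = (Real.sqrt (2 * m + 1))⁻¹ *
      ‖symbol m φ (freq (2 * m + 1) k)‖ := fun k => by
    rw [dft_eq_symbol, norm_mul, norm_inv, Complex.norm_real, Real.norm_of_nonneg hsq.le]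
  refine ⟨φ, hband, ?_, ?_, ?_⟩
  · intro x hx t0
    rw [conv_eq_sum hband, hsum (fun τ => x (t0 - τ))]
    have h1 : ∀ t ∈ I, ∑ t' ∈ I, (∑ i, β i t * star (β i t')) * x (t0 - (t - t')) = x t0 := by
      intro t ht
      have h2 := hrep _ (hX.translate_mem hx (t0 - t)) t ht
      simp only [add_sub_cancel] at h2
      conv_rhs => rw [h2]
      simp_rw [Finset.mul_sum, Finset.sum_mul]
      rw [Finset.sum_comm]
      refine Finset.sum_congr rfl fun i _ => Finset.sum_congr rfl fun t' _ => ?_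
      rw [mul_assoc]
      congr 3
      ring
    rw [Finset.sum_congr rfl h1, Finset.sum_const, hcard, nsmul_eq_mul]
    push_cast
    field_simp
  · rw [normInf, pi_norm_le_iff_of_nonneg (by positivity)]
    intro k
    rw [hdft, one_div]
    exact mul_le_of_le_one_right (by positivity) (hle1 _)
  · rw [norm1]
    simp_rw [hdft]
    rw [← Finset.mul_sum, div_eq_inv_mul]
    refine mul_le_mul_of_nonneg_left ?_ (by positivity)
    have h1 : ∀ k : Fin (2 * m + 1), ‖symbol m φ (freq (2 * m + 1) k)‖ =
        (m + 1 : ℝ)⁻¹ * ∑ i, ‖symbol m (β i) (freq (2 * m + 1) k)‖ ^ 2 := fun k => by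
      rw [hsymb, Complex.norm_real, Real.norm_of_nonneg (by positivity)]
    have h2 : ∀ i, ∑ t ∈ Finset.Icc (-(m : ℤ)) m, ‖β i t‖ ^ 2 = 1 := fun i => by
      rw [← hunit i]
      exact (Finset.sum_subset hIsub fun t _ ht => by rw [hsupp i t ht]; simp).symm
    simp_rw [h1]
    rw [← Finset.mul_sum, Finset.sum_comm]
    -- Since the symbol is nonnegative, its `ℓ¹` norm is its sum, and Parseval evaluates it as `κ
    -- (2m+1)/(m+1)`. The factor 2 arises because the projector lives on an interval about half as
    -- long as the filter.
    simp_rw [sum_norm_sq_symbol, h2]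
    rw [inv_mul_le_iff₀ (by positivity)]
    simp only [mul_one, Finset.sum_const, Finset.card_univ, Fintype.card_fin, nsmul_eq_mul]
    have : (κ : ℝ) ≤ d := by exact_mod_cast hκ
    nlinarith [mul_nonneg (Nat.cast_nonneg (α := ℝ) m) (Nat.cast_nonneg (α := ℝ) d)]

/-! ### The Dirichlet kernel -/

/-- The `i`-th smallest element of `S`, counted from 0, is at least `i`. -/
theorem sum_inv_succ_le_harmonic (S : Finset ℕ) {r : ℕ} (hS : S.card ≤ r) :
    ∑ k ∈ S, ((k : ℝ) + 1)⁻¹ ≤ (harmonic r : ℝ) := by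
  have h1 : ∑ k ∈ S, ((k : ℝ) + 1)⁻¹ = ∑ i : Fin S.card, ((S.orderEmbOfFin rfl i : ℝ) + 1)⁻¹ := by
    have h3 : S = Finset.univ.map (S.orderEmbOfFin rfl).toEmbedding := by
      ext x; simp
    conv_lhs => rw [h3]
    rw [Finset.sum_map]
    rfl
  have h2 : ∑ i : Fin S.card, ((S.orderEmbOfFin rfl i : ℝ) + 1)⁻¹ ≤
      ∑ i : Fin S.card, (((i : ℕ) : ℝ) + 1)⁻¹ := by
    refine Finset.sum_le_sum fun i _ => ?_
    have hle : ∀ i : Fin S.card, (i : ℕ) ≤ S.orderEmbOfFin rfl i := by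
      intro i
      obtain ⟨i, hi⟩ := i
      induction i with
      | zero => exact Nat.zero_le _
      | succ j ih =>
        have h4 := ih (by omega)
        have h5 : S.orderEmbOfFin rfl ⟨j, by omega⟩ < S.orderEmbOfFin rfl ⟨j + 1, hi⟩ :=
          (S.orderEmbOfFin rfl).strictMono (Fin.mk_lt_mk.2 (Nat.lt_succ_self j))
        simp only at h4 ⊢
        omega
    have : ((i : ℕ) : ℝ) ≤ S.orderEmbOfFin rfl i := by exact_mod_cast hle i
    gcongr
  rw [h1]
  refine h2.trans ?_
  rw [Fin.sum_univ_eq_sum_range (fun i => ((i : ℝ) + 1)⁻¹)]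
  rw [harmonic]
  push_cast
  exact Finset.sum_le_sum_of_subset_of_nonneg (Finset.range_subset_range.2 hS)
    fun _ _ _ => by positivity

theorem norm_sum_chi_le (m : ℕ) (θ : ℝ) :
    ‖∑ τ ∈ Finset.Icc (-(m : ℤ)) m, chi θ τ‖ ≤ 2 * m + 1 := by
  refine (norm_sum_le _ _).trans ?_
  simp only [norm_chi, Finset.sum_const, Int.card_Icc, nsmul_eq_mul, mul_one]
  have : ((m : ℤ) + 1 - -(m : ℤ)).toNat = 2 * m + 1 := by omega
  rw [this]; push_cast; rfl

/-- Multiplying the geometric sum by `chi θ 1 - 1`, of modulus `2|sin(θ/2)|`, telescopes it to a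
difference of two unimodular numbers. -/
theorem norm_sum_chi_mul_sin_le (m : ℕ) (θ : ℝ) :
    ‖∑ τ ∈ Finset.Icc (-(m : ℤ)) m, chi θ τ‖ * |Real.sin (θ / 2)| ≤ 1 := by
  have h1 : (∑ τ ∈ Finset.Icc (-(m : ℤ)) m, chi θ τ) * (chi θ 1 - 1) =
      chi θ (m + 1) - chi θ (-m) := by
    rw [sum_Icc_eq_sum_range]
    simp_rw [sub_eq_add_neg _ (m : ℤ), chi_add, ← Finset.sum_mul, chi_natCast]
    rw [mul_right_comm, geom_sum_mul, sub_mul, one_mul, ← chi_natCast, ← chi_add, ← chi_natCast,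
      ← chi_add]
    congr 2
    push_cast; ring
  have h2 : ‖chi θ 1 - 1‖ = 2 * |Real.sin (θ / 2)| := by
    have := Complex.norm_exp_I_mul_ofReal_sub_one θ
    rw [mul_comm Complex.I] at this
    rw [chi, Int.cast_one, mul_one, this, norm_mul]
    simp
  have h3 := congrArg norm h1
  rw [norm_mul, h2] at h3
  have h4 := norm_sub_le (chi θ (m + 1)) (chi θ (-m))
  rw [norm_chi, norm_chi, ← h3] at h4
  linarith

theorem chi_add_two_pi_mul (θ : ℝ) (q τ : ℤ) : chi (θ + 2 * Real.pi * q) τ = chi θ τ := by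
  rw [chi_add_freq]
  have : chi (2 * Real.pi * q) τ = 1 := by
    rw [chi, Complex.exp_eq_one_iff]
    exact ⟨q * τ, by push_cast; ring⟩
  rw [this, mul_one]

/-- Decay of the Dirichlet kernel near the `j`-th grid point. -/
theorem norm_sum_chi_grid_le (m : ℕ) {f : ℝ} (hf0 : 0 ≤ f) (hf1 : f < 1) {j : ℕ} (hj2 : 2 ≤ j)
    (hj : j < 2 * m + 1) :
    ‖∑ τ ∈ Finset.Icc (-(m : ℤ)) m, chi (2 * Real.pi / (2 * m + 1 : ℕ) * (j - f)) τ‖ ≤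
      (2 * m + 1) * (1 / 2 * (((j : ℝ) - 1)⁻¹ + ((2 * m + 1 : ℝ) - j)⁻¹)) := by
  set M : ℝ := 2 * m + 1 with hM
  have hMpos : 0 < M := by positivity
  have hMc : ((2 * m + 1 : ℕ) : ℝ) = M := by push_cast; rfl
  have hj2' : (2 : ℝ) ≤ j := by exact_mod_cast hj2
  have hj' : (j : ℝ) + 1 ≤ M := by rw [← hMc]; exact_mod_cast hj
  have hs := norm_sum_chi_mul_sin_le m (2 * Real.pi / (2 * m + 1 : ℕ) * (j - f))
  rw [hMc] at *
  have harg : 2 * Real.pi / M * (j - f) / 2 = Real.pi * ((j - f) / M) := by field_simp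
  rw [harg] at hs
  set D := ‖∑ τ ∈ Finset.Icc (-(m : ℤ)) m, chi (2 * Real.pi / M * (j - f)) τ‖
  have hD : 0 ≤ D := norm_nonneg _
  have hpi := Real.pi_pos
  have hy0 : 0 < (j - f) / M := div_pos (by linarith) hMpos
  have hy1 : (j - f) / M < 1 := by rw [div_lt_one hMpos]; linarith
  -- Jordan's inequality is applied on the half period containing the point. Adding the two
  -- reciprocals in the bound covers both cases at once.
  rcases le_total ((j - f) / M) (1 / 2) with hy | hy
  · have h1 := Real.mul_le_sin (x := Real.pi * ((j - f) / M)) (by positivity) (by nlinarith)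
    have h2 : 2 / Real.pi * (Real.pi * ((j - f) / M)) = 2 * (j - f) / M := by field_simp
    rw [h2] at h1
    have h3 : 2 * (j - 1) / M ≤ |Real.sin (Real.pi * ((j - f) / M))| := by
      refine le_trans ?_ (h1.trans (le_abs_self _))
      gcongr
    have h4 : D * (2 * (j - 1) / M) ≤ 1 := (mul_le_mul_of_nonneg_left h3 hD).trans hs
    have h5 : D ≤ M * (1 / 2 * ((j : ℝ) - 1)⁻¹) := by
      have hj1 : (0 : ℝ) < j - 1 := by linarith
      rw [mul_div_assoc', div_le_one hMpos] at h4
      rw [← div_eq_mul_inv, div_div, mul_div_assoc', le_div_iff₀ (by positivity)]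
      linarith
    refine h5.trans ?_
    have : 0 ≤ (M - j)⁻¹ := by rw [inv_nonneg]; linarith
    gcongr
    linarith
  · have h1 := Real.mul_le_sin (x := Real.pi * (1 - (j - f) / M)) (by
      have : 0 < 1 - (j - f) / M := by linarith
      positivity) (by nlinarith)
    have h2 : 2 / Real.pi * (Real.pi * (1 - (j - f) / M)) = 2 * (M - (j - f)) / M := by field_simp
    have h6 : Real.sin (Real.pi * (1 - (j - f) / M)) = Real.sin (Real.pi * ((j - f) / M)) := by
      rw [← Real.sin_pi_sub]; congr 1; ring
    rw [h2, h6] at h1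
    have h3 : 2 * (M - j) / M ≤ |Real.sin (Real.pi * ((j - f) / M))| := by
      refine le_trans ?_ (h1.trans (le_abs_self _))
      gcongr
      linarith
    have h4 : D * (2 * (M - j) / M) ≤ 1 := (mul_le_mul_of_nonneg_left h3 hD).trans hs
    have hj1 : (0 : ℝ) < M - j := by linarith
    have h5 : D ≤ M * (1 / 2 * (M - (j : ℝ))⁻¹) := by
      rw [mul_div_assoc', div_le_one hMpos] at h4
      rw [← div_eq_mul_inv, div_div, mul_div_assoc', le_div_iff₀ (by positivity)]
      linarith
    refine h5.trans ?_
    have : 0 ≤ ((j : ℝ) - 1)⁻¹ := by rw [inv_nonneg]; linarith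
    gcongr
    linarith

/-- The sum of the moduli of `r` translates of the Dirichlet kernel by distinct grid points. -/
theorem sum_norm_dirichlet_le (m r : ℕ) (g : Fin r ↪ Fin (2 * m + 1)) (θ : ℝ) :
    ∑ i, ‖∑ τ ∈ Finset.Icc (-(m : ℤ)) m, chi (freq (2 * m + 1) (g i) - θ) τ‖ ≤
      (2 * m + 1) * (3 + Real.log r) := by
  obtain ⟨M, hM⟩ : ∃ M : ℕ, M = 2 * m + 1 := ⟨_, rfl⟩
  have hMpos : 0 < M := by omega
  have hMr : (0 : ℝ) < M := by exact_mod_cast hMpos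
  have hMc : (M : ℝ) = 2 * m + 1 := by rw [hM]; push_cast; rfl
  set x : ℝ := M * θ / (2 * Real.pi) with hx
  set x0 : ℤ := ⌊x⌋ with hx0
  set f : ℝ := Int.fract x with hf
  -- Grid points are renumbered cyclically from the last one not exceeding `θ`; the offset `f` is
  -- then common to all of them.
  let j : Fin r → ℕ := fun i => ((((g i : ℕ) : ℤ) - x0) % M).toNat
  have hmodnn : ∀ i, 0 ≤ (((g i : ℕ) : ℤ) - x0) % M := fun i =>
    Int.emod_nonneg _ (by omega)
  have hjlt : ∀ i, j i < M := fun i => by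
    have := Int.emod_lt_of_pos (((g i : ℕ) : ℤ) - x0) (by omega : (0 : ℤ) < M)
    have := hmodnn i
    simp only [j]; omega
  have hjinj : Function.Injective j := by
    intro a b hab
    have h1 : (((g a : ℕ) : ℤ) - x0) % M = (((g b : ℕ) : ℤ) - x0) % M := by
      have := hmodnn a
      have := hmodnn b
      simp only [j] at hab
      omega
    have h2 : ((g a : ℕ) : ℤ) % M = ((g b : ℕ) : ℤ) % M := by
      have := Int.ModEq.add_right x0 (show _ ≡ _ [ZMOD M] from h1)
      simpa [Int.ModEq] using this
    rw [Int.emod_eq_of_lt (by omega) (by have := (g a).2; omega),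
      Int.emod_eq_of_lt (by omega) (by have := (g b).2; omega)] at h2
    exact g.injective (Fin.ext (by exact_mod_cast h2))
  have hker : ∀ i, ∑ τ ∈ Finset.Icc (-(m : ℤ)) m, chi (freq M (g i) - θ) τ =
      ∑ τ ∈ Finset.Icc (-(m : ℤ)) m, chi (2 * Real.pi / (M : ℕ) * (j i - f)) τ := by
    intro i
    refine Finset.sum_congr rfl fun τ _ => ?_
    rw [← chi_add_two_pi_mul (2 * Real.pi / (M : ℕ) * (j i - f)) ((((g i : ℕ) : ℤ) - x0) / M)]
    congr 1
    have h1 : (((j i : ℕ) : ℤ) : ℝ) = (((g i : ℕ) : ℤ) - x0 : ℤ) -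
        (M : ℝ) * ((((g i : ℕ) : ℤ) - x0) / M : ℤ) := by
      have h2 := Int.emod_add_mul_ediv (((g i : ℕ) : ℤ) - x0) M
      have h3 : ((j i : ℕ) : ℤ) = (((g i : ℕ) : ℤ) - x0) % M := Int.toNat_of_nonneg (hmodnn i)
      have h4 : ((j i : ℕ) : ℤ) = (((g i : ℕ) : ℤ) - x0) - M * ((((g i : ℕ) : ℤ) - x0) / M) := by
        rw [h3]; linarith
      rw [h4]; push_cast; ring
    have h5 : (j i : ℝ) = (((j i : ℕ) : ℤ) : ℝ) := by push_cast; rfl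
    have h6 : f = M * θ / (2 * Real.pi) - x0 := by rw [hf, Int.fract]
    rw [h5, h1, h6, freq]
    have := Real.pi_pos
    push_cast
    field_simp
    ring
  have hw : ∀ i, ‖∑ τ ∈ Finset.Icc (-(m : ℤ)) m, chi (freq (2 * m + 1) (g i) - θ) τ‖ ≤
      (2 * m + 1 : ℝ) * (if j i < 2 then 1 else
        1 / 2 * (((j i : ℝ) - 1)⁻¹ + ((2 * m + 1 : ℝ) - j i)⁻¹)) := by
    intro i
    split_ifs with h
    · rw [mul_one]; exact norm_sum_chi_le m _
    · have h7 := hker i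
      rw [hM] at h7
      rw [h7]
      exact norm_sum_chi_grid_le m (Int.fract_nonneg x) (Int.fract_lt_one x) (by omega)
        (hM ▸ hjlt i)
  clear_value j
  refine (Finset.sum_le_sum fun i _ => hw i).trans ?_
  rw [← Finset.mul_sum]
  refine mul_le_mul_of_nonneg_left ?_ (by positivity)
  rw [Finset.sum_ite]
  -- The neighbours `j = 0, 1` of `θ` get the trivial bound and contribute at most 2. The others
  -- contribute half of two harmonic sums, at most `1 + log r`; together these give `3 + log r`.
  have hlow : ∑ i with j i < 2, (1 : ℝ) ≤ 2 := by
    rw [Finset.sum_const, nsmul_eq_mul, mul_one]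
    have : (Finset.univ.filter fun i => j i < 2).card ≤ (Finset.range 2).card :=
      Finset.card_le_card_of_injOn j (fun i hi => by simpa using hi) hjinj.injOn
    rw [Finset.card_range] at this
    exact_mod_cast this
  set T := Finset.univ.filter fun i => ¬ j i < 2 with hT
  have hTc : T.card ≤ r := (Finset.card_le_univ T).trans (by simp)
  have hTj : ∀ i ∈ T, 2 ≤ j i := fun i hi => by
    rw [hT, Finset.mem_filter] at hi; omega
  have h1 : ∑ i ∈ T, ((j i : ℝ) - 1)⁻¹ ≤ harmonic r := by
    have hinj : Set.InjOn (fun i => j i - 2) T := fun a ha b hb hab => hjinj (by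
      have := hTj a ha; have := hTj b hb; simp only at hab; omega)
    refine le_trans (le_of_eq ?_) (sum_inv_succ_le_harmonic (T.image fun i => j i - 2)
      (Finset.card_image_le.trans hTc))
    rw [Finset.sum_image hinj]
    refine Finset.sum_congr rfl fun i hi => ?_
    rw [Nat.cast_sub (hTj i hi)]
    congr 1; push_cast; ring
  have h2 : ∑ i ∈ T, ((2 * m + 1 : ℝ) - j i)⁻¹ ≤ harmonic r := by
    have hinj : Set.InjOn (fun i => M - 1 - j i) T := fun a ha b hb hab => hjinj (by
      have := hjlt a; have := hjlt b; simp only at hab; omega)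
    refine le_trans (le_of_eq ?_) (sum_inv_succ_le_harmonic (T.image fun i => M - 1 - j i)
      (Finset.card_image_le.trans hTc))
    rw [Finset.sum_image hinj]
    refine Finset.sum_congr rfl fun i hi => ?_
    have := hjlt i
    rw [Nat.cast_sub (by omega), Nat.cast_sub (by omega), hMc]
    congr 1; push_cast; ring
  have h3 := harmonic_le_one_add_log r
  rw [← Finset.mul_sum, Finset.sum_add_distrib]
  linarith

/-! ### Filters with a sparse spectrum -/

/-- The four corners `±1 ± i` of a square. -/
noncomputable def corner (b : Bool × Bool) : ℂ :=
  ⟨if b.1 then 1 else -1, if b.2 then 1 else -1⟩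

theorem norm_corner_sq (b : Bool × Bool) : ‖corner b‖ ^ 2 = 2 := by
  rw [← Complex.normSq_eq_norm_sq, corner, Complex.normSq_mk]
  obtain ⟨_ | _, _ | _⟩ := b <;> norm_num

theorem norm_corner (b : Bool × Bool) : ‖corner b‖ = Real.sqrt 2 := by
  rw [← norm_corner_sq b, Real.sqrt_sq (norm_nonneg _)]

/-- With matching signs the right side is `|Re z| + |Im z|`. Four phases thus replace the whole
circle, keeping the net finite at the price of modulus `√2`. -/
theorem exists_norm_le_re_corner_mul (z : ℂ) : ∃ b, ‖z‖ ≤ (corner b * z).re := by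
  refine ⟨(decide (0 ≤ z.re), decide (z.im ≤ 0)), (Complex.norm_le_abs_re_add_abs_im z).trans ?_⟩
  rw [corner, Complex.mul_re]
  simp only [decide_eq_true_eq]
  split_ifs with h1 h2 h2
  · rw [abs_of_nonneg h1, abs_of_nonpos h2]; linarith
  · rw [abs_of_nonneg h1, abs_of_pos (not_le.1 h2)]; linarith
  · rw [abs_of_neg (not_le.1 h1), abs_of_nonpos h2]; linarith
  · rw [abs_of_neg (not_le.1 h1), abs_of_pos (not_le.1 h2)]; linarith

/-- The index set of the filters of halfwidth `m` with `r` nonzero Fourier coefficients. -/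
abbrev Net (m r : ℕ) : Type := (Fin r ↪ Fin (2 * m + 1)) × (Fin r → Bool × Bool)

/-- The filter of halfwidth `m` whose Fourier spectrum is supported on `r` points, with values
`(±1 ± i) / √(2m+1)`. -/
noncomputable def atom (m r : ℕ) (p : Net m r) : ℤ → ℂ := fun τ =>
  if |τ| ≤ m then
    ((2 * m + 1 : ℕ) : ℂ)⁻¹ * ∑ i, corner (p.2 i) * chi (freq (2 * m + 1) (p.1 i)) τ
  else 0

theorem atom_of_mem {m r : ℕ} (p : Net m r) {τ : ℤ} (hτ : τ ∈ Finset.Icc (-(m : ℤ)) m) :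
    atom m r p τ =
      ((2 * m + 1 : ℕ) : ℂ)⁻¹ * ∑ i, corner (p.2 i) * chi (freq (2 * m + 1) (p.1 i)) τ := by
  rw [Finset.mem_Icc, ← abs_le] at hτ
  rw [atom, if_pos hτ]

theorem bandLimited_atom (m r : ℕ) (p : Net m r) : BandLimited m (atom m r p) :=
  fun τ hτ => if_neg (by omega)

/-- On its own grid the symbol has modulus at most `√2`, but between grid points it is a
superposition of `r` Dirichlet kernels. The square of this bound is the squared logarithm of `s` in
both claims. -/
theorem norm_symbol_atom_le {m r : ℕ} (p : Net m r) (θ : ℝ) :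
    ‖symbol m (atom m r p) θ‖ ≤ Real.sqrt 2 * (3 + Real.log r) := by
  have hM : (0 : ℝ) < 2 * m + 1 := by positivity
  have h1 : symbol m (atom m r p) θ = ((2 * m + 1 : ℕ) : ℂ)⁻¹ * ∑ i, corner (p.2 i) *
      ∑ τ ∈ Finset.Icc (-(m : ℤ)) m, chi (freq (2 * m + 1) (p.1 i) - θ) τ := by
    rw [symbol]
    simp_rw [Finset.mul_sum]
    rw [Finset.sum_comm]
    refine Finset.sum_congr rfl fun τ hτ => ?_
    rw [atom_of_mem p hτ, Finset.mul_sum, Finset.mul_sum]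
    refine Finset.sum_congr rfl fun i _ => ?_
    rw [sub_eq_add_neg, chi_add_freq]
    ring
  have h2 := sum_norm_dirichlet_le m r p.1 θ
  rw [h1, norm_mul, norm_inv, Complex.norm_natCast]
  push_cast
  rw [inv_mul_le_iff₀ hM]
  refine (norm_sum_le _ _).trans ?_
  simp_rw [norm_mul, norm_corner]
  rw [← Finset.mul_sum, mul_left_comm]
  gcongr

/-- Parseval, with the corners placed on the `r` distinct frequencies. Over an interval of `2m+1`
points this energy adds up to `2r`, independently of `m`. -/
theorem sum_norm_sq_atom (m r : ℕ) (p : Net m r) :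
    ∑ τ ∈ Finset.Icc (-(m : ℤ)) m, ‖atom m r p τ‖ ^ 2 = 2 * r / (2 * m + 1) := by
  classical
  have hM : (0 : ℝ) < 2 * m + 1 := by positivity
  let a : Fin (2 * m + 1) → ℂ := fun k =>
    ∑ i, if p.1 i = k then ((2 * m + 1 : ℕ) : ℂ)⁻¹ * corner (p.2 i) else 0
  have h1 : ∀ τ ∈ Finset.Icc (-(m : ℤ)) m,
      atom m r p τ = ∑ k, a k * chi (freq (2 * m + 1) k) τ := by
    intro τ hτ
    rw [atom_of_mem p hτ, Finset.mul_sum]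
    simp only [a, Finset.sum_mul]
    rw [Finset.sum_comm]
    refine Finset.sum_congr rfl fun i _ => ?_
    simp only [ite_mul, zero_mul, Finset.sum_ite_eq, Finset.mem_univ, if_true]
    ring
  have h2 : ∀ i, a (p.1 i) = ((2 * m + 1 : ℕ) : ℂ)⁻¹ * corner (p.2 i) := by
    intro i
    simp only [a]
    rw [Finset.sum_eq_single i]
    · rw [if_pos rfl]
    · intro j _ hj
      rw [if_neg fun h => hj (p.1.injective h)]
    · exact fun h => absurd (Finset.mem_univ _) h
  have h3 : ∀ k, k ∉ Set.range p.1 → a k = 0 := fun k hk =>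
    Finset.sum_eq_zero fun i _ => if_neg fun h => hk ⟨i, h⟩
  rw [Finset.sum_congr rfl fun τ hτ => by rw [h1 τ hτ], sum_norm_sq_trigonometric]
  have h4 : ∑ k, ‖a k‖ ^ 2 = ∑ i, ‖a (p.1 i)‖ ^ 2 := by
    rw [← Finset.sum_map Finset.univ p.1 (fun k => ‖a k‖ ^ 2)]
    refine (Finset.sum_subset (Finset.subset_univ _) fun k _ hk => ?_).symm
    rw [h3 k (by simpa using hk)]; simp
  rw [h4]
  simp_rw [h2, norm_mul, mul_pow, norm_corner_sq, norm_inv, Complex.norm_natCast]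
  rw [Finset.sum_const, Finset.card_univ, Fintype.card_fin, nsmul_eq_mul]
  push_cast
  field_simp

theorem norm_atom_zero_le (m r : ℕ) (p : Net m r) : ‖atom m r p 0‖ ≤ 2 * r / (2 * m + 1) := by
  have hM : (0 : ℝ) < 2 * m + 1 := by positivity
  rw [atom_of_mem p (by simp), norm_mul, norm_inv, Complex.norm_natCast]
  push_cast
  rw [inv_mul_le_iff₀ hM, mul_div_cancel₀ _ hM.ne']
  refine (norm_sum_le _ _).trans ?_
  simp_rw [norm_mul, norm_corner, norm_chi]
  have : Real.sqrt 2 ≤ 2 := by rw [Real.sqrt_le_left (by norm_num)]; norm_num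
  simp only [mul_one, Finset.sum_const, Finset.card_univ, Fintype.card_fin, nsmul_eq_mul]
  rw [mul_comm]
  gcongr

theorem card_net_le (m r : ℕ) : Fintype.card (Net m r) ≤ (4 * (2 * m + 1)) ^ r := by
  rw [Fintype.card_prod, Fintype.card_embedding_eq, mul_pow, mul_comm]
  refine Nat.mul_le_mul ?_ ?_
  · simp
  · simpa using Nat.descFactorial_le_pow (2 * m + 1) r

/-- Among the nonnegative vectors with bounded `ℓ^∞` and `ℓ¹` norms, a linear functional is
maximized on its largest coefficients. -/
theorem exists_embedding_sum_mul_le {M r : ℕ} (hr : 1 ≤ r) (hrM : r ≤ M) {a b : Fin M → ℝ} {α : ℝ}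
    (ha : ∀ k, a k ≤ α) (ha' : ∑ k, a k ≤ r * α) (hb : ∀ k, 0 ≤ b k) (ha0 : ∀ k, 0 ≤ a k) :
    ∃ g : Fin r ↪ Fin M, ∑ k, a k * b k ≤ α * ∑ i, b (g i) := by
  classical
  obtain ⟨S, hS, hmax⟩ := Finset.exists_max_image
    (Finset.powersetCard r (Finset.univ : Finset (Fin M))) (fun S => ∑ k ∈ S, b k)
    (Finset.powersetCard_nonempty.2 (by simpa using hrM))
  rw [Finset.mem_powersetCard] at hS
  have hSne : S.Nonempty := Finset.card_pos.1 (by omega)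
  obtain ⟨k0, hk0, hmin⟩ := Finset.exists_min_image S b hSne
  have hout : ∀ l, l ∉ S → b l ≤ b k0 := by
    intro l hl
    have hl' : l ∉ S.erase k0 := fun h => hl (Finset.mem_of_mem_erase h)
    -- Exchanging `k0` for `l` keeps the cardinality, so maximality of `S` forces `b l ≤ b k0`.
    have h1 := hmax (insert l (S.erase k0)) (by
      rw [Finset.mem_powersetCard]
      refine ⟨Finset.subset_univ _, ?_⟩
      rw [Finset.card_insert_of_notMem hl', Finset.card_erase_of_mem hk0]
      omega)
    rw [Finset.sum_insert hl', ← Finset.add_sum_erase S b hk0] at h1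
    linarith
  refine ⟨(S.orderEmbOfFin hS.2).toEmbedding, ?_⟩
  have h2 : ∑ i, b ((S.orderEmbOfFin hS.2).toEmbedding i) = ∑ k ∈ S, b k := by
    rw [← Finset.sum_map Finset.univ]
    congr 1
    ext x; simp
  rw [h2, ← Finset.sum_add_sum_compl S]
  rw [← Finset.sum_add_sum_compl S a] at ha'
  have h3 : ∑ k ∈ Sᶜ, a k * b k ≤ b k0 * ∑ k ∈ Sᶜ, a k := by
    rw [Finset.mul_sum]
    refine Finset.sum_le_sum fun k hk => ?_
    rw [mul_comm]
    exact mul_le_mul_of_nonneg_right (hout k (Finset.mem_compl.1 hk)) (ha0 k)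
  have h4 : ∑ k ∈ S, a k * (b k - b k0) ≤ ∑ k ∈ S, α * (b k - b k0) :=
    Finset.sum_le_sum fun k hk =>
      mul_le_mul_of_nonneg_right (ha k) (sub_nonneg.2 (hmin k hk))
  simp_rw [mul_sub, Finset.sum_sub_distrib] at h4
  rw [← Finset.sum_mul, ← Finset.mul_sum, Finset.sum_const, hS.2, nsmul_eq_mul] at h4
  have h5 := mul_le_mul_of_nonneg_left ha' (hb k0)
  linarith

/-- A linear functional of a filter with bounded spectrum is dominated by its value at some filter
with a sparse spectrum. -/
theorem exists_atom_re_le {m r : ℕ} (hr : 1 ≤ r) (hrM : r ≤ 2 * m + 1) {φ : ℤ → ℂ}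
    (hφ : BandLimited m φ) {β : ℝ} (hβ : 0 ≤ β)
    (hinf : normInf (dft m φ) ≤ β / Real.sqrt (2 * m + 1))
    (h1 : norm1 (dft m φ) ≤ r * β / Real.sqrt (2 * m + 1)) (ℓ : (ℤ → ℂ) →ₗ[ℂ] ℂ) :
    ∃ p : Net m r, (ℓ φ).re ≤ β * (ℓ (atom m r p)).re := by
  classical
  set q := Real.sqrt (2 * m + 1) with hq
  have hpos : (0 : ℝ) < 2 * m + 1 := by positivity
  have hq0 : 0 < q := Real.sqrt_pos.2 hpos
  have hqq : q * q = 2 * m + 1 := Real.mul_self_sqrt hpos.le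
  let e : ℕ → ℤ → ℂ := fun k τ => if |τ| ≤ m then chi (freq (2 * m + 1) k) τ else 0
  have he : φ = ∑ k : Fin (2 * m + 1), (dft m φ k * ((q : ℝ) : ℂ)⁻¹) • e k := by
    funext τ
    rw [Finset.sum_apply]
    by_cases hτ : |τ| ≤ m
    · rw [dft_inversion m φ (by rw [Finset.mem_Icc, ← abs_le]; exact hτ)]
      refine Finset.sum_congr rfl fun k _ => ?_
      simp only [e, Pi.smul_apply, smul_eq_mul, if_pos hτ, mul_assoc, hq]
    · rw [hφ τ (by omega)]
      simp [e, hτ]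
  have hatom : ∀ p : Net m r, atom m r p =
      ∑ i, (((2 * m + 1 : ℕ) : ℂ)⁻¹ * corner (p.2 i)) • e (p.1 i) := by
    intro p
    funext τ
    rw [Finset.sum_apply]
    by_cases hτ : |τ| ≤ m
    · simp only [atom, e, Pi.smul_apply, smul_eq_mul, if_pos hτ, mul_assoc, Finset.mul_sum]
    · simp [atom, e, hτ]
  have hle : (ℓ φ).re ≤ q⁻¹ * ∑ k : Fin (2 * m + 1), ‖dft m φ k‖ * ‖ℓ (e k)‖ := by
    refine (Complex.re_le_norm _).trans ?_
    conv_lhs => rw [he]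
    rw [map_sum, Finset.mul_sum]
    refine (norm_sum_le _ _).trans (Finset.sum_le_sum fun k _ => le_of_eq ?_)
    rw [map_smul, norm_smul, norm_mul, norm_inv, Complex.norm_real, Real.norm_of_nonneg hq0.le]
    ring
  obtain ⟨g, hg⟩ := exists_embedding_sum_mul_le hr hrM (a := fun k => ‖dft m φ k‖)
    (b := fun k => ‖ℓ (e k)‖) (α := β / q)
    (fun k => (norm_le_pi_norm (dft m φ) k).trans hinf)
    (by rw [mul_div_assoc']; exact h1) (fun k => norm_nonneg _) (fun k => norm_nonneg _)
  choose b hb using fun i => exists_norm_le_re_corner_mul (ℓ (e (g i)))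
  refine ⟨(g, b), hle.trans ?_⟩
  have h2 : (ℓ (atom m r (g, b))).re =
      (2 * m + 1 : ℝ)⁻¹ * ∑ i, (corner (b i) * ℓ (e (g i))).re := by
    rw [hatom, map_sum, Complex.re_sum, Finset.mul_sum]
    refine Finset.sum_congr rfl fun i _ => ?_
    rw [map_smul, smul_eq_mul, mul_assoc]
    have : ((2 * m + 1 : ℕ) : ℂ)⁻¹ = (((2 * m + 1 : ℝ)⁻¹ : ℝ) : ℂ) := by push_cast; rfl
    rw [this, Complex.re_ofReal_mul]
  have h3 : ∑ i, ‖ℓ (e (g i))‖ ≤ ∑ i, (corner (b i) * ℓ (e (g i))).re :=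
    Finset.sum_le_sum fun i _ => hb i
  rw [h2]
  calc q⁻¹ * ∑ k : Fin (2 * m + 1), ‖dft m φ k‖ * ‖ℓ (e k)‖
      ≤ q⁻¹ * (β / q * ∑ i, ‖ℓ (e (g i))‖) := by gcongr
    _ ≤ q⁻¹ * (β / q * ∑ i, (corner (b i) * ℓ (e (g i))).re) := by gcongr
    _ = β * ((2 * m + 1 : ℝ)⁻¹ * ∑ i, (corner (b i) * ℓ (e (g i))).re) := by
        rw [← hqq]; field_simp

/-! ### Tail bounds for filtered noise -/

theorem extend_apply {N : ℕ} (y : Window N → ℂ) (t : Window N) : extend y t = y t := by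
  rw [extend, dif_pos t.2]

theorem bandLimited_extend {N : ℕ} (y : Window N → ℂ) : BandLimited N (extend y) :=
  bandLimited_iff.2 fun t ht => by rw [extend, dif_neg ht]

theorem sum_window {E : Type*} [AddCommMonoid E] {N : ℕ} (f : ℤ → E) :
    ∑ t : Window N, f t = ∑ t ∈ Finset.Icc (-(N : ℤ)) N, f t :=
  Finset.sum_coe_sort _ f

theorem sum_norm_sq_extend {N : ℕ} (v : Window N → ℂ) :
    ∑ t ∈ Finset.Icc (-(N : ℤ)) N, ‖extend v t‖ ^ 2 = ∑ t, ‖v t‖ ^ 2 := by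
  rw [← sum_window (fun t => ‖extend v t‖ ^ 2)]
  simp_rw [extend_apply]

theorem conv_extend {N : ℕ} (φ : ℤ → ℂ) (v : Window N → ℂ) (t : ℤ) :
    conv φ (extend v) t = ∑ t' : Window N, φ (t - t') * v t' := by
  rw [conv_comm, conv_eq_sum (bandLimited_extend v), ← sum_window]
  refine Finset.sum_congr rfl fun t' _ => ?_
  rw [extend_apply, mul_comm]

theorem sum_norm_sq_sub_le {m : ℕ} {φ : ℤ → ℂ} (hφ : BandLimited m φ) (t : ℤ) (J : Finset ℤ) :
    ∑ t' ∈ J, ‖φ (t - t')‖ ^ 2 ≤ ∑ τ ∈ Finset.Icc (-(m : ℤ)) m, ‖φ τ‖ ^ 2 := by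
  rw [← Finset.sum_image (g := fun t' => t - t') (f := fun τ => ‖φ τ‖ ^ 2)
    (fun a _ b _ h => by simpa using h)]
  refine (Finset.sum_le_sum_of_subset_of_nonneg Finset.subset_union_left
      fun _ _ _ => by positivity).trans
      (le_of_eq (Finset.sum_subset (s₁ := Finset.Icc (-(m : ℤ)) m)
        (s₂ := J.image (fun t' => t - t') ∪ Finset.Icc (-(m : ℤ)) m)
        Finset.subset_union_right fun τ _ hτ => ?_).symm)
  rw [bandLimited_iff.1 hφ τ hτ]; simp

/-- The Toeplitz matrix of `φ` has operator norm at most the maximum of the symbol, and every row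
has energy at most that of `φ`. -/
theorem noiseLaw_conv_tail {N m : ℕ} {φ : ℤ → ℂ} (hφ : BandLimited m φ) {Λ f F : ℝ} (hΛ : 0 < Λ)
    (hsymb : ∀ θ, ‖symbol m φ θ‖ ≤ Λ) (hf : ∑ τ ∈ Finset.Icc (-(m : ℤ)) m, ‖φ τ‖ ^ 2 ≤ f)
    (J : Finset ℤ) (hF : J.card * f ≤ F) (L : ℝ) :
    noiseLaw N {ξ | 3 * F + 4 * Λ ^ 2 * L < ∑ t ∈ J, ‖conv φ (extend ξ) t‖ ^ 2} ≤
      ENNReal.ofReal (Real.exp (-L)) := by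
  have h1 : ∀ ξ : Window N → ℂ, ∑ t ∈ J, ‖conv φ (extend ξ) t‖ ^ 2 =
      ∑ k : J, ‖∑ i : Window N, φ (k - i) * ξ i‖ ^ 2 := by
    intro ξ
    rw [← Finset.sum_coe_sort J]
    simp_rw [conv_extend]
  simp_rw [h1]
  refine pi_complexGaussian_norm_sq_tail (fun (k : J) (i : Window N) => φ (k - i))
    (pow_pos hΛ 2) (fun v => ?_) ?_ L
  · rw [← h1, ← sum_norm_sq_extend]
    exact sum_norm_sq_conv_le hφ (bandLimited_extend v) hsymb J
  · refine le_trans ?_ hF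
    rw [← nsmul_eq_mul, ← Fintype.card_coe, ← Finset.card_univ]
    refine Finset.sum_le_card_nsmul _ _ _ fun k _ => ?_
    rw [sum_window (fun t => ‖φ (k - t)‖ ^ 2)]
    exact (sum_norm_sq_sub_le hφ _ _).trans hf

/-- The adjoint version serves the least-squares analysis, where the filter acts on the signal and
is moved onto the noise. -/
theorem noiseLaw_conv_adjoint_tail {N m : ℕ} {φ : ℤ → ℂ} (hφ : BandLimited m φ) {Λ f F : ℝ}
    (hΛ : 0 < Λ) (hsymb : ∀ θ, ‖symbol m φ θ‖ ≤ Λ)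
    (hf : ∑ τ ∈ Finset.Icc (-(m : ℤ)) m, ‖φ τ‖ ^ 2 ≤ f)
    {J : Finset ℤ} (hJ : J ⊆ Finset.Icc (-(N : ℤ)) N) (hF : J.card * f ≤ F) (L : ℝ) :
    noiseLaw N {ξ | 3 * F + 4 * Λ ^ 2 * L < ∑ t' ∈ Finset.Icc (-(N : ℤ)) N,
        ‖∑ t ∈ J, star (φ (t - t')) * extend ξ t‖ ^ 2} ≤
      ENNReal.ofReal (Real.exp (-L)) := by
  classical
  let A : Window N → Window N → ℂ := fun k i => if (i : ℤ) ∈ J then star (φ (i - k)) else 0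
  have hAξ : ∀ (ξ : Window N → ℂ) (k : Window N),
      ∑ i, A k i * ξ i = ∑ t ∈ J, star (φ (t - k)) * extend ξ t := by
    intro ξ k
    have e1 : ∀ i : Window N, A k i * ξ i =
        if (i : ℤ) ∈ J then star (φ (i - k)) * extend ξ i else 0 := by
      intro i
      simp only [A, extend_apply, ite_mul, zero_mul]
    simp_rw [e1]
    rw [sum_window (fun t => if t ∈ J then star (φ (t - k)) * extend ξ t else 0),
      ← Finset.sum_filter]
    congr 1
    ext t
    rw [Finset.mem_filter]
    exact ⟨fun h => h.2, fun h => ⟨hJ h, h⟩⟩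
  have h1 : ∀ ξ : Window N → ℂ, ∑ t' ∈ Finset.Icc (-(N : ℤ)) N,
      ‖∑ t ∈ J, star (φ (t - t')) * extend ξ t‖ ^ 2 = ∑ k, ‖∑ i, A k i * ξ i‖ ^ 2 := by
    intro ξ
    rw [← sum_window]
    simp_rw [hAξ]
  simp_rw [h1]
  refine pi_complexGaussian_norm_sq_tail A (pow_pos hΛ 2) (fun v => ?_) ?_ L
  -- The operator bound follows by duality: `‖y‖²` is a pairing of `v` with `φ * y`, and the
  -- arithmetic-geometric inequality leaves half of `‖y‖²` on the right.
  · set y : Window N → ℂ := fun k => ∑ i, A k i * v i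
    have hy := sum_norm_sq_conv_le hφ (bandLimited_extend y) hsymb J
    rw [sum_norm_sq_extend] at hy
    have hyv : ∑ k, ‖y k‖ ^ 2 ≤ ∑ t ∈ J, ‖extend v t‖ * ‖conv φ (extend y) t‖ := by
      have e2 : ((∑ k, ‖y k‖ ^ 2 : ℝ) : ℂ) =
          star (∑ t ∈ J, star (extend v t) * conv φ (extend y) t) := by
        push_cast
        simp_rw [← Complex.conj_mul', conv_extend, Finset.mul_sum, star_sum, star_mul', star_star]
        rw [Finset.sum_comm]
        refine Finset.sum_congr rfl fun k _ => ?_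
        simp only [y]
        rw [hAξ, mul_comm, Finset.sum_mul]
        refine Finset.sum_congr rfl fun t _ => ?_
        rw [Complex.star_def]
        ring
      have e3 := congrArg norm e2
      rw [Complex.norm_real, Real.norm_of_nonneg (by positivity), norm_star] at e3
      rw [e3]
      refine (norm_sum_le _ _).trans (le_of_eq (Finset.sum_congr rfl fun t _ => ?_))
      rw [norm_mul, norm_star]
    have hvJ : ∑ t ∈ J, ‖extend v t‖ ^ 2 ≤ ∑ i, ‖v i‖ ^ 2 := by
      rw [← sum_norm_sq_extend]
      exact Finset.sum_le_sum_of_subset_of_nonneg hJ fun _ _ _ => by positivity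
    have hamgm : ∑ t ∈ J, ‖extend v t‖ * ‖conv φ (extend y) t‖ ≤
        Λ ^ 2 / 2 * ∑ t ∈ J, ‖extend v t‖ ^ 2 +
          (2 * Λ ^ 2)⁻¹ * ∑ t ∈ J, ‖conv φ (extend y) t‖ ^ 2 := by
      rw [Finset.mul_sum, Finset.mul_sum, ← Finset.sum_add_distrib]
      refine Finset.sum_le_sum fun t _ => ?_
      have h5 := sq_nonneg (Λ * ‖extend v t‖ - Λ⁻¹ * ‖conv φ (extend y) t‖)
      have h6 : Λ * Λ⁻¹ = 1 := mul_inv_cancel₀ hΛ.ne'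
      have h7 : (2 * Λ ^ 2)⁻¹ = Λ⁻¹ ^ 2 / 2 := by field_simp
      have h10 : (Λ * ‖extend v t‖ - Λ⁻¹ * ‖conv φ (extend y) t‖) ^ 2 =
          Λ ^ 2 * ‖extend v t‖ ^ 2 - 2 * (Λ * Λ⁻¹) * (‖extend v t‖ * ‖conv φ (extend y) t‖) +
            Λ⁻¹ ^ 2 * ‖conv φ (extend y) t‖ ^ 2 := by ring
      rw [h10, h6] at h5
      rw [h7]
      linarith
    have h8 : (2 * Λ ^ 2)⁻¹ * ∑ t ∈ J, ‖conv φ (extend y) t‖ ^ 2 ≤ 1 / 2 * ∑ k, ‖y k‖ ^ 2 := by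
      rw [inv_mul_le_iff₀ (by positivity)]
      linarith
    have h9 : Λ ^ 2 / 2 * ∑ t ∈ J, ‖extend v t‖ ^ 2 ≤ Λ ^ 2 / 2 * ∑ i, ‖v i‖ ^ 2 := by gcongr
    change ∑ k, ‖y k‖ ^ 2 ≤ _
    linarith
  · refine le_trans ?_ hF
    rw [Finset.sum_comm]
    have e1 : ∀ i k : Window N, ‖A k i‖ ^ 2 = if (i : ℤ) ∈ J then ‖φ (i - k)‖ ^ 2 else 0 := by
      intro i k
      simp only [A]
      split_ifs <;> simp
    simp_rw [e1]
    have e2 : ∀ i : Window N, ∑ k : Window N, (if (i : ℤ) ∈ J then ‖φ (i - k)‖ ^ 2 else 0) ≤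
        if (i : ℤ) ∈ J then f else 0 := by
      intro i
      split_ifs
      · rw [sum_window (fun t => ‖φ (i - t)‖ ^ 2)]
        exact (sum_norm_sq_sub_le hφ _ _).trans hf
      · simp
    refine (Finset.sum_le_sum fun i _ => e2 i).trans ?_
    rw [sum_window (fun t => if t ∈ J then f else 0), ← Finset.sum_filter, Finset.sum_const,
      nsmul_eq_mul]
    have hf0 : 0 ≤ f := le_trans (by positivity) hf
    have hc : ((Finset.Icc (-(N : ℤ)) N).filter (· ∈ J)).card ≤ J.card :=
      Finset.card_le_card fun t ht => (Finset.mem_filter.1 ht).2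
    gcongr

/-- The diagonal entries equal `φ 0`, which controls the trace. Assuming `1 ≤ Λ` and `0 ≤ L` allows
the threshold to be enlarged to the one used for the energy, so a single threshold serves both. -/
theorem noiseLaw_chaos_tail {N m : ℕ} {φ : ℤ → ℂ} (hφ : BandLimited m φ) {Λ f F : ℝ} (hΛ : 1 ≤ Λ)
    (hsymb : ∀ θ, ‖symbol m φ θ‖ ≤ Λ) (hf : ∑ τ ∈ Finset.Icc (-(m : ℤ)) m, ‖φ τ‖ ^ 2 ≤ f)
    (hf0 : ‖φ 0‖ ≤ f) {J : Finset ℤ} (hJ : J ⊆ Finset.Icc (-(N : ℤ)) N) (hF : J.card * f ≤ F)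
    {L : ℝ} (hL : 0 ≤ L) :
    noiseLaw N {ξ | 3 * F + 4 * Λ ^ 2 * L <
        (∑ t ∈ J, star (extend ξ t) * conv φ (extend ξ) t).re} ≤
      ENNReal.ofReal (Real.exp (-L)) := by
  classical
  have hΛ0 : 0 < Λ := by linarith
  have hfpos : 0 ≤ f := le_trans (by positivity) hf
  have hF0 : 0 ≤ F := le_trans (by positivity) hF
  have hc : ((Finset.Icc (-(N : ℤ)) N).filter (· ∈ J)).card = J.card := by
    congr 1
    ext t
    rw [Finset.mem_filter]
    exact ⟨fun h => h.2, fun h => ⟨hJ h, h⟩⟩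
  let A : Window N → Window N → ℂ := fun i k => if (i : ℤ) ∈ J then φ (i - k) else 0
  have hform : ∀ v : Window N → ℂ, ∑ i, ∑ k, star (v i) * (A i k * v k) =
      ∑ t ∈ J, star (extend v t) * conv φ (extend v) t := by
    intro v
    have e1 : ∀ i : Window N, ∑ k, star (v i) * (A i k * v k) =
        if (i : ℤ) ∈ J then star (extend v i) * conv φ (extend v) i else 0 := by
      intro i
      simp only [A]
      split_ifs
      · rw [conv_extend, extend_apply, Finset.mul_sum]
      · simp
    simp_rw [e1]
    rw [sum_window (fun t => if t ∈ J then star (extend v t) * conv φ (extend v) t else 0),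
      ← Finset.sum_filter]
    congr 1
    ext t
    rw [Finset.mem_filter]
    exact ⟨fun h => h.2, fun h => ⟨hJ h, h⟩⟩
  have htail := pi_complexGaussian_chaos_tail A (F := F) (τ := F) hΛ0 (fun v => ?_) ?_ ?_ L
  · refine le_trans (measure_mono fun ξ hξ => ?_) htail
    simp only [Set.mem_ofPred_eq] at hξ ⊢
    rw [hform]
    refine lt_of_le_of_lt ?_ hξ
    have h1 : F / Λ ≤ F := div_le_self hF0 hΛ
    have h2 : 4 * Λ * L ≤ 4 * Λ ^ 2 * L := by nlinarith [mul_nonneg (sub_nonneg.2 hΛ) hL]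
    linarith
  · rw [hform]
    refine (Complex.abs_re_le_norm _).trans ((norm_sum_le _ _).trans ?_)
    have hy := sum_norm_sq_conv_le hφ (bandLimited_extend v) hsymb J
    rw [sum_norm_sq_extend] at hy
    have hvJ : ∑ t ∈ J, ‖extend v t‖ ^ 2 ≤ ∑ i, ‖v i‖ ^ 2 := by
      rw [← sum_norm_sq_extend]
      exact Finset.sum_le_sum_of_subset_of_nonneg hJ fun _ _ _ => by positivity
    have hamgm : ∑ t ∈ J, ‖star (extend v t) * conv φ (extend v) t‖ ≤
        Λ / 2 * ∑ t ∈ J, ‖extend v t‖ ^ 2 +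
          (2 * Λ)⁻¹ * ∑ t ∈ J, ‖conv φ (extend v) t‖ ^ 2 := by
      rw [Finset.mul_sum, Finset.mul_sum, ← Finset.sum_add_distrib]
      refine Finset.sum_le_sum fun t _ => ?_
      rw [norm_mul, norm_star]
      have h5 := sq_nonneg (Λ * ‖extend v t‖ - ‖conv φ (extend v) t‖)
      have h7 : Λ / 2 * ‖extend v t‖ ^ 2 + (2 * Λ)⁻¹ * ‖conv φ (extend v) t‖ ^ 2 =
        (Λ ^ 2 * ‖extend v t‖ ^ 2 + ‖conv φ (extend v) t‖ ^ 2) / (2 * Λ) := by field_simp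
      rw [h7, le_div_iff₀ (by positivity)]
      nlinarith
    have h8 : (2 * Λ)⁻¹ * ∑ t ∈ J, ‖conv φ (extend v) t‖ ^ 2 ≤ Λ / 2 * ∑ k, ‖v k‖ ^ 2 := by
      rw [inv_mul_le_iff₀ (by positivity)]
      refine hy.trans (le_of_eq ?_)
      ring
    have h9 : Λ / 2 * ∑ t ∈ J, ‖extend v t‖ ^ 2 ≤ Λ / 2 * ∑ i, ‖v i‖ ^ 2 := by gcongr
    linarith
  · refine le_trans ?_ hF
    have e2 : ∀ i : Window N, ∑ k : Window N, ‖A i k‖ ^ 2 ≤ if (i : ℤ) ∈ J then f else 0 := by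
      intro i
      simp only [A]
      split_ifs
      · rw [sum_window (fun t => ‖φ (i - t)‖ ^ 2)]
        exact (sum_norm_sq_sub_le hφ _ _).trans hf
      · simp
    refine (Finset.sum_le_sum fun i _ => e2 i).trans ?_
    rw [sum_window (fun t => if t ∈ J then f else 0), ← Finset.sum_filter, Finset.sum_const,
      nsmul_eq_mul, hc]
  · refine le_trans ?_ hF
    have e2 : ∀ i : Window N, A i i = if (i : ℤ) ∈ J then φ 0 else 0 := by
      intro i
      simp only [A, sub_self]
    simp_rw [e2]
    rw [sum_window (fun t => if t ∈ J then φ 0 else 0), ← Finset.sum_filter, Finset.sum_const,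
      nsmul_eq_mul, hc]
    refine (Complex.re_le_norm _).trans ?_
    rw [norm_mul, Complex.norm_natCast]
    gcongr

/-- Tail bound for the coordinates of the noise in an orthonormal system. -/
theorem noiseLaw_projection_tail {N κ d : ℕ} (hκ : κ ≤ d) {J : Finset ℤ}
    (hJ : J ⊆ Finset.Icc (-(N : ℤ)) N) (β : Fin κ → ℤ → ℂ)
    (hunit : ∀ i, ∑ t ∈ J, ‖β i t‖ ^ 2 = 1)
    (hbessel : ∀ v : ℤ → ℂ, ∑ i, ‖∑ t ∈ J, star (β i t) * v t‖ ^ 2 ≤ ∑ t ∈ J, ‖v t‖ ^ 2) (L : ℝ) :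
    noiseLaw N {ξ | 3 * d + 4 * L < ∑ i, ‖∑ t ∈ J, star (β i t) * extend ξ t‖ ^ 2} ≤
      ENNReal.ofReal (Real.exp (-L)) := by
  classical
  let A : Fin κ → Window N → ℂ := fun k i => if (i : ℤ) ∈ J then star (β k i) else 0
  have hfilter : (Finset.Icc (-(N : ℤ)) N).filter (· ∈ J) = J := by
    ext t
    rw [Finset.mem_filter]
    exact ⟨fun h => h.2, fun h => ⟨hJ h, h⟩⟩
  have hAξ : ∀ (ξ : Window N → ℂ) (k : Fin κ),
      ∑ i, A k i * ξ i = ∑ t ∈ J, star (β k t) * extend ξ t := by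
    intro ξ k
    have e1 : ∀ i : Window N, A k i * ξ i =
        if (i : ℤ) ∈ J then star (β k i) * extend ξ i else 0 := by
      intro i
      simp only [A, extend_apply, ite_mul, zero_mul]
    simp_rw [e1]
    rw [sum_window (fun t => if t ∈ J then star (β k t) * extend ξ t else 0),
      ← Finset.sum_filter, hfilter]
  simp_rw [← hAξ]
  have h := pi_complexGaussian_norm_sq_tail A (V := 1) (F := d) one_pos (fun v => ?_) ?_ L
  · simpa [noiseLaw] using h
  · simp_rw [hAξ]
    rw [one_mul, ← sum_norm_sq_extend]
    exact (hbessel _).trans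
      (Finset.sum_le_sum_of_subset_of_nonneg hJ fun _ _ _ => by positivity)
  · have e1 : ∀ k, ∑ i, ‖A k i‖ ^ 2 = 1 := by
      intro k
      rw [← hunit k, ← hfilter, Finset.sum_filter,
        ← sum_window (fun t => if t ∈ J then ‖β k t‖ ^ 2 else 0)]
      refine Finset.sum_congr rfl fun i _ => ?_
      simp only [A]
      split_ifs <;> simp
    simp_rw [e1]
    simpa using hκ

/-- Tail bound for the energy of the noise on a set. -/
theorem noiseLaw_energy_tail {N : ℕ} {J : Finset ℤ} (hJ : J ⊆ Finset.Icc (-(N : ℤ)) N) (L : ℝ) :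
    noiseLaw N {ξ | 3 * J.card + 4 * L < ∑ t ∈ J, ‖extend ξ t‖ ^ 2} ≤
      ENNReal.ofReal (Real.exp (-L)) := by
  classical
  have e : ∀ (ξ : Window N → ℂ) (k : J),
      ∑ i : Window N, (if (k : ℤ) = i then 1 else 0) * ξ i = extend ξ k := by
    intro ξ k
    simp_rw [ite_mul, one_mul, zero_mul]
    rw [Finset.sum_eq_single (⟨k, hJ k.2⟩ : Window N)]
    · rw [if_pos rfl, ← extend_apply ξ]
    · intro i _ hi
      rw [if_neg]
      intro h; apply hi; ext; exact h.symm
    · exact fun h => absurd (Finset.mem_univ _) h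
  have e' : ∀ ξ : Window N → ℂ, ∑ t ∈ J, ‖extend ξ t‖ ^ 2 = ∑ k : J, ‖extend ξ k‖ ^ 2 :=
    fun ξ => (Finset.sum_coe_sort J (fun t => ‖extend ξ t‖ ^ 2)).symm
  have h := pi_complexGaussian_norm_sq_tail (ι := Window N)
    (fun (k : J) (i : Window N) => if (k : ℤ) = i then 1 else 0) (V := 1)
    (F := J.card) one_pos (fun v => ?_) ?_ L
  · simp_rw [e] at h
    simp_rw [e']
    rw [mul_one] at h
    exact h
  · simp_rw [e]
    rw [← e', one_mul, ← sum_norm_sq_extend]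
    exact Finset.sum_le_sum_of_subset_of_nonneg hJ fun _ _ _ => by positivity
  · have e2 : ∀ k : J, ∑ i : Window N, ‖(if (k : ℤ) = i then (1 : ℂ) else 0)‖ ^ 2 = 1 := by
      intro k
      rw [Finset.sum_eq_single (⟨k, hJ k.2⟩ : Window N)]
      · simp
      · intro i _ hi
        rw [if_neg]
        · simp
        · intro h; apply hi; ext; exact h.symm
      · exact fun h => absurd (Finset.mem_univ _) h
    simp_rw [e2]
    simp

/-! ### Suprema over filters -/

/-- The linear functional `φ ↦ ⟨g, φ * v⟩_J` on filters of halfwidth `m`. -/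
noncomputable def pairing (m : ℕ) (J : Finset ℤ) (g v : ℤ → ℂ) : (ℤ → ℂ) →ₗ[ℂ] ℂ where
  toFun φ := ∑ t ∈ J, star (g t) * ∑ τ ∈ Finset.Icc (-(m : ℤ)) m, φ τ * v (t - τ)
  map_add' φ ψ := by
    simp only [Pi.add_apply, add_mul, Finset.sum_add_distrib, mul_add]
  map_smul' c φ := by
    simp only [Pi.smul_apply, smul_eq_mul, RingHom.id_apply, Finset.mul_sum]
    refine Finset.sum_congr rfl fun t _ => Finset.sum_congr rfl fun τ _ => ?_
    ring

theorem pairing_apply {m : ℕ} {φ : ℤ → ℂ} (hφ : BandLimited m φ) (J : Finset ℤ) (g v : ℤ → ℂ) :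
    pairing m J g v φ = ∑ t ∈ J, star (g t) * conv φ v t := by
  simp only [conv_eq_sum hφ]
  rfl

/-- The spectrum of `φ` is bounded by `β / √(2m+1)` in `ℓ^∞` and by `rβ / √(2m+1)` in `ℓ¹`. -/
structure SpectrumBound (m r : ℕ) (β : ℝ) (φ : ℤ → ℂ) : Prop where
  band : BandLimited m φ
  inf_le : normInf (dft m φ) ≤ β / Real.sqrt (2 * m + 1)
  one_le : norm1 (dft m φ) ≤ r * β / Real.sqrt (2 * m + 1)

theorem dft_neg (m : ℕ) (φ : ℤ → ℂ) : dft m (-φ) = -dft m φ := by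
  funext k
  simp [dft]

theorem SpectrumBound.neg {m r : ℕ} {β : ℝ} {φ : ℤ → ℂ} (h : SpectrumBound m r β φ) :
    SpectrumBound m r β (-φ) where
  band t ht := by rw [Pi.neg_apply, h.band t ht, neg_zero]
  inf_le := by
    rw [dft_neg, normInf, norm_neg]; exact h.inf_le
  one_le := by
    simp only [dft_neg, norm1, Pi.neg_apply, norm_neg]; exact h.one_le

theorem SpectrumBound.re_pairing_le {m r : ℕ} (hr : 1 ≤ r) (hrM : r ≤ 2 * m + 1) {β : ℝ}
    (hβ : 0 ≤ β) {φ : ℤ → ℂ} (h : SpectrumBound m r β φ) (J : Finset ℤ) (g v : ℤ → ℂ) :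
    ∃ p : Net m r, (∑ t ∈ J, star (g t) * conv φ v t).re ≤
      β * (∑ t ∈ J, star (g t) * conv (atom m r p) v t).re := by
  obtain ⟨p, hp⟩ := exists_atom_re_le hr hrM h.band hβ h.inf_le h.one_le (pairing m J g v)
  rw [pairing_apply h.band, pairing_apply (bandLimited_atom m r p)] at hp
  exact ⟨p, hp⟩

theorem re_sum_star_mul_le (J : Finset ℤ) (f g : ℤ → ℂ) :
    (∑ t ∈ J, star (f t) * g t).re ≤
      Real.sqrt (∑ t ∈ J, ‖f t‖ ^ 2) * Real.sqrt (∑ t ∈ J, ‖g t‖ ^ 2) := by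
  refine (Complex.re_le_norm _).trans ((norm_sum_le _ _).trans ?_)
  simp only [norm_mul, norm_star]
  exact Real.sum_mul_le_sqrt_mul_sqrt J (fun t => ‖f t‖) (fun t => ‖g t‖)

theorem re_sum_star_self (J : Finset ℤ) (f : ℤ → ℂ) :
    (∑ t ∈ J, star (f t) * f t).re = ∑ t ∈ J, ‖f t‖ ^ 2 := by
  rw [Complex.re_sum]
  refine Finset.sum_congr rfl fun t _ => ?_
  rw [Complex.star_def, ← Complex.normSq_eq_conj_mul_self, Complex.normSq_eq_norm_sq,
    Complex.ofReal_re]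

/-- Testing the linear bound against `φ * v` itself turns the quadratic quantity into a linear one;
Cauchy–Schwarz then cancels one factor of the norm. -/
theorem SpectrumBound.sum_norm_sq_conv_le {m r : ℕ} (hr : 1 ≤ r) (hrM : r ≤ 2 * m + 1) {β : ℝ}
    (hβ : 0 ≤ β) {φ : ℤ → ℂ} (h : SpectrumBound m r β φ) (J : Finset ℤ) (v : ℤ → ℂ) {T : ℝ}
    (hT : ∀ p : Net m r, ∑ t ∈ J, ‖conv (atom m r p) v t‖ ^ 2 ≤ T) :
    ∑ t ∈ J, ‖conv φ v t‖ ^ 2 ≤ β ^ 2 * T := by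
  obtain ⟨p, hp⟩ := h.re_pairing_le hr hrM hβ J (conv φ v) v
  rw [re_sum_star_self] at hp
  have h1 := re_sum_star_mul_le J (conv φ v) (conv (atom m r p) v)
  set a := ∑ t ∈ J, ‖conv φ v t‖ ^ 2
  have ha : 0 ≤ a := by positivity
  have h2 : Real.sqrt (∑ t ∈ J, ‖conv (atom m r p) v t‖ ^ 2) ≤ Real.sqrt T :=
    Real.sqrt_le_sqrt (hT p)
  have hT0 : 0 ≤ T := le_trans (by positivity) (hT p)
  have h3 : a ≤ β * (Real.sqrt a * Real.sqrt T) :=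
    hp.trans (mul_le_mul_of_nonneg_left (h1.trans (by gcongr)) hβ)
  have h4 : Real.sqrt a * Real.sqrt a = a := Real.mul_self_sqrt ha
  have h5 : Real.sqrt T * Real.sqrt T = T := Real.mul_self_sqrt hT0
  have h6 : 0 ≤ Real.sqrt a := Real.sqrt_nonneg a
  have h7 : 0 ≤ β * Real.sqrt T := by positivity
  have h8 : Real.sqrt a ≤ β * Real.sqrt T := by
    by_contra hc
    rw [not_le] at hc
    nlinarith
  nlinarith

/-! ### The error of an optimal filter -/

/-- The deterministic part of the analysis of a residual-minimizing filter. -/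
theorem norm_sq_le_of_residual_le {E : Type*} [NormedAddCommGroup E] [InnerProductSpace ℂ E]
    {w a a₀ e : E} {σ c T : ℝ} (hσ : 0 ≤ σ) (hc : 0 ≤ c) (hT : 0 ≤ T)
    (hres : ‖(w - (σ : ℂ) • a) + (σ : ℂ) • e‖ ≤ ‖(σ : ℂ) • e - (σ : ℂ) • a₀‖)
    (h₀ : ‖a₀‖ ^ 2 ≤ T) (h₀' : -(inner ℂ e a₀).re ≤ T) (ha : ‖a‖ ^ 2 ≤ c ^ 2 * T)
    (ha' : (inner ℂ e a).re ≤ c * T) (hw : ‖inner ℂ e w‖ ^ 2 ≤ T * ‖w‖ ^ 2) :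
    ‖w - (σ : ℂ) • a‖ ^ 2 ≤ (10 + 8 * c) * σ ^ 2 * T := by
  set u := w - (σ : ℂ) • a with hu
  set q := Real.sqrt T with hq
  have hq0 : 0 ≤ q := Real.sqrt_nonneg T
  have hqT : q * q = T := Real.mul_self_sqrt hT
  have hre : ∀ z : E, (inner ℂ z ((σ : ℂ) • e)).re = σ * (inner ℂ e z).re := by
    intro z
    rw [inner_smul_right, Complex.re_ofReal_mul, ← inner_conj_symm, Complex.conj_re]
  have h1 : ‖u + (σ : ℂ) • e‖ ^ 2 = ‖u‖ ^ 2 + 2 * (σ * (inner ℂ e u).re) + ‖(σ : ℂ) • e‖ ^ 2 := by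
    rw [@norm_add_sq ℂ, ← hre]; rfl
  have h2 : ‖(σ : ℂ) • e - (σ : ℂ) • a₀‖ ^ 2 =
      ‖(σ : ℂ) • e‖ ^ 2 - 2 * (σ ^ 2 * (inner ℂ e a₀).re) + σ ^ 2 * ‖a₀‖ ^ 2 := by
    rw [@norm_sub_sq ℂ, norm_smul (σ : ℂ) a₀, Complex.norm_real, Real.norm_of_nonneg hσ, mul_pow]
    congr 2
    have : RCLike.re (inner ℂ ((σ : ℂ) • e) ((σ : ℂ) • a₀)) = σ ^ 2 * (inner ℂ e a₀).re := by
      rw [inner_smul_left, inner_smul_right, Complex.conj_ofReal, ← mul_assoc,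
        ← Complex.ofReal_mul]
      change ((((σ * σ : ℝ) : ℂ)) * inner ℂ e a₀).re = _
      rw [Complex.re_ofReal_mul, pow_two]
    rw [this]
  have h3 := pow_le_pow_left₀ (norm_nonneg _) hres 2
  rw [h1, h2] at h3
  have h4 : (inner ℂ e u).re = (inner ℂ e w).re - σ * (inner ℂ e a).re := by
    rw [hu, inner_sub_right, Complex.sub_re, inner_smul_right, Complex.re_ofReal_mul]
  have h5 : ‖inner ℂ e w‖ ≤ q * ‖w‖ := by
    refine le_of_sq_le_sq ?_ (by positivity)
    rw [mul_pow, pow_two q, hqT]; exact hw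
  have h6 : -(inner ℂ e w).re ≤ q * ‖w‖ :=
    (neg_le_abs _).trans ((Complex.abs_re_le_norm _).trans h5)
  have h7 : ‖a‖ ≤ c * q := by
    refine le_of_sq_le_sq ?_ (by positivity)
    rw [mul_pow, pow_two q, hqT]; exact ha
  have h8 : ‖w‖ ≤ ‖u‖ + σ * (c * q) := by
    have : w = u + (σ : ℂ) • a := by rw [hu]; abel
    calc ‖w‖ = ‖u + (σ : ℂ) • a‖ := by rw [← this]
      _ ≤ ‖u‖ + ‖(σ : ℂ) • a‖ := norm_add_le _ _
      _ ≤ ‖u‖ + σ * (c * q) := by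
        rw [norm_smul, Complex.norm_real, Real.norm_of_nonneg hσ]
        gcongr
  have hu0 := norm_nonneg u
  have h9 : q * ‖w‖ ≤ q * (‖u‖ + σ * (c * q)) := mul_le_mul_of_nonneg_left h8 hq0
  have h10 : σ * (-(inner ℂ e w).re) ≤ σ * (q * (‖u‖ + σ * (c * q))) :=
    mul_le_mul_of_nonneg_left (h6.trans h9) hσ
  have h11 : σ ^ 2 * (inner ℂ e a).re ≤ σ ^ 2 * (c * T) :=
    mul_le_mul_of_nonneg_left ha' (sq_nonneg σ)
  have h12 : σ ^ 2 * (-(inner ℂ e a₀).re) ≤ σ ^ 2 * T :=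
    mul_le_mul_of_nonneg_left h₀' (sq_nonneg σ)
  have h13 : σ ^ 2 * ‖a₀‖ ^ 2 ≤ σ ^ 2 * T := mul_le_mul_of_nonneg_left h₀ (sq_nonneg σ)
  -- This absorbs `2σq‖u‖` into `‖u‖²/2 + 2σ²T`. What remains is `‖u‖²/2 ≤ (5 + 4c)σ²T`.
  have h14 := sq_nonneg (‖u‖ - 2 * (σ * q))
  rw [h4] at h3
  have h15 : σ * (q * (σ * (c * q))) = σ ^ 2 * (c * T) := by rw [← hqT]; ring
  have h16 : (σ * q) ^ 2 = σ ^ 2 * T := by rw [← hqT]; ring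
  nlinarith

theorem cStar_ge : 27 ≤ cStar := by
  have h := Real.pi_gt_d2
  rw [cStar]
  nlinarith

/-- The weight `18s` in the constraint is the ratio of the two norm bounds, hence the sparsity of
the filters that dominate the feasible ones. -/
theorem Feasible.spectrumBound {m s : ℕ} (hs : 1 ≤ s) {φ : ℤ → ℂ} (h : Feasible m s φ) :
    SpectrumBound m (18 * s) cStar φ := by
  have hs' : (1 : ℝ) ≤ s := by exact_mod_cast hs
  refine ⟨h.1, ?_, ?_⟩
  · have h1 := (le_max_right _ _).trans h.2
    have h2 : 18 * cStar * (s : ℝ) / Real.sqrt (2 * m + 1) =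
        18 * s * (cStar / Real.sqrt (2 * m + 1)) := by ring
    rw [h2] at h1
    exact le_of_mul_le_mul_left h1 (by positivity)
  · refine ((le_max_left _ _).trans h.2).trans (le_of_eq ?_)
    push_cast
    ring

theorem l2_sq (n : ℕ) (u : ℤ → ℂ) :
    l2 n u ^ 2 = ∑ t ∈ Finset.Icc (-(n : ℤ)) n, ‖u t‖ ^ 2 := by
  rw [l2, Real.sq_sqrt (by positivity)]

theorem sum_Icc_shift (m : ℕ) (h : ℤ) (f : ℤ → ℝ) :
    ∑ t ∈ Finset.Icc (-(m : ℤ)) m, f (t + h) = ∑ t ∈ Finset.Icc (h - m) (h + m), f t := by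
  refine Finset.sum_bij (fun t _ => t + h) ?_ ?_ ?_ fun _ _ => rfl
  · intro t ht
    rw [Finset.mem_Icc] at *
    omega
  · intro a _ b _ hab
    simpa using hab
  · intro t ht
    rw [Finset.mem_Icc] at ht
    exact ⟨t - h, by rw [Finset.mem_Icc]; omega, by ring⟩

theorem residual_sq (m : ℕ) (h : ℤ) (y φ : ℤ → ℂ) :
    residual m h y φ ^ 2 = ∑ t ∈ Finset.Icc (h - m) (h + m), ‖conv φ y t - y t‖ ^ 2 := by
  rw [residual, l2_sq, ← sum_Icc_shift m h (fun t => ‖conv φ y t - y t‖ ^ 2)]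

/-- The restriction of a sequence to a finite set. -/
noncomputable def restrictTo (J : Finset ℤ) : (ℤ → ℂ) →ₗ[ℂ] EuclideanSpace ℂ J where
  toFun u := WithLp.toLp 2 fun t => u t
  map_add' _ _ := rfl
  map_smul' _ _ := rfl

theorem norm_sq_restrictTo (J : Finset ℤ) (u : ℤ → ℂ) :
    ‖restrictTo J u‖ ^ 2 = ∑ t ∈ J, ‖u t‖ ^ 2 := by
  rw [EuclideanSpace.norm_sq_eq, ← Finset.sum_coe_sort J (fun t => ‖u t‖ ^ 2)]
  rfl

theorem inner_restrictTo (J : Finset ℤ) (u v : ℤ → ℂ) :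
    inner ℂ (restrictTo J u) (restrictTo J v) = ∑ t ∈ J, star (u t) * v t := by
  rw [PiLp.inner_apply, ← Finset.sum_coe_sort J (fun t => star (u t) * v t)]
  refine Finset.sum_congr rfl fun t _ => ?_
  change inner ℂ (u t) (v t) = _
  simp [mul_comm]

/-- The error of an optimal filter on the interval where its residual is minimized. -/
theorem optimalFilter_error_le {X : Submodule ℂ (ℤ → ℂ)} (hX : IsShiftInvariant X)
    [FiniteDimensional ℂ X] {m s : ℕ} (hs : 1 ≤ s) (hd : Module.finrank ℂ X ≤ s)
    (hm : 9 * s ≤ m) {h : ℤ} {σ : ℝ} (hσ : 0 ≤ σ) {x y η : ℤ → ℂ} (hx : x ∈ X)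
    (hy : ∀ t ∈ Finset.Icc (h - 2 * m) (h + 2 * m), y t = x t + σ * η t) {T : ℝ}
    (hT1 : ∀ p : Net m (18 * s),
      ∑ t ∈ Finset.Icc (h - m) (h + m), ‖conv (atom m (18 * s) p) η t‖ ^ 2 ≤ T)
    (hT2 : ∀ p : Net m (18 * s),
      (∑ t ∈ Finset.Icc (h - m) (h + m), star (η t) * conv (atom m (18 * s) p) η t).re ≤ T)
    (hT3 : ∀ w ∈ X, ‖∑ t ∈ Finset.Icc (h - m) (h + m), star (η t) * w t‖ ^ 2 ≤
      T * ∑ t ∈ Finset.Icc (h - m) (h + m), ‖w t‖ ^ 2)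
    {φ : ℤ → ℂ} (hφ : IsOptimalFilter m s h y φ) :
    ∑ t ∈ Finset.Icc (h - m) (h + m), ‖conv φ y t - x t‖ ^ 2 ≤
      (10 + 8 * cStar) * σ ^ 2 * T := by
  set I := Finset.Icc (h - m : ℤ) (h + m) with hI
  have hc := cStar_ge
  have hs' : (1 : ℝ) ≤ s := by exact_mod_cast hs
  have hr : 1 ≤ 18 * s := by omega
  -- The assumption `9 * s ≤ m` leaves room for `18s` distinct frequencies on the grid.
  have hrM : 18 * s ≤ 2 * m + 1 := by omega
  have hsq : 0 < Real.sqrt (2 * (m : ℝ) + 1) := Real.sqrt_pos.2 (by positivity)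
  obtain ⟨φ₀, hb₀, hrep₀, hinf₀, hone₀⟩ := exists_reproducing_filter hX hd m
  have hfeas₀ : Feasible m s φ₀ := by
    refine ⟨hb₀, max_le (hone₀.trans ?_) ?_⟩
    · exact div_le_div_of_nonneg_right (by nlinarith) hsq.le
    · refine (mul_le_mul_of_nonneg_left hinf₀ (by positivity)).trans ?_
      rw [mul_div_assoc']
      exact div_le_div_of_nonneg_right (by nlinarith) hsq.le
  have hsp₀ : SpectrumBound m (18 * s) 1 φ₀ := by
    refine ⟨hb₀, hinf₀, hone₀.trans ?_⟩
    push_cast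
    exact div_le_div_of_nonneg_right (by linarith) hsq.le
  have hsp := hφ.1.spectrumBound hs
  have hT0 : 0 ≤ T := by
    obtain ⟨p, -⟩ := hsp₀.re_pairing_le hr hrM zero_le_one I η η
    exact le_trans (by positivity) (hT1 p)
  have hconv : ∀ ψ, BandLimited m ψ → ∀ t ∈ I, conv ψ y t = conv ψ x t + σ * conv ψ η t := by
    intro ψ hψ t ht
    rw [conv_eq_sum hψ, conv_eq_sum hψ, conv_eq_sum hψ, Finset.mul_sum, ← Finset.sum_add_distrib]
    refine Finset.sum_congr rfl fun τ hτ => ?_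
    rw [hy]
    · ring
    · rw [hI] at ht
      rw [Finset.mem_Icc] at *
      omega
  have hyI : ∀ t ∈ I, y t = x t + σ * η t := fun t ht => hy t (by
    rw [hI] at ht
    rw [Finset.mem_Icc] at *
    omega)
  have hconvx : conv φ x ∈ X := by
    have : conv φ x = ∑ τ ∈ Finset.Icc (-(m : ℤ)) m, φ τ • fun t => x (t + -τ) := by
      funext t
      rw [conv_eq_sum hφ.1.1, Finset.sum_apply]
      rfl
    rw [this]
    exact Submodule.sum_mem _ fun τ _ => Submodule.smul_mem _ _ (hX.translate_mem hx (-τ))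
  -- However `φ` depends on the noise, its bias stays in the fixed subspace `X`, so `hT3` applies to
  -- it.
  have hwX : x - conv φ x ∈ X := Submodule.sub_mem _ hx hconvx
  have hmain := norm_sq_le_of_residual_le (w := restrictTo I (x - conv φ x)) (a := restrictTo I (conv φ η))
    (a₀ := restrictTo I (conv φ₀ η)) (e := restrictTo I η) (T := T) (c := cStar) hσ (by linarith) hT0 ?_ ?_ ?_ ?_ ?_ ?_
  · rw [← map_smul, ← map_sub, norm_sq_restrictTo] at hmain
    refine le_trans (le_of_eq (Finset.sum_congr rfl fun t ht => ?_)) hmain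
    rw [hconv φ hφ.1.1 t ht, ← norm_neg]
    congr 2
    simp only [Pi.sub_apply, Pi.smul_apply, smul_eq_mul]
    ring
  · have h1 := hφ.2 φ₀ hfeas₀
    have h2 := pow_le_pow_left₀ (show 0 ≤ residual m h y φ from Real.sqrt_nonneg _) h1 2
    rw [residual_sq, residual_sq] at h2
    refine le_of_sq_le_sq ?_ (norm_nonneg _)
    rw [← map_smul, ← map_sub, ← map_smul, ← map_add, ← map_smul, ← map_sub,
      norm_sq_restrictTo, norm_sq_restrictTo]
    refine le_trans (le_of_eq (Finset.sum_congr rfl fun t ht => ?_)) (h2.trans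
      (le_of_eq (Finset.sum_congr rfl fun t ht => ?_)))
    all_goals simp only [Pi.sub_apply, Pi.smul_apply, smul_eq_mul, Pi.add_apply]
    · rw [hconv φ hφ.1.1 t ht, hyI t ht, ← norm_neg]
      congr 2
      ring
    · rw [hconv φ₀ hb₀ t ht, hyI t ht, hrep₀ x hx, ← norm_neg]
      congr 2
      ring
  · rw [norm_sq_restrictTo]
    have := hsp₀.sum_norm_sq_conv_le hr hrM zero_le_one I η hT1
    simpa using this
  · rw [inner_restrictTo]
    -- The chaos of the comparison filter is needed from below; its negative obeys the same spectral
    -- bounds.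
    obtain ⟨p, hp⟩ := hsp₀.neg.re_pairing_le hr hrM zero_le_one I η η
    have e1 : ∀ t, conv (-φ₀) η t = -conv φ₀ η t := fun t => by
      rw [conv_eq_sum hb₀, conv_eq_sum hsp₀.neg.band, ← Finset.sum_neg_distrib]
      simp
    simp only [e1, mul_neg, Finset.sum_neg_distrib, Complex.neg_re, one_mul] at hp
    exact hp.trans (hT2 p)
  · rw [norm_sq_restrictTo]
    exact hsp.sum_norm_sq_conv_le hr hrM (by linarith) I η hT1
  · rw [inner_restrictTo]
    obtain ⟨p, hp⟩ := hsp.re_pairing_le hr hrM (by linarith : 0 ≤ cStar) I η η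
    exact hp.trans (mul_le_mul_of_nonneg_left (hT2 p) (by linarith))
  · rw [inner_restrictTo, norm_sq_restrictTo]
    exact hT3 _ hwX

/-! ### Existence of the estimator -/

theorem continuous_extend {N : ℕ} (t : ℤ) : Continuous fun v : Window N → ℂ => extend v t := by
  by_cases h : t ∈ Finset.Icc (-(N : ℤ)) N
  · simp only [extend, dif_pos h]
    exact continuous_apply _
  · simp only [extend, dif_neg h]
    exact continuous_const

theorem extend_restrict {N : ℕ} {u : ℤ → ℂ} (hu : BandLimited N u) :
    extend (fun t : Window N => u t) = u := by
  funext t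
  by_cases h : t ∈ Finset.Icc (-(N : ℤ)) N
  · rw [extend, dif_pos h]
  · rw [extend, dif_neg h, bandLimited_iff.1 hu t h]

/-- The feasible filters form a nonempty compact subset of a finite-dimensional space (boundedness
comes from Fourier inversion and the `ℓ¹` constraint), and the residual is continuous. -/
theorem exists_isOptimalFilter (m s : ℕ) (h : ℤ) (y : ℤ → ℂ) : ∃ φ, IsOptimalFilter m s h y φ := by
  have hc := cStar_ge
  let S : Set (Window m → ℂ) := {v | Feasible m s (extend v)}
  have hdft : ∀ k, Continuous fun v : Window m → ℂ => dft m (extend v) k := fun k => by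
    unfold dft
    exact continuous_const.mul (continuous_finsetSum _ fun τ _ =>
      continuous_const.mul (continuous_extend τ))
  have hdft' : Continuous fun v : Window m → ℂ => dft m (extend v) := continuous_pi hdft
  have hone : Continuous fun v : Window m → ℂ => norm1 (dft m (extend v)) :=
    continuous_finsetSum _ fun k _ => (hdft k).norm
  have hclosed : IsClosed S := by
    have : S = {v | max (norm1 (dft m (extend v))) (18 * (s : ℝ) * normInf (dft m (extend v))) ≤
        18 * cStar * (s : ℝ) / Real.sqrt (2 * (m : ℝ) + 1)} := by
      ext v
      exact ⟨fun h => h.2, fun h => ⟨bandLimited_extend v, h⟩⟩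
    rw [this]
    exact isClosed_le (hone.max (continuous_const.mul hdft'.norm)) continuous_const
  have hbdd : Bornology.IsBounded S := by
    rw [Metric.isBounded_iff_subset_closedBall (0 : Window m → ℂ)]
    refine ⟨(18 * cStar * (s : ℝ) / Real.sqrt (2 * (m : ℝ) + 1)) *
      (Real.sqrt (2 * (m : ℝ) + 1))⁻¹, fun v hv => ?_⟩
    have h1 := (le_max_left _ _).trans hv.2
    rw [mem_closedBall_zero_iff, pi_norm_le_iff_of_nonneg (by positivity)]
    intro t
    rw [← extend_apply v t, dft_inversion m (extend v) t.2]
    refine (norm_sum_le _ _).trans ?_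
    have h2 : ∀ k, ‖dft m (extend v) k * (((Real.sqrt (2 * (m : ℝ) + 1) : ℝ) : ℂ)⁻¹ *
        chi (freq (2 * m + 1) k) t)‖ = ‖dft m (extend v) k‖ * (Real.sqrt (2 * (m : ℝ) + 1))⁻¹ := by
      intro k
      rw [norm_mul, norm_mul, norm_chi, norm_inv, Complex.norm_real,
        Real.norm_of_nonneg (Real.sqrt_nonneg _), mul_one]
    simp_rw [h2]
    rw [← Finset.sum_mul]
    exact mul_le_mul_of_nonneg_right h1 (by positivity)
  have hcompact : IsCompact S := Metric.isCompact_of_isClosed_isBounded hclosed hbdd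
  have hne : S.Nonempty := by
    refine ⟨0, bandLimited_extend 0, ?_⟩
    have h0 : dft m (extend (0 : Window m → ℂ)) = 0 := by
      funext k
      simp [dft, extend]
    rw [h0]
    simp only [norm1, normInf, Pi.zero_apply, norm_zero, Finset.sum_const_zero, mul_zero, max_self]
    positivity
  have hres : Continuous fun v : Window m → ℂ => residual m h y (extend v) := by
    unfold residual l2
    refine Real.continuous_sqrt.comp (continuous_finsetSum _ fun t _ => ?_)
    simp_rw [conv_eq_sum (bandLimited_extend _)]
    exact (((continuous_finsetSum _ fun τ _ =>
      (continuous_extend τ).mul continuous_const).sub continuous_const).norm).pow 2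
  obtain ⟨v, hv, hmin⟩ := hcompact.exists_isMinOn hne hres.continuousOn
  refine ⟨extend v, hv, fun ψ hψ => ?_⟩
  have hψ' : (fun t : Window m => ψ t) ∈ S := by
    change Feasible m s _
    rw [extend_restrict hψ.1]
    exact hψ
  have := hmin hψ'
  simpa [extend_restrict hψ.1] using this

/-! ### Triadic scales and the gluing of the local filters -/

section Scales

variable {n s : ℕ}

theorem scale_facts (hn : ∃ a : ℕ, n = 3 ^ a) (hs : ∃ b : ℕ, s = 3 ^ b) (h : 9 * s ≤ n) :
    (∀ k ≤ numScales n s, 9 * s * 3 ^ (numScales n s - k) = scale n k) ∧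
      n = 9 * s * 3 ^ numScales n s ∧ 1 ≤ s := by
  obtain ⟨a, rfl⟩ := hn
  obtain ⟨b, rfl⟩ := hs
  have h9 : 9 * 3 ^ b = 3 ^ (b + 2) := by ring
  have hab : b + 2 ≤ a := by
    rw [h9] at h
    exact (Nat.pow_le_pow_iff_right (by norm_num)).1 h
  have hK : numScales (3 ^ a) (3 ^ b) = a - (b + 2) := by
    rw [numScales, h9, Nat.pow_div hab (by norm_num), Nat.log_pow (by norm_num)]
  refine ⟨fun k hk => ?_, ?_, Nat.one_le_pow _ _ (by norm_num)⟩
  · rw [hK] at *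
    rw [scale, Nat.pow_div (by omega) (by norm_num), h9, ← pow_add]
    congr 1
    omega
  · rw [hK, h9, ← pow_add]
    congr 1
    omega

theorem scale_zero (n : ℕ) : scale n 0 = n := by simp [scale]

theorem scale_antitone (n : ℕ) : Antitone (scale n) := fun _ _ h =>
  Nat.div_le_div_left (Nat.pow_le_pow_right (by norm_num) h) (by positivity)

/-- Here `d` stands for the distance `2n - |t|` to the nearest endpoint, and `k` is the first scale
not exceeding it. -/
theorem exists_scale (hn : ∃ a : ℕ, n = 3 ^ a) (hs : ∃ b : ℕ, s = 3 ^ b) (h : 9 * s ≤ n) {d : ℕ}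
    (hd : 9 * s ≤ d) (hdn : d < n) :
    ∃ k ∈ Finset.Icc 1 (numScales n s), scale n k ≤ d ∧ d < scale n (k - 1) := by
  classical
  obtain ⟨h1, -, -⟩ := scale_facts hn hs h
  have hK := h1 _ le_rfl
  rw [Nat.sub_self, pow_zero, mul_one] at hK
  have hex : ∃ k, scale n k ≤ d := ⟨numScales n s, by omega⟩
  have hk0 : Nat.find hex ≠ 0 := by
    intro h0
    have := Nat.find_spec hex
    rw [h0, scale_zero] at this
    omega
  refine ⟨Nat.find hex, Finset.mem_Icc.2 ⟨by omega, Nat.find_min' hex (by omega)⟩,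
    Nat.find_spec hex, ?_⟩
  have := Nat.find_min hex (m := Nat.find hex - 1) (by omega)
  omega

/-- The halfwidths decrease from `n` to `9s`, so the pieces, the core and the edges are pairwise
disjoint and the prescriptions never conflict. -/
theorem exists_isFullEstimate (hn : ∃ a : ℕ, n = 3 ^ a) (hs : ∃ b : ℕ, s = 3 ^ b) (h : 9 * s ≤ n)
    (y : ℤ → ℂ) : ∃ z, IsFullEstimate n s y z := by
  classical
  obtain ⟨h1, -, -⟩ := scale_facts hn hs h
  have hK := h1 _ le_rfl
  rw [Nat.sub_self, pow_zero, mul_one] at hK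
  obtain ⟨φ, hφ⟩ := exists_isOptimalFilter n s 0 y
  choose φp hφp using fun k => exists_isOptimalFilter (scale n k) s (center n k) y
  choose φm hφm using fun k => exists_isOptimalFilter (scale n k) s (-center n k) y
  have hanti := scale_antitone n
  have huniq : ∀ k l : ℕ, ∀ d : ℤ, 1 ≤ k → 1 ≤ l → (scale n k : ℤ) ≤ d → d < scale n (k - 1) →
      (scale n l : ℤ) ≤ d → d < scale n (l - 1) → k = l := by
    intro k l d hk hl h1 h2 h3 h4
    by_contra hne
    rcases lt_or_gt_of_ne hne with hlt | hlt
    · have : scale n (l - 1) ≤ scale n k := hanti (by omega)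
      omega
    · have : scale n (k - 1) ≤ scale n l := hanti (by omega)
      omega
  have hle : ∀ k ∈ Finset.Icc 1 (numScales n s), 9 * s ≤ scale n k ∧ scale n (k - 1) ≤ n := by
    intro k hk
    rw [Finset.mem_Icc] at hk
    refine ⟨hK ▸ hanti hk.2, ?_⟩
    have := hanti (Nat.zero_le (k - 1))
    rwa [scale_zero] at this
  let good : ℤ → ℕ → Prop := fun d k => k ∈ Finset.Icc 1 (numScales n s) ∧
    (scale n k : ℤ) ≤ d ∧ d < scale n (k - 1)
  let z : ℤ → ℂ := fun t =>
    if |t| ≤ (n : ℤ) then conv φ y t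
    else if h : ∃ k, good (2 * n - |t|) k then
      if 0 ≤ t then conv (φp h.choose) y t else conv (φm h.choose) y t
    else y t
  have hz : ∀ t k, good (2 * n - |t|) k →
      z t = if 0 ≤ t then conv (φp k) y t else conv (φm k) y t := by
    intro t k hk
    have hex : ∃ k, good (2 * n - |t|) k := ⟨k, hk⟩
    have hlek := (hle k hk.1).2
    have hnt : ¬ |t| ≤ (n : ℤ) := by
      have := hk.2.2
      omega
    have heq : hex.choose = k := by
      have hsp := hex.choose_spec
      exact huniq _ _ _ (Finset.mem_Icc.1 hsp.1).1 (Finset.mem_Icc.1 hk.1).1 hsp.2.1 hsp.2.2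
        hk.2.1 hk.2.2
    simp only [z]
    rw [if_neg hnt, dif_pos hex, heq]
  refine ⟨z, φ, φp, φm, hφ, fun k _ => ⟨hφp k, hφm k⟩, fun t ht => by simp only [z]; rw [if_pos ht],
    fun k hk t h2 h3 => ?_, fun k hk t h2 h3 => ?_, fun t h2 h3 => ?_⟩
  · have := (hle k hk).2
    have ht : 0 ≤ t := by omega
    rw [hz t k ⟨hk, by rw [abs_of_nonneg ht]; omega, by rw [abs_of_nonneg ht]; omega⟩, if_pos ht]
  · have := (hle k hk).2
    have ht : t < 0 := by omega
    rw [hz t k ⟨hk, by rw [abs_of_neg ht]; omega, by rw [abs_of_neg ht]; omega⟩,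
      if_neg (by omega)]
  · have hnt : ¬ |t| ≤ (n : ℤ) := by omega
    have hnex : ¬ ∃ k, good (2 * n - |t|) k := by
      rintro ⟨k, hk, h4, -⟩
      have := (hle k hk).1
      omega
    simp only [z]
    rw [if_neg hnt, dif_neg hnex]

end Scales

/-! ### High-probability events -/

theorem one_le_sqrt_two_mul (r : ℕ) : 1 ≤ Real.sqrt 2 * (3 + Real.log r) := by
  have h1 : 0 ≤ Real.log r := Real.log_natCast_nonneg r
  have h2 : (1 : ℝ) ≤ Real.sqrt 2 := by
    rw [Real.one_le_sqrt]; norm_num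
  nlinarith

/-- The threshold for the noise passed through sparse filters. -/
noncomputable def noiseThreshold (r : ℕ) (L : ℝ) : ℝ :=
  3 * (2 * r) + 8 * (3 + Real.log r) ^ 2 * L

theorem measure_iUnion_le_card_mul {Ω α : Type*} [MeasurableSpace Ω] [Fintype α] (μ : Measure Ω)
    (E : α → Set Ω) {c : ℝ} {C : ℕ} (hC : Fintype.card α ≤ C)
    (hE : ∀ a, μ (E a) ≤ ENNReal.ofReal c) : μ (⋃ a, E a) ≤ ENNReal.ofReal (C * c) := by
  refine (measure_iUnion_fintype_le μ E).trans ((Finset.sum_le_sum fun a _ => hE a).trans ?_)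
  rw [Finset.sum_const, nsmul_eq_mul, ENNReal.ofReal_mul (by positivity), ENNReal.ofReal_natCast,
    Finset.card_univ]
  gcongr

/-- Outside of an event of small probability, the noise is controlled on a segment. -/
theorem exists_bad_event (N : ℕ) {X : Submodule ℂ (ℤ → ℂ)} [FiniteDimensional ℂ X] {m s : ℕ}
    (hs : 1 ≤ s) (hd : Module.finrank ℂ X ≤ s) {h : ℤ}
    (hI : Finset.Icc (h - m : ℤ) (h + m) ⊆ Finset.Icc (-(N : ℤ)) N) {L : ℝ} (hL : 0 ≤ L) :
    ∃ B : Set (Window N → ℂ),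
      noiseLaw N B ≤ ENNReal.ofReal ((2 * (4 * (2 * m + 1)) ^ (18 * s) + 1) * Real.exp (-L)) ∧
      ∀ ξ ∉ B,
        (∀ p : Net m (18 * s), ∑ t ∈ Finset.Icc (h - m) (h + m),
          ‖conv (atom m (18 * s) p) (extend ξ) t‖ ^ 2 ≤ noiseThreshold (18 * s) L) ∧
        (∀ p : Net m (18 * s), (∑ t ∈ Finset.Icc (h - m) (h + m),
          star (extend ξ t) * conv (atom m (18 * s) p) (extend ξ) t).re ≤
            noiseThreshold (18 * s) L) ∧
        (∀ w ∈ X, ‖∑ t ∈ Finset.Icc (h - m) (h + m), star (extend ξ t) * w t‖ ^ 2 ≤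
          noiseThreshold (18 * s) L * ∑ t ∈ Finset.Icc (h - m) (h + m), ‖w t‖ ^ 2) := by
  set I := Finset.Icc (h - m : ℤ) (h + m) with hIdef
  set r := 18 * s with hr
  set T := noiseThreshold r L with hT
  set Λ := Real.sqrt 2 * (3 + Real.log r) with hΛ
  have hΛ1 : 1 ≤ Λ := one_le_sqrt_two_mul r
  have hTΛ : T = 3 * (2 * r) + 4 * Λ ^ 2 * L := by
    rw [hT, noiseThreshold, hΛ, mul_pow, Real.sq_sqrt (by norm_num)]
    ring
  have hcard : (I.card : ℝ) = 2 * m + 1 := by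
    have : I.card = 2 * m + 1 := by
      rw [hIdef, Int.card_Icc]; omega
    rw [this]; push_cast; rfl
  have hM : (0 : ℝ) < 2 * m + 1 := by positivity
  have hF : (I.card : ℝ) * (2 * r / (2 * m + 1)) ≤ 2 * r := by
    rw [hcard, mul_div_cancel₀ _ hM.ne']
  obtain ⟨κ, β, hκ, -, hunit, hbessel, hrep⟩ := exists_projector X hd I
  let E1 : Net m r → Set (Window N → ℂ) := fun p =>
    {ξ | T < ∑ t ∈ I, ‖conv (atom m r p) (extend ξ) t‖ ^ 2}
  let E2 : Net m r → Set (Window N → ℂ) := fun p =>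
    {ξ | T < (∑ t ∈ I, star (extend ξ t) * conv (atom m r p) (extend ξ) t).re}
  let E3 : Set (Window N → ℂ) :=
    {ξ | 3 * (s : ℝ) + 4 * L < ∑ i, ‖∑ t ∈ I, star (β i t) * extend ξ t‖ ^ 2}
  have h1 : noiseLaw N (⋃ p, E1 p) ≤
      ENNReal.ofReal (((4 * (2 * m + 1)) ^ r : ℕ) * Real.exp (-L)) := by
    refine measure_iUnion_le_card_mul _ _ (card_net_le m r) fun p => ?_
    simp only [E1, hTΛ]
    exact noiseLaw_conv_tail (bandLimited_atom m r p) (by linarith) (norm_symbol_atom_le p)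
      (sum_norm_sq_atom m r p).le I hF L
  have h2 : noiseLaw N (⋃ p, E2 p) ≤
      ENNReal.ofReal (((4 * (2 * m + 1)) ^ r : ℕ) * Real.exp (-L)) := by
    refine measure_iUnion_le_card_mul _ _ (card_net_le m r) fun p => ?_
    simp only [E2, hTΛ]
    exact noiseLaw_chaos_tail (bandLimited_atom m r p) hΛ1 (norm_symbol_atom_le p)
      (sum_norm_sq_atom m r p).le (norm_atom_zero_le m r p) hI hF hL
  have h3 : noiseLaw N E3 ≤ ENNReal.ofReal (Real.exp (-L)) :=
    noiseLaw_projection_tail hκ hI β hunit hbessel L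
  refine ⟨(⋃ p, E1 p) ∪ (⋃ p, E2 p) ∪ E3, ?_, fun ξ hξ => ?_⟩
  · refine (measure_union_le _ _).trans ((add_le_add ((measure_union_le _ _).trans
      (add_le_add h1 h2)) h3).trans (le_of_eq ?_))
    rw [← ENNReal.ofReal_add (by positivity) (by positivity),
      ← ENNReal.ofReal_add (by positivity) (by positivity)]
    congr 1
    push_cast
    ring
  · simp only [Set.mem_union, Set.mem_iUnion, not_or, not_exists, E1, E2, E3, Set.mem_ofPred_eq,
      not_lt] at hξ
    refine ⟨hξ.1.1, hξ.1.2, fun w hw => ?_⟩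
    -- Expanding `w` in the orthonormal system leaves only the at most `s` coordinates of the noise
    -- along `X`.
    have e1 : ∑ t ∈ I, star (extend ξ t) * w t =
        ∑ i, star (∑ t ∈ I, star (β i t) * extend ξ t) * ∑ t ∈ I, star (β i t) * w t := by
      rw [Finset.sum_congr rfl fun t ht => by rw [hrep w hw t ht]]
      simp_rw [Finset.mul_sum (s := Finset.univ), star_sum, star_mul', star_star,
        Finset.sum_mul (s := I)]
      rw [Finset.sum_comm]
      refine Finset.sum_congr rfl fun i _ => Finset.sum_congr rfl fun t _ => by ring
    have e2 : ‖∑ t ∈ I, star (extend ξ t) * w t‖ ≤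
        ∑ i, ‖∑ t ∈ I, star (β i t) * extend ξ t‖ * ‖∑ t ∈ I, star (β i t) * w t‖ := by
      rw [e1]
      refine (norm_sum_le _ _).trans (le_of_eq (Finset.sum_congr rfl fun i _ => ?_))
      rw [norm_mul, norm_star]
    have e3 := pow_le_pow_left₀ (norm_nonneg _) e2 2
    refine e3.trans ((Finset.sum_mul_sq_le_sq_mul_sq _ _ _).trans ?_)
    have e4 : 3 * (s : ℝ) + 4 * L ≤ T := by
      rw [hTΛ, hr]
      push_cast
      have : L ≤ Λ ^ 2 * L := le_mul_of_one_le_left hL (one_le_pow₀ hΛ1)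
      have hs0 : (0 : ℝ) ≤ s := Nat.cast_nonneg s
      linarith
    exact mul_le_mul (hξ.2.trans e4) (hbessel w) (by positivity)
      (le_trans (by positivity) e4)

/-! ### The risk of the full estimator -/

theorem extend_observe {N : ℕ} (σ : ℝ) (x : ℤ → ℂ) (ξ : Window N → ℂ) {t : ℤ}
    (ht : t ∈ Finset.Icc (-(N : ℤ)) N) :
    extend (observe σ x ξ) t = x t + σ * extend ξ t := by
  rw [extend, dif_pos ht, extend, dif_pos ht]
  rfl

theorem edge_card_le (n s : ℕ) :
    ((Finset.Icc (-((2 * n : ℕ) : ℤ)) (2 * n : ℕ)).filter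
      fun t => 2 * (n : ℤ) - 9 * (s : ℤ) < |t|).card ≤ 18 * s := by
  have hsub : ((Finset.Icc (-((2 * n : ℕ) : ℤ)) (2 * n : ℕ)).filter
      fun t => 2 * (n : ℤ) - 9 * (s : ℤ) < |t|) ⊆
      Finset.Ioc (2 * (n : ℤ) - 9 * s) (2 * n) ∪ Finset.Ico (-(2 * (n : ℤ))) (9 * s - 2 * n) := by
    intro t ht
    rw [Finset.mem_filter, Finset.mem_Icc] at ht
    rw [Finset.mem_union, Finset.mem_Ioc, Finset.mem_Ico]
    push_cast at ht
    rcases lt_abs.1 ht.2 with h | h <;> omega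
  refine (Finset.card_le_card hsub).trans ((Finset.card_union_le _ _).trans ?_)
  rw [Int.card_Ioc, Int.card_Ico]
  omega

/-- The center of a filter on the right (`true`) or on the left (`false`). -/
def signedCenter (n k : ℕ) (b : Bool) : ℤ := if b then center n k else -center n k

theorem center_zero (n : ℕ) : center n 0 = 0 := by
  rw [center, scale_zero]; ring

/-- The error of the full estimate is at most the sum of the errors of the filters on their
intervals and of the noise at the edges. -/
theorem fullEstimate_error_le {n s : ℕ} (hn : ∃ a : ℕ, n = 3 ^ a) (hs : ∃ b : ℕ, s = 3 ^ b)
    (h : 9 * s ≤ n) {y z : ℤ → ℂ} (hz : IsFullEstimate n s y z) (x : ℤ → ℂ) {P Q : ℝ}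
    (hP : ∀ k ≤ numScales n s, ∀ b φ, IsOptimalFilter (scale n k) s (signedCenter n k b) y φ →
      ∑ t ∈ Finset.Icc (signedCenter n k b - scale n k) (signedCenter n k b + scale n k),
        ‖conv φ y t - x t‖ ^ 2 ≤ P)
    (hQ : ∑ t ∈ (Finset.Icc (-((2 * n : ℕ) : ℤ)) (2 * n : ℕ)).filter
      (fun t => 2 * (n : ℤ) - 9 * (s : ℤ) < |t|), ‖y t - x t‖ ^ 2 ≤ Q) :
    l2 (2 * n) (fun t => z t - x t) ^ 2 ≤ 2 * (numScales n s + 1) * P + Q := by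
  classical
  obtain ⟨h1, -, -⟩ := scale_facts hn hs h
  obtain ⟨φ, φp, φm, hφ, hφpm, hz0, hzp, hzm, hze⟩ := hz
  set K := numScales n s
  let ψ : ℕ → Bool → ℤ → ℂ := fun k b => if k = 0 then φ else if b then φp k else φm k
  have hψ : ∀ k ≤ K, ∀ b, IsOptimalFilter (scale n k) s (signedCenter n k b) y (ψ k b) := by
    intro k hk b
    rcases Nat.eq_zero_or_pos k with rfl | hk0
    · have : signedCenter n 0 b = 0 := by
        cases b <;> simp [signedCenter, center_zero]
      rw [this, scale_zero]
      simpa [ψ] using hφ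
    · obtain ⟨hp, hm⟩ := hφpm k (Finset.mem_Icc.2 ⟨hk0, hk⟩)
      cases b
      · simpa [ψ, signedCenter, hk0.ne'] using hm
      · simpa [ψ, signedCenter, hk0.ne'] using hp
  let I : ℕ → Bool → Finset ℤ := fun k b =>
    Finset.Icc (signedCenter n k b - scale n k) (signedCenter n k b + scale n k)
  let W := Finset.Icc (-((2 * n : ℕ) : ℤ)) (2 * n : ℕ)
  let e : ℤ → ℝ := fun t =>
    if 2 * (n : ℤ) - 9 * (s : ℤ) < |t| then ‖y t - x t‖ ^ 2 else 0
  let g : ℕ → Bool → ℤ → ℝ := fun k b t =>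
    if t ∈ I k b then ‖conv (ψ k b) y t - x t‖ ^ 2 else 0
  have hg0 : ∀ k b t, 0 ≤ g k b t := fun k b t => by
    simp only [g]; split_ifs <;> positivity
  have he0 : ∀ t, 0 ≤ e t := fun t => by
    simp only [e]; split_ifs <;> positivity
  have hsingle : ∀ k ≤ K, ∀ b t, g k b t ≤ ∑ k ∈ Finset.range (K + 1), ∑ b, g k b t := by
    intro k hk b t
    refine (Finset.single_le_sum (f := fun b => g k b t) (fun b _ => hg0 k b t)
      (Finset.mem_univ b)).trans ?_
    exact Finset.single_le_sum (f := fun k => ∑ b, g k b t)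
      (fun k _ => Finset.sum_nonneg fun b _ => hg0 k b t) (Finset.mem_range.2 (by omega))
  have hpt : ∀ t ∈ W, ‖z t - x t‖ ^ 2 ≤
      (∑ k ∈ Finset.range (K + 1), ∑ b, g k b t) + e t := by
    intro t ht
    have htW : |t| ≤ 2 * n := by
      rw [abs_le]
      simp only [W, Finset.mem_Icc] at ht
      push_cast at ht
      omega
    by_cases hc : |t| ≤ (n : ℤ)
    · refine le_trans ?_ (add_le_add (hsingle 0 (Nat.zero_le _) true t) (he0 t))
      have : t ∈ I 0 true := by
        simp only [I, signedCenter, center_zero, scale_zero, Finset.mem_Icc, if_true]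
        rw [abs_le] at hc
        omega
      simp only [g]
      rw [if_pos this, hz0 t hc]
      simp [ψ]
    by_cases hedge : 2 * (n : ℤ) - 9 * (s : ℤ) < |t|
    · have h2 : 0 ≤ ∑ k ∈ Finset.range (K + 1), ∑ b, g k b t :=
        Finset.sum_nonneg fun k _ => Finset.sum_nonneg fun b _ => hg0 k b t
      rw [hze t hedge htW]
      simp only [e]
      rw [if_pos hedge]
      linarith
    · obtain ⟨k, hk, hk1, hk2⟩ := exists_scale hn hs h (d := (2 * n - |t|).toNat)
        (by omega) (by omega)
      have hkm := Finset.mem_Icc.1 hk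
      -- Because the ratio is 3, the `k`-th piece is the interval of halfwidth `n_k` around `h_k`,
      -- up to one endpoint: exactly where the residual of its filter was minimized.
      have h3 : scale n (k - 1) = 3 * scale n k := by
        rw [← h1 k hkm.2, ← h1 (k - 1) (by omega)]
        have : K - (k - 1) = (K - k) + 1 := by omega
        rw [this, pow_succ]; ring
      rcases le_or_gt 0 t with ht0 | ht0
      · rw [abs_of_nonneg ht0] at *
        refine le_trans ?_ (add_le_add (hsingle k hkm.2 true t) (he0 t))
        have : t ∈ I k true := by
          simp only [I, signedCenter, Finset.mem_Icc, center, if_true]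
          omega
        simp only [g]
        rw [if_pos this, hzp k hk t (by omega) (by omega)]
        have hk0 : k ≠ 0 := by omega
        simp [ψ, hk0]
      · rw [abs_of_neg ht0] at *
        refine le_trans ?_ (add_le_add (hsingle k hkm.2 false t) (he0 t))
        have : t ∈ I k false := by
          simp only [I, signedCenter, Finset.mem_Icc, center, Bool.false_eq_true, if_false]
          omega
        simp only [g]
        rw [if_pos this, hzm k hk t (by omega) (by omega)]
        have hk0 : k ≠ 0 := by omega
        simp [ψ, hk0]
  rw [l2_sq]
  refine (Finset.sum_le_sum hpt).trans ?_
  rw [Finset.sum_add_distrib]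
  refine add_le_add ?_ ?_
  · rw [Finset.sum_comm]
    -- At `k = 0` both signs denote the core filter; counting it twice is harmless and keeps the sum
    -- uniform.
    have h4 : ∀ k ∈ Finset.range (K + 1), ∑ t ∈ W, ∑ b, g k b t ≤ 2 * P := by
      intro k hk
      rw [Finset.sum_comm]
      have h5 : ∀ b, ∑ t ∈ W, g k b t ≤ P := by
        intro b
        refine le_trans ?_ (hP k (by rw [Finset.mem_range] at hk; omega) b (ψ k b)
          (hψ k (by rw [Finset.mem_range] at hk; omega) b))
        simp only [g]
        rw [← Finset.sum_filter]
        refine Finset.sum_le_sum_of_subset_of_nonneg (fun t ht => (Finset.mem_filter.1 ht).2)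
          fun _ _ _ => by positivity
      rw [Fintype.sum_bool]
      linarith [h5 true, h5 false]
    refine (Finset.sum_le_sum h4).trans (le_of_eq ?_)
    rw [Finset.sum_const, Finset.card_range, nsmul_eq_mul]
    push_cast; ring
  · simp only [e]
    rw [← Finset.sum_filter]
    exact hQ

/-! ### Numerical constants and levels for the union bounds -/

theorem log_nine_exp_four_mul {s : ℕ} (hs : 1 ≤ s) :
    6 ≤ Real.log (9 * Real.exp 4 * s) ∧
      3 + Real.log (18 * s : ℕ) ≤ Real.log (9 * Real.exp 4 * s) := by
  have hs' : (1 : ℝ) ≤ s := by exact_mod_cast hs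
  have h1 : Real.log (9 * Real.exp 4 * s) = Real.log 9 + 4 + Real.log s := by
    rw [Real.log_mul (by positivity) (by positivity), Real.log_mul (by norm_num) (by positivity),
      Real.log_exp]
  have h2 : Real.log (18 * s : ℕ) = Real.log 9 + Real.log 2 + Real.log s := by
    push_cast
    rw [show (18 : ℝ) = 9 * 2 by norm_num, Real.log_mul (by norm_num) (by positivity),
      Real.log_mul (by norm_num) (by norm_num)]
  have h3 := Real.log_nonneg hs'
  have h4 : 2 ≤ Real.log 9 := by
    rw [Real.le_log_iff_exp_le (by norm_num)]
    have := Real.exp_one_lt_d9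
    have h5 : Real.exp 2 = Real.exp 1 * Real.exp 1 := by rw [← Real.exp_add]; norm_num
    have := Real.exp_pos 1
    rw [h5]; nlinarith
  have h6 := Real.log_two_lt_d9
  rw [h1, h2]
  constructor <;> linarith

/-- The probabilistic level used in the union bounds. -/
noncomputable def level (N j : ℕ) (δ : ℝ) : ℝ :=
  (j : ℝ) * Real.log (4 * (2 * N + 1 : ℕ)) + Real.log δ⁻¹

theorem exp_neg_level (N j : ℕ) {δ : ℝ} (hδ : 0 < δ) :
    Real.exp (-level N j δ) = δ / (4 * (2 * N + 1 : ℕ)) ^ j := by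
  have hpos : (0 : ℝ) < 4 * (2 * N + 1 : ℕ) := by positivity
  rw [level, Real.log_inv, neg_add, neg_neg, Real.exp_add, Real.exp_log hδ, Real.exp_neg,
    Real.exp_nat_mul, Real.exp_log hpos]
  field_simp

theorem level_nonneg (N j : ℕ) {δ : ℝ} (hδ : 0 < δ) (hδ1 : δ < 1) : 0 ≤ level N j δ := by
  have h1 : 0 ≤ Real.log δ⁻¹ := Real.log_nonneg (one_le_inv_iff₀.2 ⟨hδ, hδ1.le⟩)
  have h2 : 0 ≤ Real.log (4 * (2 * N + 1 : ℕ)) := Real.log_nonneg (by push_cast; linarith)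
  rw [level]; positivity

/-- The factor 9.5 is `2 · 19 / 4`: each of the `19s` logarithms in the level at most doubles, using
`4 ≤ 2n + 1`. The 77 is `8 · 9.5` plus one unit that absorbs the term linear in `s`, thanks to `ℓ ≥
6`. -/
theorem noiseThreshold_le {n s : ℕ} (hs : 1 ≤ s) (hn : 2 ≤ n) {δ : ℝ} (hδ : 0 < δ) (hδ1 : δ < 1)
    {ℓ Z : ℝ} (hℓ : 6 ≤ ℓ) (hℓ' : 3 + Real.log (18 * s : ℕ) ≤ ℓ)
    (hZ : Z = 4 * (s : ℝ) * Real.log (2 * (n : ℝ) + 1) + 10 * (s : ℝ) + Real.log δ⁻¹) :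
    level n (19 * s) δ ≤ 9.5 * Z ∧ (s : ℝ) ≤ Z / 10 ∧
      noiseThreshold (18 * s) (level n (19 * s) δ) ≤ 77 * ℓ ^ 2 * Z := by
  have hs' : (1 : ℝ) ≤ s := by exact_mod_cast hs
  have hn' : (2 : ℝ) ≤ n := by exact_mod_cast hn
  have h1 : 0 ≤ Real.log δ⁻¹ := Real.log_nonneg (one_le_inv_iff₀.2 ⟨hδ, hδ1.le⟩)
  have h2 : 0 ≤ Real.log (2 * (n : ℝ) + 1) := Real.log_nonneg (by linarith)
  have h3 : Real.log (4 * (2 * n + 1 : ℕ)) ≤ 2 * Real.log (2 * (n : ℝ) + 1) := by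
    push_cast
    rw [Real.log_mul (by norm_num) (by positivity)]
    have : Real.log 4 ≤ Real.log (2 * (n : ℝ) + 1) := Real.log_le_log (by norm_num) (by linarith)
    linarith
  have h4 : level n (19 * s) δ ≤ 38 * s * Real.log (2 * (n : ℝ) + 1) + Real.log δ⁻¹ := by
    rw [level]
    push_cast at h3 ⊢
    nlinarith
  have h5 : level n (19 * s) δ ≤ 9.5 * Z := by
    rw [hZ]
    refine h4.trans ?_
    nlinarith
  have h6 : (s : ℝ) ≤ Z / 10 := by
    rw [hZ]
    have : 0 ≤ (s : ℝ) * Real.log (2 * (n : ℝ) + 1) := by positivity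
    linarith
  refine ⟨h5, h6, ?_⟩
  have h7 : 0 ≤ 3 + Real.log (18 * s : ℕ) := by
    have := Real.log_natCast_nonneg (18 * s)
    linarith
  have h8 : (3 + Real.log (18 * s : ℕ)) ^ 2 ≤ ℓ ^ 2 := pow_le_pow_left₀ h7 hℓ' 2
  have hL := level_nonneg n (19 * s) hδ hδ1
  have hZ0 : 0 ≤ Z := by linarith
  have h9 : (3 + Real.log (18 * s : ℕ)) ^ 2 * level n (19 * s) δ ≤ ℓ ^ 2 * (9.5 * Z) :=
    mul_le_mul h8 h5 hL (by positivity)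
  have h10 : 36 * Z ≤ ℓ ^ 2 * Z := mul_le_mul_of_nonneg_right (by nlinarith) hZ0
  rw [noiseThreshold]
  push_cast at h9 ⊢
  linarith

/-- The bound in probability on the error of the full estimator. -/
theorem fullEstimator_tail {n s : ℕ} (hn : ∃ a : ℕ, n = 3 ^ a) (hs : ∃ b : ℕ, s = 3 ^ b)
    (h : 9 * s ≤ n) {xhat : (Window (2 * n) → ℂ) → ℤ → ℂ} (hx : IsFullEstimator n s xhat)
    {δ σ : ℝ} (hδ : 0 < δ) (hδ1 : δ < 1) (hσ : 0 ≤ σ) {x : ℤ → ℂ} (hxs : x ∈ signalClass s) :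
    noiseLaw (2 * n) {ξ | errorBound n s δ σ <
      l2 (2 * n) (fun t => xhat (observe σ x ξ) t - x t) ^ 2} ≤ ENNReal.ofReal δ := by
  obtain ⟨h1, hnK, hs1⟩ := scale_facts hn hs h
  obtain ⟨X, hX, hfin, hd, hxX⟩ := hxs
  set K := numScales n s with hK
  set L := level n (19 * s) δ with hL
  have hL0 : 0 ≤ L := level_nonneg n (19 * s) hδ hδ1
  have hwin : ∀ k ≤ K, ∀ b, Finset.Icc (signedCenter n k b - 2 * scale n k)
      (signedCenter n k b + 2 * scale n k) ⊆ Finset.Icc (-((2 * n : ℕ) : ℤ)) (2 * n : ℕ) := by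
    intro k hk b
    have := scale_antitone n (Nat.zero_le k)
    rw [scale_zero] at this
    refine Finset.Icc_subset_Icc ?_ ?_ <;> cases b <;>
      simp only [signedCenter, center, Bool.false_eq_true, if_true, if_false] <;> push_cast <;>
      omega
  have hbad : ∀ k b, ∃ B : Set (Window (2 * n) → ℂ), k ≤ K →
      noiseLaw (2 * n) B ≤
        ENNReal.ofReal ((2 * (4 * (2 * scale n k + 1)) ^ (18 * s) + 1) * Real.exp (-L)) ∧
      ∀ ξ ∉ B, ∀ φ, IsOptimalFilter (scale n k) s (signedCenter n k b)
        (extend (observe σ x ξ)) φ →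
        ∑ t ∈ Finset.Icc (signedCenter n k b - scale n k) (signedCenter n k b + scale n k),
          ‖conv φ (extend (observe σ x ξ)) t - x t‖ ^ 2 ≤
          (10 + 8 * cStar) * σ ^ 2 * noiseThreshold (18 * s) L := by
    intro k b
    by_cases hk : k ≤ K
    · obtain ⟨B, hB, hB'⟩ := exists_bad_event (2 * n) (X := X) (m := scale n k)
        (h := signedCenter n k b) hs1 hd.le
        ((Finset.Icc_subset_Icc (by omega) (by omega)).trans (hwin k hk b)) hL0
      refine ⟨B, fun _ => ⟨hB, fun ξ hξ φ hφ => ?_⟩⟩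
      obtain ⟨e1, e2, e3⟩ := hB' ξ hξ
      refine optimalFilter_error_le hX hs1 hd.le ?_ hσ hxX
        (fun t ht => extend_observe σ x ξ (hwin k hk b ht)) e1 e2 e3 hφ
      rw [← h1 k hk]
      exact Nat.le_mul_of_pos_right _ (by positivity)
    · exact ⟨∅, fun h => absurd h hk⟩
  choose B hB using hbad
  set S := (Finset.Icc (-((2 * n : ℕ) : ℤ)) (2 * n : ℕ)).filter
      (fun t => 2 * (n : ℤ) - 9 * (s : ℤ) < |t|) with hS
  let E : Set (Window (2 * n) → ℂ) := {ξ | 3 * S.card + 4 * L < ∑ t ∈ S, ‖extend ξ t‖ ^ 2}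
  have hE : noiseLaw (2 * n) E ≤ ENNReal.ofReal (Real.exp (-L)) :=
    noiseLaw_energy_tail (Finset.filter_subset _ _) L
  have hsub : {ξ | errorBound n s δ σ <
      l2 (2 * n) (fun t => xhat (observe σ x ξ) t - x t) ^ 2} ⊆
      (⋃ q : Fin (K + 1) × Bool, B q.1 q.2) ∪ E := by
    intro ξ hξ
    by_contra hcon
    simp only [Set.mem_union, Set.mem_iUnion, not_or, not_exists, E, Set.mem_ofPred_eq,
      not_lt] at hcon hξ
    refine absurd hξ (not_lt.2 ?_)
    have hmain := fullEstimate_error_le hn hs h (hx (observe σ x ξ)) x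
      (P := (10 + 8 * cStar) * σ ^ 2 * noiseThreshold (18 * s) L)
      (Q := σ ^ 2 * (3 * (18 * s) + 4 * L))
      (fun k hk b φ hφ => (hB k b hk).2 ξ (hcon.1 (⟨k, by omega⟩, b)) φ hφ) ?_
    · refine hmain.trans ?_
      obtain ⟨hℓ6, hℓ⟩ := log_nine_exp_four_mul hs1
      have hc := cStar_ge
      rw [errorBound]
      obtain ⟨ℓ, hℓdef⟩ : ∃ ℓ, ℓ = Real.log (9 * Real.exp 4 * s) := ⟨_, rfl⟩
      obtain ⟨Z, hZ⟩ : ∃ Z, Z = 4 * (s : ℝ) * Real.log (2 * (n : ℝ) + 1) + 10 * (s : ℝ) +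
        Real.log δ⁻¹ := ⟨_, rfl⟩
      obtain ⟨h2, h3, h4⟩ := noiseThreshold_le hs1 (by omega : 2 ≤ n) hδ hδ1 (hℓdef ▸ hℓ6)
        (hℓdef ▸ hℓ) hZ
      rw [← hℓdef] at hℓ6
      rw [← hℓdef, ← hZ]
      have hlog : Real.logb 3 ((n : ℝ) / s) = K + 2 := by
        have : (n : ℝ) / s = (3 : ℝ) ^ (K + 2) := by
          rw [div_eq_iff (by positivity)]
          conv_lhs => rw [hnK]
          push_cast; ring
        rw [this, Real.logb_pow, Real.logb_self_eq_one (by norm_num)]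
        push_cast; ring
      rw [hlog]
      have hs' : (1 : ℝ) ≤ s := by exact_mod_cast hs1
      have hZ0 : 0 ≤ Z := by linarith
      have hK0 : (0 : ℝ) ≤ K := Nat.cast_nonneg K
      set G := cStar ^ 2 * (σ ^ 2 * (ℓ ^ 2 * Z)) with hG
      have hw : 0 ≤ σ ^ 2 * (ℓ ^ 2 * Z) := by positivity
      have hG0 : 0 ≤ G := by positivity
      have h5 : (10 + 8 * cStar) * σ ^ 2 * noiseThreshold (18 * s) L ≤ 26 * G := by
        have e1 : (10 + 8 * cStar) * σ ^ 2 * noiseThreshold (18 * s) L ≤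
            (10 + 8 * cStar) * σ ^ 2 * (77 * ℓ ^ 2 * Z) :=
          mul_le_mul_of_nonneg_left h4 (by positivity)
        -- At `cStar = 27` this reads 17402 ≤ 18954, and the right side grows faster.
        have e2 : (10 + 8 * cStar) * 77 ≤ 26 * cStar ^ 2 := by nlinarith
        calc _ ≤ _ := e1
          _ = (10 + 8 * cStar) * 77 * (σ ^ 2 * (ℓ ^ 2 * Z)) := by ring
          _ ≤ 26 * cStar ^ 2 * (σ ^ 2 * (ℓ ^ 2 * Z)) := mul_le_mul_of_nonneg_right e2 hw
          _ = 26 * G := by rw [hG]; ring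
      have h6 : σ ^ 2 * (3 * (18 * s) + 4 * L) ≤ G := by
        have e1 : 3 * (18 * s) + 4 * L ≤ 44 * Z := by linarith
        have e2 : 44 ≤ cStar ^ 2 * ℓ ^ 2 := by
          have : 36 ≤ ℓ ^ 2 := by nlinarith
          nlinarith
        calc σ ^ 2 * (3 * (18 * s) + 4 * L) ≤ σ ^ 2 * (44 * Z) :=
              mul_le_mul_of_nonneg_left e1 (sq_nonneg σ)
          _ = 44 * (σ ^ 2 * Z) := by ring
          _ ≤ cStar ^ 2 * ℓ ^ 2 * (σ ^ 2 * Z) := mul_le_mul_of_nonneg_right e2 (by positivity)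
          _ = G := by rw [hG]; ring
      have h7 : 2 * ((K : ℝ) + 1) * ((10 + 8 * cStar) * σ ^ 2 * noiseThreshold (18 * s) L) ≤
          2 * ((K : ℝ) + 1) * (26 * G) := mul_le_mul_of_nonneg_left h5 (by positivity)
      have h8 : 160 * cStar ^ 2 * σ ^ 2 * Z * ℓ ^ 2 * ((K : ℝ) + 2) = 160 * G * (K + 2) := by
        rw [hG]; ring
      rw [h8]
      have h9 : 0 ≤ K * G := by positivity
      linarith
    · have e1 : ∑ t ∈ S, ‖extend (observe σ x ξ) t - x t‖ ^ 2 =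
          σ ^ 2 * ∑ t ∈ S, ‖extend ξ t‖ ^ 2 := by
        rw [Finset.mul_sum]
        refine Finset.sum_congr rfl fun t ht => ?_
        rw [extend_observe σ x ξ (Finset.mem_filter.1 ht).1, add_sub_cancel_left, norm_mul,
          Complex.norm_real, Real.norm_of_nonneg hσ, mul_pow]
      rw [e1]
      refine mul_le_mul_of_nonneg_left (hcon.2.trans ?_) (sq_nonneg σ)
      have := edge_card_le n s
      rw [← hS] at this
      have : (S.card : ℝ) ≤ 18 * s := by exact_mod_cast this
      linarith
  have hU : noiseLaw (2 * n) (⋃ q : Fin (K + 1) × Bool, B q.1 q.2) ≤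
      ENNReal.ofReal (((2 * (K + 1) : ℕ) : ℝ) *
        ((2 * (4 * (2 * n + 1 : ℕ)) ^ (18 * s) + 1) * Real.exp (-L))) := by
    refine measure_iUnion_le_card_mul _ _ (by simp [mul_comm]) fun q => ?_
    refine ((hB q.1 q.2 (by omega)).1).trans (ENNReal.ofReal_le_ofReal ?_)
    have : scale n q.1 ≤ n := Nat.div_le_self _ _
    have : (scale n q.1 : ℝ) ≤ n := by exact_mod_cast this
    push_cast
    gcongr
  refine (measure_mono hsub).trans ((measure_union_le _ _).trans
    ((add_le_add hU hE).trans ?_))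
  rw [← ENNReal.ofReal_add (by positivity) (by positivity)]
  refine ENNReal.ofReal_le_ofReal ?_
  rw [hL, exp_neg_level n _ hδ]
  set Y : ℝ := 4 * (2 * n + 1 : ℕ) with hY
  have hY1 : 1 ≤ Y := by rw [hY]; push_cast; linarith [Nat.cast_nonneg (α := ℝ) n]
  have hKn : 9 * (K + 1) ≤ n := by
    rw [hnK]
    have : K + 1 ≤ 3 ^ K := Nat.lt_pow_self (by norm_num)
    nlinarith
  have hYK : 6 * ((K : ℝ) + 1) + 1 ≤ Y := by
    have : (9 * ((K : ℝ) + 1)) ≤ n := by exact_mod_cast hKn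
    rw [hY]; push_cast; linarith
  have hYp : 1 ≤ Y ^ (18 * s) := one_le_pow₀ hY1
  -- The nets account for the exponent `18s`. One further factor `Y` pays for the `2(K+1)` segments
  -- and the edge event, because `K + 1 ≤ 3 ^ K`.
  have h2 : ((2 * (K + 1) : ℕ) : ℝ) * (2 * Y ^ (18 * s) + 1) + 1 ≤ Y ^ (19 * s) := by
    calc ((2 * (K + 1) : ℕ) : ℝ) * (2 * Y ^ (18 * s) + 1) + 1
        ≤ (6 * ((K : ℝ) + 1) + 1) * Y ^ (18 * s) := by
          push_cast
          nlinarith [Nat.cast_nonneg (α := ℝ) K]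
      _ ≤ Y * Y ^ (18 * s) := by gcongr
      _ = Y ^ (18 * s + 1) := by ring
      _ ≤ Y ^ (19 * s) := pow_le_pow_right₀ hY1 (by omega)
  calc ((2 * (K + 1) : ℕ) : ℝ) * ((2 * Y ^ (18 * s) + 1) * (δ / Y ^ (19 * s))) + δ / Y ^ (19 * s)
      = (((2 * (K + 1) : ℕ) : ℝ) * (2 * Y ^ (18 * s) + 1) + 1) * (δ / Y ^ (19 * s)) := by ring
    _ ≤ Y ^ (19 * s) * (δ / Y ^ (19 * s)) := mul_le_mul_of_nonneg_right h2 (by positivity)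
    _ = δ := by field_simp

/-- Every level strictly above the bound is admissible and automatically positive. Passing through
such levels also covers a zero bound, as for `σ = 0`. -/
theorem deltaRisk_le_of_forall {N : ℕ} {δ σ : ℝ} {xhat : (Window N → ℂ) → ℤ → ℂ} {X : Set (ℤ → ℂ)}
    {b : ℝ} (h : ∀ x ∈ X, noiseLaw N {ξ | b < l2 N (fun t => xhat (observe σ x ξ) t - x t) ^ 2} ≤
      ENNReal.ofReal δ) :
    deltaRisk N δ σ xhat X ≤ ENNReal.ofReal (b / (2 * (N : ℝ) + 1)) := by
  refine le_of_forall_gt_imp_ge_of_dense fun ε hε => sInf_le ⟨pos_of_gt hε, fun x hx => ?_⟩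
  refine (measure_mono fun ξ hξ => ?_).trans (h x hx)
  have h1 := hε.trans (show ε < _ from hξ)
  have hpos : (0 : ℝ) < 2 * N + 1 := by positivity
  by_contra hcon
  refine absurd h1 (not_lt.2 (ENNReal.ofReal_le_ofReal ?_))
  rw [div_le_div_iff_of_pos_right hpos]
  exact not_lt.1 hcon

/-! ### Approximate least squares -/

/-- Membership requires a subspace of dimension exactly `s`; the `s`-periodic sequences provide one.
This shows that estimators with values in the class exist. -/
theorem zero_mem_signalClass {s : ℕ} (hs : 1 ≤ s) : (0 : ℤ → ℂ) ∈ signalClass s := by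
  have : NeZero s := ⟨by omega⟩
  let P : (ZMod s → ℂ) →ₗ[ℂ] (ℤ → ℂ) := LinearMap.funLeft ℂ ℂ (Int.cast : ℤ → ZMod s)
  have hP : Function.Injective P :=
    LinearMap.funLeft_injective_of_surjective ℂ ℂ _ (ZMod.intCast_surjective)
  refine ⟨LinearMap.range P, ?_, inferInstance, ?_, Submodule.zero_mem _⟩
  · rintro _ ⟨f, rfl⟩
    refine ⟨fun i => f (i - 1), ?_⟩
    funext t
    change f ((t : ZMod s) - 1) = f ((t - 1 : ℤ) : ZMod s)
    push_cast
    rfl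
  · rw [LinearMap.finrank_range_of_inj hP, Module.finrank_fintype_fun_eq_card, ZMod.card]

theorem exists_shiftInvariant_of_sub {s : ℕ} {x x' : ℤ → ℂ} (hx : x ∈ signalClass s)
    (hx' : x' ∈ signalClass s) :
    ∃ Y : Submodule ℂ (ℤ → ℂ), IsShiftInvariant Y ∧ FiniteDimensional ℂ Y ∧
      Module.finrank ℂ Y ≤ 2 * s ∧ x - x' ∈ Y := by
  obtain ⟨X, hX, hfin, hd, hm⟩ := hx
  obtain ⟨X', hX', hfin', hd', hm'⟩ := hx'
  refine ⟨X ⊔ X', ?_, inferInstance, ?_, ?_⟩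
  · intro u hu
    obtain ⟨a, ha, b, hb, rfl⟩ := Submodule.mem_sup.1 hu
    exact Submodule.mem_sup.2 ⟨delay a, hX a ha, delay b, hX' b hb, rfl⟩
  · have := Submodule.finrank_add_le_finrank_add_finrank X X'
    omega
  · exact Submodule.sub_mem _ (Submodule.mem_sup_left hm) (Submodule.mem_sup_right hm')

/-- A measurable selection of an approximate minimizer of the squared residual. -/
theorem exists_measurable_near_minimizer (N : ℕ) {S : Set (ℤ → ℂ)} (hS : S.Nonempty) {ε : ℝ}
    (hε : 0 < ε) :
    ∃ xhat : (Window N → ℂ) → ℤ → ℂ, Measurable xhat ∧ (∀ y, xhat y ∈ S) ∧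
      ∀ y, ∀ x ∈ S, ∑ t : Window N, ‖y t - xhat y t‖ ^ 2 ≤
        ∑ t : Window N, ‖y t - x t‖ ^ 2 + ε := by
  classical
  let ρ : (ℤ → ℂ) → Window N → ℂ := fun u t => u t
  let f : (Window N → ℂ) → (Window N → ℂ) → ℝ := fun y v => ∑ t, ‖y t - v t‖ ^ 2
  have hf1 : ∀ v, Continuous fun y => f y v := fun v => by
    simp only [f]; fun_prop
  have hf2 : ∀ y, Continuous fun v => f y v := fun y => by
    simp only [f]; fun_prop
  have hf0 : ∀ y v, 0 ≤ f y v := fun y v => by simp only [f]; positivity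
  have hne : Nonempty (ρ '' S) := (hS.image ρ).to_subtype
  -- The estimator takes values in a countable family that is dense in the restrictions of `S` to
  -- the window. Choosing the first index within `ε` of optimal makes it measurable, and density
  -- with continuity extends the comparison to all of `S`.
  obtain ⟨q, hq⟩ := TopologicalSpace.exists_dense_seq (ρ '' S)
  choose d hdS hd using fun i => (q i).2
  have hex : ∀ y, ∃ i, ∀ j, f y (q i) ≤ f y (q j) + ε := by
    intro y
    have hbdd : BddBelow (Set.range fun j => f y (q j)) := ⟨0, by
      rintro _ ⟨j, rfl⟩; exact hf0 _ _⟩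
    obtain ⟨i, hi⟩ := exists_lt_of_ciInf_lt (lt_add_of_pos_right (⨅ j, f y (q j)) hε)
    exact ⟨i, fun j => hi.le.trans (by linarith [ciInf_le hbdd j])⟩
  have hmeas : ∀ i, MeasurableSet {y | ∀ j, f y (q i) ≤ f y (q j) + ε} := by
    intro i
    simp only [Set.ofPred_forall]
    exact MeasurableSet.iInter fun j =>
      (isClosed_le (hf1 _) ((hf1 _).add continuous_const)).measurableSet
  refine ⟨fun y => d (Nat.find (hex y)), ?_, fun y => hdS _, fun y x hx => ?_⟩
  · exact (measurable_from_nat (f := d)).comp (measurable_find hex hmeas)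
  · have h1 := Nat.find_spec (hex y)
    have h2 : ∀ v : ρ '' S, f y (q (Nat.find (hex y))) ≤ f y v + ε := by
      have hcl : IsClosed {v : ρ '' S | f y (q (Nat.find (hex y))) ≤ f y v + ε} :=
        isClosed_le continuous_const (((hf2 y).comp continuous_subtype_val).add continuous_const)
      intro v
      have := hcl.closure_subset_iff.2 (show Set.range q ⊆ _ by rintro _ ⟨j, rfl⟩; exact h1 j)
      exact this (hq v)
    have h3 := h2 ⟨ρ x, x, hx, rfl⟩
    rw [← hd] at h3
    exact h3

/-- Expanding the squares gives `‖z - x‖² ≤ 2σ Re⟨ξ, z - x⟩ + ε ≤ 2σG‖z - x‖ + ε`; half of the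
square absorbs the linear term. -/
theorem sum_sq_sub_le_of_near_minimizer {N : ℕ} {σ ε G : ℝ} (hσ : 0 ≤ σ)
    {x z : ℤ → ℂ} {ξ : Window N → ℂ}
    (hz : ∑ t : Window N, ‖observe σ x ξ t - z t‖ ^ 2 ≤
      ∑ t : Window N, ‖observe σ x ξ t - x t‖ ^ 2 + ε)
    (hG' : (∑ t ∈ Finset.Icc (-(N : ℤ)) N, star (extend ξ t) * (z t - x t)).re ≤
      G * Real.sqrt (∑ t ∈ Finset.Icc (-(N : ℤ)) N, ‖z t - x t‖ ^ 2)) :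
    l2 N (fun t => z t - x t) ^ 2 ≤ 4 * σ ^ 2 * G ^ 2 + 2 * ε := by
  rw [l2_sq]
  set a := ∑ t ∈ Finset.Icc (-(N : ℤ)) N, ‖z t - x t‖ ^ 2 with ha
  have ha0 : 0 ≤ a := by positivity
  have e1 : ∀ t : Window N, ‖observe σ x ξ t - z t‖ ^ 2 =
      ‖observe σ x ξ t - x t‖ ^ 2 + ‖z t - x t‖ ^ 2 -
        2 * σ * (star (extend ξ t) * (z t - x t)).re := by
    intro t
    have e2 : observe σ x ξ t - z t = (σ : ℂ) * ξ t - (z t - x t) := by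
      simp only [observe]; ring
    have e3 : observe σ x ξ t - x t = (σ : ℂ) * ξ t := by
      simp only [observe]; ring
    rw [e2, e3, extend_apply]
    simp only [← Complex.normSq_eq_norm_sq, Complex.normSq_apply, Complex.sub_re, Complex.sub_im,
      Complex.mul_re, Complex.mul_im, Complex.ofReal_re, Complex.ofReal_im, Complex.star_def,
      Complex.conj_re, Complex.conj_im]
    ring
  simp_rw [e1] at hz
  rw [Finset.sum_sub_distrib, Finset.sum_add_distrib, ← Finset.mul_sum, ← Complex.re_sum,
    sum_window (fun t => ‖z t - x t‖ ^ 2),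
    sum_window (fun t => star (extend ξ t) * (z t - x t)), ← ha] at hz
  have h1 := mul_le_mul_of_nonneg_left hG' hσ
  have h2 := Real.mul_self_sqrt ha0
  nlinarith [sq_nonneg (Real.sqrt a - 2 * σ * G)]

/-! ### Dyadic decomposition of the observation window -/

/-- The distance of a point of `{-N, ..., N}` to the nearest endpoint. -/
noncomputable def depth (N : ℕ) (t : ℤ) : ℕ := ((N : ℤ) - |t|).toNat

/-- The points of `{-N, ..., N}` at distance about `2 ^ k` to the endpoints. -/
noncomputable def shell (N k : ℕ) : Finset ℤ :=
  (Finset.Icc (-(N : ℤ)) N).filter fun t => 2 ^ k ≤ depth N t ∧ depth N t < 2 ^ (k + 1)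

/-- The points of `{-N, ..., N}` close to the endpoints. -/
noncomputable def rim (N k : ℕ) : Finset ℤ := (Finset.Icc (-(N : ℤ)) N).filter fun t => depth N t < 2 ^ k

theorem card_filter_depth_lt_le (N D : ℕ) :
    ((Finset.Icc (-(N : ℤ)) N).filter fun t => depth N t < D).card ≤ 2 * D := by
  have hsub : ((Finset.Icc (-(N : ℤ)) N).filter fun t => depth N t < D) ⊆
      Finset.Ioc ((N : ℤ) - D) N ∪ Finset.Ico (-(N : ℤ)) (D - N) := by
    intro t ht
    rw [Finset.mem_filter, Finset.mem_Icc, depth] at ht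
    rw [Finset.mem_union, Finset.mem_Ioc, Finset.mem_Ico]
    rcases abs_cases t with h | h <;> omega
  refine (Finset.card_le_card hsub).trans ((Finset.card_union_le _ _).trans ?_)
  rw [Int.card_Ioc, Int.card_Ico]
  omega

theorem card_rim_le (N k : ℕ) : (rim N k).card ≤ 2 * 2 ^ k := card_filter_depth_lt_le N _

theorem card_shell_le (N k : ℕ) : (shell N k).card ≤ 2 * 2 ^ k := by
  have hsub : shell N k ⊆
      Finset.Ioc ((N : ℤ) - 2 ^ (k + 1)) (N - 2 ^ k) ∪
        Finset.Ico (2 ^ k - (N : ℤ)) (2 ^ (k + 1) - N) := by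
    intro t ht
    rw [shell, Finset.mem_filter, Finset.mem_Icc, depth] at ht
    zify at ht
    rw [Finset.mem_union, Finset.mem_Ioc, Finset.mem_Ico]
    have : (0 : ℤ) < 2 ^ k := by positivity
    rcases abs_cases t with h | h <;> omega
  refine (Finset.card_le_card hsub).trans ((Finset.card_union_le _ _).trans ?_)
  rw [Int.card_Ioc, Int.card_Ico]
  have : (2 : ℤ) ^ (k + 1) = 2 * 2 ^ k := by ring
  zify
  have : (0 : ℤ) < 2 ^ k := by positivity
  omega

/-- The points of `{-N, ..., N}` at distance at most `2 ^ (k - 1)` of the `k`-th shell. -/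
noncomputable def thickShell (N k : ℕ) : Finset ℤ :=
  (Finset.Icc (-(N : ℤ)) N).filter fun t => k ≤ Nat.log 2 (depth N t) + 1 ∧
    Nat.log 2 (depth N t) ≤ k + 1

/-- A move by at most `2^(k-1)` from depth in `[2^k, 2^(k+1))` ends at depth in `[2^(k-1),
2^(k+2))`, so a filter of that halfwidth never reads outside the window. -/
theorem mem_thickShell {N k : ℕ} (hk : 1 ≤ k) {t τ : ℤ} (ht : t ∈ shell N k)
    (hτ : τ ∈ Finset.Icc (-((2 ^ (k - 1) : ℕ) : ℤ)) (2 ^ (k - 1) : ℕ)) :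
    t - τ ∈ thickShell N k := by
  obtain ⟨j, rfl⟩ : ∃ j, k = j + 1 := ⟨k - 1, by omega⟩
  rw [Nat.add_sub_cancel] at hτ
  rw [shell, Finset.mem_filter, Finset.mem_Icc, depth] at ht
  rw [thickShell, Finset.mem_filter, Finset.mem_Icc]
  rw [Finset.mem_Icc] at hτ
  have e1 : 2 ^ (j + 1) = 2 * 2 ^ j := by ring
  have e2 : 2 ^ (j + 1 + 1) = 4 * 2 ^ j := by ring
  have e3 : 2 ^ (j + 3) = 8 * 2 ^ j := by ring
  have hpos : 0 < 2 ^ j := by positivity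
  rw [e1, e2] at ht
  generalize hA : 2 ^ j = A at *
  have hd1 : A ≤ depth N (t - τ) := by
    rw [depth]
    rcases abs_cases t with h | h <;> rcases abs_cases (t - τ) with h' | h' <;> omega
  have hd2 : depth N (t - τ) < 8 * A := by
    rw [depth]
    rcases abs_cases t with h | h <;> rcases abs_cases (t - τ) with h' | h' <;> omega
  refine ⟨?_, ?_, ?_⟩
  · rw [depth] at hd1
    rcases abs_cases (t - τ) with h' | h' <;> omega
  · have := Nat.le_log_of_pow_le (b := 2) (by norm_num) (hA ▸ hd1)
    omega
  · have := Nat.log_lt_of_lt_pow (b := 2) (by omega) (e3.symm ▸ hd2 : _ < 2 ^ (j + 3))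
    omega

/-- A point lies only in the thick shells whose index is within 1 of the binary logarithm of its
depth, hence in at most three. -/
theorem sum_thickShell_le (N a b : ℕ) (f : ℤ → ℝ) (hf : ∀ t, 0 ≤ f t) :
    ∑ k ∈ Finset.Ico a b, ∑ t ∈ thickShell N k, f t ≤
      3 * ∑ t ∈ Finset.Icc (-(N : ℤ)) N, f t := by
  simp only [thickShell, Finset.sum_filter]
  rw [Finset.sum_comm, Finset.mul_sum]
  refine Finset.sum_le_sum fun t _ => ?_
  rw [← Finset.sum_filter, Finset.sum_const, nsmul_eq_mul]
  refine mul_le_mul_of_nonneg_right ?_ (hf t)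
  set l := Nat.log 2 (depth N t)
  have : ((Finset.Ico a b).filter fun k => k ≤ l + 1 ∧ l ≤ k + 1) ⊆ Finset.Icc (l - 1) (l + 1) := by
    intro k hk
    rw [Finset.mem_filter] at hk
    rw [Finset.mem_Icc]
    omega
  have := Finset.card_le_card this
  rw [Nat.card_Icc] at this
  have : ((Finset.Ico a b).filter fun k => k ≤ l + 1 ∧ l ≤ k + 1).card ≤ 3 := by omega
  exact_mod_cast this

theorem sum_window_eq_rim_add_shells {E : Type*} [AddCommMonoid E] (N a : ℕ) (f : ℤ → E) :
    ∑ t ∈ Finset.Icc (-(N : ℤ)) N, f t =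
      ∑ t ∈ rim N a, f t + ∑ k ∈ Finset.Ico a (Nat.log 2 N + 1), ∑ t ∈ shell N k, f t := by
  classical
  rw [← Finset.sum_filter_add_sum_filter_not _ (fun t => depth N t < 2 ^ a)]
  refine congrArg₂ _ rfl ?_
  rw [← Finset.sum_biUnion]
  · refine Finset.sum_congr ?_ fun _ _ => rfl
    ext t
    simp only [Finset.mem_filter, Finset.mem_biUnion, shell, Finset.mem_Ico, not_lt]
    constructor
    · rintro ⟨ht, hd⟩
      have hd0 : depth N t ≠ 0 := by
        have : 0 < 2 ^ a := by positivity
        omega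
      have hdN : depth N t ≤ N := by
        rw [depth]
        have := abs_nonneg t
        omega
      refine ⟨Nat.log 2 (depth N t), ⟨Nat.le_log_of_pow_le (by norm_num) hd,
        Nat.lt_succ_of_le (Nat.log_mono_right hdN)⟩, ht, Nat.pow_log_le_self 2 hd0,
        Nat.lt_pow_succ_log_self (by norm_num) _⟩
    · rintro ⟨k, ⟨hk, -⟩, ht, hd, -⟩
      exact ⟨ht, (Nat.pow_le_pow_right (by norm_num) hk).trans hd⟩
  · intro i _ j _ hij
    rw [Function.onFun, Finset.disjoint_left]
    intro t hi hj
    simp only [shell, Finset.mem_filter] at hi hj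
    rcases lt_or_gt_of_ne hij with h | h
    · have := Nat.pow_le_pow_right (n := 2) (by norm_num) (show i + 1 ≤ j by omega)
      omega
    · have := Nat.pow_le_pow_right (n := 2) (by norm_num) (show j + 1 ≤ i by omega)
      omega

/-! ### Noise against shift-invariant subspaces -/

/-- On the shell `u = φ * u` for a reproducing filter, which may be traded for a sparse one. Its
adjoint then acts on the noise, so the hypothesis on `η` no longer involves `Y`; this is what makes
the bound uniform over subspaces. -/
theorem re_shell_pairing_le {Y : Submodule ℂ (ℤ → ℂ)} (hY : IsShiftInvariant Y)
    [FiniteDimensional ℂ Y] {N k s : ℕ} (hs : 1 ≤ s) (hd : Module.finrank ℂ Y ≤ 2 * s)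
    (hk : 4 * s ≤ 2 ^ k) {T : ℝ} {η u : ℤ → ℂ} (hu : u ∈ Y)
    (hT : ∀ p : Net (2 ^ (k - 1)) (4 * s), ∑ t' ∈ Finset.Icc (-(N : ℤ)) N,
      ‖∑ t ∈ shell N k, star (atom (2 ^ (k - 1)) (4 * s) p (t - t')) * η t‖ ^ 2 ≤ T) :
    (∑ t ∈ shell N k, star (η t) * u t).re ≤
      Real.sqrt T * Real.sqrt (∑ t ∈ thickShell N k, ‖u t‖ ^ 2) := by
  have hk1 : 1 ≤ k := by
    rcases Nat.eq_zero_or_pos k with rfl | h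
    · simp at hk; omega
    · exact h
  have hpow : 2 ^ k = 2 * 2 ^ (k - 1) := by rw [← pow_succ']; congr 1; omega
  set m := 2 ^ (k - 1) with hm
  obtain ⟨φ, hb, hrep, hinf, hone⟩ := exists_reproducing_filter hY hd m
  have hsp : SpectrumBound m (4 * s) 1 φ := by
    refine ⟨hb, hinf, hone.trans (le_of_eq ?_)⟩
    push_cast
    ring
  obtain ⟨p, hp⟩ := hsp.re_pairing_le (by omega) (by omega) zero_le_one (shell N k) η u
  simp_rw [hrep u hu, one_mul] at hp
  refine hp.trans ?_
  set a := atom m (4 * s) p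
  have hsub : thickShell N k ⊆ Finset.Icc (-(N : ℤ)) N := Finset.filter_subset _ _
  have hconv : ∀ t ∈ shell N k, conv a u t = ∑ t' ∈ thickShell N k, a (t - t') * u t' := by
    intro t ht
    have hinj : Set.InjOn (fun τ => t - τ) (Finset.Icc (-(m : ℤ)) m) :=
      fun a _ b _ h => by simpa using h
    rw [conv_eq_sum (bandLimited_atom m (4 * s) p)]
    rw [← Finset.sum_subset (s₁ := (Finset.Icc (-(m : ℤ)) m).image fun τ => t - τ)
      (s₂ := thickShell N k)]
    · rw [Finset.sum_image hinj]
      refine Finset.sum_congr rfl fun τ _ => ?_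
      rw [sub_sub_cancel]
    · intro t' ht'
      obtain ⟨τ, hτ, rfl⟩ := Finset.mem_image.1 ht'
      exact mem_thickShell hk1 ht hτ
    · intro t' _ ht'
      rw [show a (t - t') = 0 from bandLimited_iff.1 (bandLimited_atom m (4 * s) p) _ ?_, zero_mul]
      intro h
      exact ht' (Finset.mem_image.2 ⟨t - t', h, sub_sub_cancel _ _⟩)
  have e1 : ∑ t ∈ shell N k, star (η t) * conv a u t =
      ∑ t' ∈ thickShell N k, star (∑ t ∈ shell N k, star (a (t - t')) * η t) * u t' := by
    rw [Finset.sum_congr rfl fun t ht => by rw [hconv t ht, Finset.mul_sum], Finset.sum_comm]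
    refine Finset.sum_congr rfl fun t' _ => ?_
    rw [star_sum, Finset.sum_mul]
    refine Finset.sum_congr rfl fun t _ => ?_
    rw [star_mul', star_star]
    ring
  rw [e1]
  refine (re_sum_star_mul_le _ _ _).trans (mul_le_mul_of_nonneg_right ?_ (Real.sqrt_nonneg _))
  exact Real.sqrt_le_sqrt ((Finset.sum_le_sum_of_subset_of_nonneg hsub
    fun _ _ _ => by positivity).trans (hT p))

/-- Outside of an event of small probability, the correlation of the noise with all elements of
shift-invariant subspaces is controlled. -/
theorem exists_uniform_bad_event {N s : ℕ} (hs : 1 ≤ s) (hsN : s ≤ N) {δ : ℝ} (hδ : 0 < δ)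
    (hδ1 : δ < 1) :
    ∃ B : Set (Window N → ℂ), noiseLaw N B ≤ ENNReal.ofReal δ ∧
      ∀ ξ ∉ B, ∀ Y : Submodule ℂ (ℤ → ℂ), IsShiftInvariant Y → FiniteDimensional ℂ Y →
        Module.finrank ℂ Y ≤ 2 * s → ∀ u ∈ Y,
        (∑ t ∈ Finset.Icc (-(N : ℤ)) N, star (extend ξ t) * u t).re ≤
          2 * Real.sqrt (noiseThreshold (8 * s) (level N (5 * s) δ) *
            ((Nat.log 2 N + 1 - Nat.clog 2 (4 * s) : ℕ) + 1)) *
          Real.sqrt (∑ t ∈ Finset.Icc (-(N : ℤ)) N, ‖u t‖ ^ 2) := by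
  classical
  set L := level N (5 * s) δ with hL
  have hL0 : 0 ≤ L := level_nonneg N (5 * s) hδ hδ1
  -- The filters have `4s` frequencies, but a shell has up to `4 · 2^(k-1)` points, so the Frobenius
  -- budget is `16s = 2 · 8s`; the rim also has at most `16s` points.
  set T := noiseThreshold (8 * s) L with hT
  set a := Nat.clog 2 (4 * s) with ha
  set b := Nat.log 2 N + 1 with hb
  have ha4 : 4 * s ≤ 2 ^ a := Nat.le_pow_clog (by norm_num) _
  have ha8 : 2 ^ a ≤ 8 * s := by
    have h1 := Nat.pow_pred_clog_lt_self (b := 2) (by norm_num) (show 1 < 4 * s by omega)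
    have h2 : 2 ^ a = 2 * 2 ^ (a - 1) := by
      rw [← pow_succ']
      congr 1
      have : 0 < a := Nat.clog_pos (by norm_num) (by omega)
      omega
    rw [← ha, Nat.pred_eq_sub_one] at h1
    omega
  set Λ := Real.sqrt 2 * (3 + Real.log (4 * s : ℕ)) with hΛ
  have hΛ1 : 1 ≤ Λ := one_le_sqrt_two_mul (4 * s)
  have hs' : (1 : ℝ) ≤ s := by exact_mod_cast hs
  have hlog0 : 0 ≤ Real.log (4 * s : ℕ) := Real.log_natCast_nonneg _
  have hTΛ : 3 * (16 * s) + 4 * Λ ^ 2 * L ≤ T := by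
    rw [hT, noiseThreshold, hΛ, mul_pow, Real.sq_sqrt (by norm_num)]
    have : Real.log (4 * s : ℕ) ≤ Real.log (8 * s : ℕ) :=
      Real.log_le_log (by push_cast; linarith) (by push_cast; linarith)
    have h2 : (3 + Real.log (4 * s : ℕ)) ^ 2 ≤ (3 + Real.log (8 * s : ℕ)) ^ 2 := by gcongr
    have h3 := mul_le_mul_of_nonneg_right h2 hL0
    push_cast at h3 ⊢
    linarith
  have hTL : 3 * (16 * s) + 4 * L ≤ T := by
    have : L ≤ Λ ^ 2 * L := le_mul_of_one_le_left hL0 (one_le_pow₀ hΛ1)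
    linarith
  have hT0 : 0 ≤ T := le_trans (by positivity) hTL
  let E : ℕ → Set (Window N → ℂ) := fun k => ⋃ p : Net (2 ^ (k - 1)) (4 * s),
    {ξ | T < ∑ t' ∈ Finset.Icc (-(N : ℤ)) N, ‖∑ t ∈ shell N k,
      star (atom (2 ^ (k - 1)) (4 * s) p (t - t')) * extend ξ t‖ ^ 2}
  let R : Set (Window N → ℂ) := {ξ | T < ∑ t ∈ rim N a, ‖extend ξ t‖ ^ 2}
  set V : ℝ := 4 * (2 * N + 1 : ℕ) with hV
  have hE : ∀ k ∈ Finset.Ico a b, noiseLaw N (E k) ≤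
      ENNReal.ofReal (V ^ (4 * s) * Real.exp (-L)) := by
    intro k hk
    rw [Finset.mem_Ico] at hk
    have hak : 2 ^ a ≤ 2 ^ k := Nat.pow_le_pow_right (by norm_num) hk.1
    have hk1 : 1 ≤ k := by
      rcases Nat.eq_zero_or_pos k with rfl | h
      · simp at hak; omega
      · exact h
    have hpow : 2 ^ k = 2 * 2 ^ (k - 1) := by rw [← pow_succ']; congr 1; omega
    have hkN : 2 ^ k ≤ N := (Nat.pow_le_pow_right (by norm_num) (by omega)).trans
      (Nat.pow_log_le_self 2 (by omega))
    have hmN : 2 ^ (k - 1) ≤ N := by omega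
    have h1 := measure_iUnion_le_card_mul (noiseLaw N) (fun p : Net (2 ^ (k - 1)) (4 * s) =>
      {ξ | T < ∑ t' ∈ Finset.Icc (-(N : ℤ)) N, ‖∑ t ∈ shell N k,
        star (atom (2 ^ (k - 1)) (4 * s) p (t - t')) * extend ξ t‖ ^ 2})
      (c := Real.exp (-L)) (card_net_le _ _) fun p => ?_
    · refine h1.trans (ENNReal.ofReal_le_ofReal ?_)
      refine mul_le_mul_of_nonneg_right ?_ (Real.exp_pos _).le
      rw [hV]
      exact_mod_cast Nat.pow_le_pow_left (by omega) _
    · refine (measure_mono fun ξ hξ => ?_).trans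
        (noiseLaw_conv_adjoint_tail (N := N) (F := 16 * s) (bandLimited_atom (2 ^ (k - 1)) (4 * s) p)
        (by linarith : 0 < Λ) (norm_symbol_atom_le p) (sum_norm_sq_atom _ _ p).le
        (J := shell N k) (Finset.filter_subset _ _) ?_ L)
      · exact lt_of_le_of_lt hTΛ hξ
      · have hc := card_shell_le N k
        rw [hpow] at hc
        have hc' : ((shell N k).card : ℝ) ≤ 4 * (2 ^ (k - 1) : ℕ) := by
          exact_mod_cast (by omega : (shell N k).card ≤ 4 * 2 ^ (k - 1))
        have hM : (0 : ℝ) < 2 * (2 ^ (k - 1) : ℕ) + 1 := by positivity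
        rw [mul_div_assoc', div_le_iff₀ hM]
        push_cast at hc' ⊢
        nlinarith
  have hR : noiseLaw N R ≤ ENNReal.ofReal (Real.exp (-L)) := by
    refine (measure_mono fun ξ hξ => ?_).trans
      (noiseLaw_energy_tail (J := rim N a) (Finset.filter_subset _ _) L)
    refine lt_of_le_of_lt ?_ (show T < _ from hξ)
    have h1 : (rim N a).card ≤ 16 * s := (card_rim_le N a).trans (by omega)
    have h2 : ((rim N a).card : ℝ) ≤ 16 * s := by exact_mod_cast h1
    linarith
  refine ⟨(⋃ k ∈ Finset.Ico a b, E k) ∪ R, ?_, fun ξ hξ Y hY hfin hd u hu => ?_⟩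
  · refine (measure_union_le _ _).trans ((add_le_add ((measure_biUnion_finset_le _ _).trans
      (Finset.sum_le_sum hE)) hR).trans ?_)
    rw [Finset.sum_const, Nat.card_Ico, nsmul_eq_mul, ← ENNReal.ofReal_natCast,
      ← ENNReal.ofReal_mul (by positivity), ← ENNReal.ofReal_add (by positivity) (by positivity)]
    refine ENNReal.ofReal_le_ofReal ?_
    rw [hL, exp_neg_level N _ hδ, ← hV]
    have hV1 : 1 ≤ V := by rw [hV]; push_cast; linarith [Nat.cast_nonneg (α := ℝ) N]
    have hba : b - a + 1 ≤ 4 * (2 * N + 1) := by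
      have : Nat.log 2 N ≤ N := Nat.log_le_self 2 N
      omega
    have hba' : ((b - a : ℕ) : ℝ) + 1 ≤ V := by
      rw [hV]; exact_mod_cast hba
    have hVp : 1 ≤ V ^ (4 * s) := one_le_pow₀ hV1
    have h2 : ((b - a : ℕ) : ℝ) * V ^ (4 * s) + 1 ≤ V ^ (5 * s) := by
      calc ((b - a : ℕ) : ℝ) * V ^ (4 * s) + 1
          ≤ (((b - a : ℕ) : ℝ) + 1) * V ^ (4 * s) := by rw [add_mul, one_mul]; linarith
        _ ≤ V * V ^ (4 * s) := by gcongr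
        _ = V ^ (4 * s + 1) := by ring
        _ ≤ V ^ (5 * s) := pow_le_pow_right₀ hV1 (by omega)
    calc ((b - a : ℕ) : ℝ) * (V ^ (4 * s) * (δ / V ^ (5 * s))) + δ / V ^ (5 * s)
        = (((b - a : ℕ) : ℝ) * V ^ (4 * s) + 1) * (δ / V ^ (5 * s)) := by ring
      _ ≤ V ^ (5 * s) * (δ / V ^ (5 * s)) := mul_le_mul_of_nonneg_right h2 (by positivity)
      _ = δ := by field_simp
  · simp only [Set.mem_union, Set.mem_iUnion, not_or, not_exists, E, R, Set.mem_ofPred_eq,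
      not_lt] at hξ
    set w : ℝ := ∑ t ∈ Finset.Icc (-(N : ℤ)) N, ‖u t‖ ^ 2 with hw
    have hw0 : 0 ≤ w := by positivity
    have h1 : (∑ t ∈ rim N a, star (extend ξ t) * u t).re ≤ Real.sqrt T * Real.sqrt w := by
      refine (re_sum_star_mul_le _ _ _).trans ?_
      refine mul_le_mul (Real.sqrt_le_sqrt hξ.2) (Real.sqrt_le_sqrt ?_) (Real.sqrt_nonneg _)
        (Real.sqrt_nonneg _)
      exact Finset.sum_le_sum_of_subset_of_nonneg (Finset.filter_subset _ _)
        fun _ _ _ => by positivity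
    have h2 : ∀ k ∈ Finset.Ico a b, (∑ t ∈ shell N k, star (extend ξ t) * u t).re ≤
        Real.sqrt T * Real.sqrt (∑ t ∈ thickShell N k, ‖u t‖ ^ 2) := by
      intro k hk
      have hak : 2 ^ a ≤ 2 ^ k := Nat.pow_le_pow_right (by norm_num) (Finset.mem_Ico.1 hk).1
      exact re_shell_pairing_le hY hs hd (ha4.trans hak) hu (hξ.1 k hk)
    have h3 : ∑ k ∈ Finset.Ico a b, Real.sqrt (∑ t ∈ thickShell N k, ‖u t‖ ^ 2) ≤
        Real.sqrt (b - a : ℕ) * Real.sqrt (3 * w) := by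
      have hcs := Real.sum_mul_le_sqrt_mul_sqrt (Finset.Ico a b) (fun _ => (1 : ℝ))
        (fun k => Real.sqrt (∑ t ∈ thickShell N k, ‖u t‖ ^ 2))
      simp only [one_mul, one_pow, Finset.sum_const, Nat.card_Ico, nsmul_eq_mul, mul_one] at hcs
      refine hcs.trans (mul_le_mul_of_nonneg_left (Real.sqrt_le_sqrt ?_) (Real.sqrt_nonneg _))
      refine le_trans (le_of_eq (Finset.sum_congr rfl fun k _ => ?_))
        (sum_thickShell_le N a b (fun t => ‖u t‖ ^ 2) fun t => by positivity)
      exact Real.sq_sqrt (by positivity)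
    rw [sum_window_eq_rim_add_shells N a, Complex.add_re, Complex.re_sum (Finset.Ico _ _)]
    have h4 : ∑ k ∈ Finset.Ico a b, (∑ t ∈ shell N k, star (extend ξ t) * u t).re ≤
        Real.sqrt T * (Real.sqrt (b - a : ℕ) * Real.sqrt (3 * w)) := by
      refine (Finset.sum_le_sum h2).trans ?_
      rw [← Finset.mul_sum]
      exact mul_le_mul_of_nonneg_left h3 (Real.sqrt_nonneg _)
    -- After squaring, the difference of the two sides is `(√3 - √(b - a))²`.
    have h5 : 1 * 1 + Real.sqrt (b - a : ℕ) * Real.sqrt 3 ≤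
        2 * Real.sqrt ((b - a : ℕ) + 1) := by
      have hk0 : (0 : ℝ) ≤ (b - a : ℕ) := Nat.cast_nonneg _
      refine le_of_sq_le_sq ?_ (by positivity)
      rw [mul_pow, Real.sq_sqrt (by positivity)]
      have e1 := Real.sq_sqrt hk0
      have e2 := Real.sq_sqrt (show (0 : ℝ) ≤ 3 by norm_num)
      nlinarith [sq_nonneg (Real.sqrt 3 - Real.sqrt (b - a : ℕ))]
    rw [Real.sqrt_mul (by norm_num : (0 : ℝ) ≤ 3)] at h4
    rw [Real.sqrt_mul hT0]
    have h6 := mul_le_mul_of_nonneg_left h5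
      (mul_nonneg (Real.sqrt_nonneg T) (Real.sqrt_nonneg w))
    linarith

/-! ### The minimax risk -/

theorem minimax_constant {n s : ℕ} (hs : 1 ≤ s) (hsn : s ≤ n) {δ : ℝ} (hδ : 0 < δ) (hδ1 : δ < 1) :
    noiseThreshold (8 * s) (level n (5 * s) δ) *
        ((Nat.log 2 n + 1 - Nat.clog 2 (4 * s) : ℕ) + 1) ≤
      30000 * (((s : ℝ) * Real.log (Real.exp 1 * (n : ℝ)) + Real.log δ⁻¹) *
        Real.log (Real.exp 1 * (s : ℝ)) ^ 2 * Real.log (Real.exp 1 * (n : ℝ) / (s : ℝ))) := by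
  have hs' : (1 : ℝ) ≤ s := by exact_mod_cast hs
  have hsn' : (s : ℝ) ≤ n := by exact_mod_cast hsn
  have hn0 : (0 : ℝ) < n := by linarith
  have hs0 : (0 : ℝ) < s := by linarith
  have hls : 0 ≤ Real.log s := Real.log_nonneg hs'
  have hlsn : Real.log s ≤ Real.log n := Real.log_le_log hs0 hsn'
  have hδ' : 0 ≤ Real.log δ⁻¹ := Real.log_nonneg (one_le_inv_iff₀.2 ⟨hδ, hδ1.le⟩)
  have e1 : Real.log (Real.exp 1 * n) = 1 + Real.log n := by
    rw [Real.log_mul (by positivity) (by positivity), Real.log_exp]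
  have e2 : Real.log (Real.exp 1 * s) = 1 + Real.log s := by
    rw [Real.log_mul (by positivity) (by positivity), Real.log_exp]
  have e3 : Real.log (Real.exp 1 * n / s) = 1 + Real.log n - Real.log s := by
    rw [Real.log_div (by positivity) (by positivity), e1]
  rw [e1, e2, e3]
  have hl2 := Real.log_two_gt_d9
  have hl2' := Real.log_two_lt_d9
  set ℓ := 1 + Real.log s with hℓ
  set Z := (s : ℝ) * (1 + Real.log n) + Real.log δ⁻¹ with hZ
  have hZs : (s : ℝ) ≤ Z := by
    rw [hZ]; nlinarith [mul_nonneg hs0.le (hls.trans hlsn)]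
  have hL : level n (5 * s) δ ≤ 15 * Z := by
    have h1 : Real.log (4 * (2 * n + 1 : ℕ)) ≤ 3 * (1 + Real.log n) := by
      have h2 : Real.log (4 * (2 * n + 1 : ℕ)) ≤ Real.log (16 * n) := by
        refine Real.log_le_log (by positivity) ?_
        push_cast; linarith
      rw [Real.log_mul (by norm_num) hn0.ne', show (16 : ℝ) = 2 ^ 4 by norm_num,
        Real.log_pow] at h2
      push_cast at h2 ⊢
      linarith [hls.trans hlsn]
    have h3 := mul_le_mul_of_nonneg_left h1 (show (0 : ℝ) ≤ 5 * s by positivity)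
    rw [level, hZ]
    push_cast at h3 ⊢
    linarith
  have hL0 := level_nonneg n (5 * s) hδ hδ1
  have h8 : 3 + Real.log (8 * s : ℕ) ≤ 6 * ℓ := by
    push_cast
    rw [Real.log_mul (by norm_num) hs0.ne', show (8 : ℝ) = 2 ^ 3 by norm_num, Real.log_pow, hℓ]
    push_cast
    linarith
  have h80 : 0 ≤ 3 + Real.log (8 * s : ℕ) := by
    have := Real.log_natCast_nonneg (8 * s)
    linarith
  have hℓ1 : 1 ≤ ℓ ^ 2 := one_le_pow₀ (by linarith)
  have hT : noiseThreshold (8 * s) (level n (5 * s) δ) ≤ 5000 * (Z * ℓ ^ 2) := by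
    have h9 : (3 + Real.log (8 * s : ℕ)) ^ 2 * level n (5 * s) δ ≤ (6 * ℓ) ^ 2 * (15 * Z) :=
      mul_le_mul (pow_le_pow_left₀ h80 h8 2) hL hL0 (by positivity)
    have h10 : Z ≤ Z * ℓ ^ 2 := le_mul_of_one_le_right (by linarith) hℓ1
    rw [noiseThreshold]
    push_cast at h9 ⊢
    nlinarith
  have hK : (((Nat.log 2 n + 1 - Nat.clog 2 (4 * s) : ℕ) : ℝ) + 1) ≤
      3 * (1 + Real.log n - Real.log s) := by
    -- When `4s` is too large compared with `n` there are no shells, and the truncated subtraction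
    -- is 0.
    rcases Nat.lt_or_ge (Nat.log 2 n + 1) (Nat.clog 2 (4 * s)) with h | h
    · rw [Nat.sub_eq_zero_of_le h.le]
      push_cast
      linarith
    · have h1 : (Nat.log 2 n : ℝ) * Real.log 2 ≤ Real.log n := by
        rw [← Real.log_pow]
        refine Real.log_le_log (by positivity) ?_
        exact_mod_cast Nat.pow_log_le_self 2 (by omega : n ≠ 0)
      have h2 : 2 * Real.log 2 + Real.log s ≤ (Nat.clog 2 (4 * s) : ℝ) * Real.log 2 := by
        rw [← Real.log_pow, ← Nat.cast_two (R := ℝ), ← Real.log_pow, ← Real.log_mul (by norm_num) hs0.ne']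
        refine Real.log_le_log (by positivity) ?_
        have := Nat.le_pow_clog (b := 2) (by norm_num) (4 * s)
        have h3 : ((4 * s : ℕ) : ℝ) ≤ ((2 ^ Nat.clog 2 (4 * s) : ℕ) : ℝ) := by exact_mod_cast this
        push_cast at h3 ⊢
        linarith
      rw [Nat.cast_sub h]
      push_cast
      nlinarith
  have hZ0 : 0 ≤ Z := by linarith
  calc _ ≤ 5000 * (Z * ℓ ^ 2) * (3 * (1 + Real.log n - Real.log s)) :=
        mul_le_mul hT hK (by positivity) (by positivity)
    _ = 15000 * (Z * ℓ ^ 2 * (1 + Real.log n - Real.log s)) := by ring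
    _ ≤ _ := by
      have : 0 ≤ Z * ℓ ^ 2 * (1 + Real.log n - Real.log s) :=
        mul_nonneg (by positivity) (by linarith)
      linarith

/-- Outside the uniform bad event the near-minimizer obeys the bound whatever the true signal is.
The constant is 30000 times 16, where 16 is `4 · 2²` from the quadratic inequality and the factor 2
in front of the square root. -/
theorem minimaxRisk_le {n s : ℕ} (hs : 1 ≤ s) (hsn : s ≤ n) {δ σ : ℝ} (hδ : 0 < δ) (hδ1 : δ < 1)
    (hσ : 0 ≤ σ) :
    minimaxRisk n δ σ (signalClass s) ≤
      ENNReal.ofReal (480000 * (σ ^ 2 / (2 * (n : ℝ) + 1)) *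
        ((s : ℝ) * Real.log (Real.exp 1 * (n : ℝ)) + Real.log δ⁻¹) *
        Real.log (Real.exp 1 * (s : ℝ)) ^ 2 * Real.log (Real.exp 1 * (n : ℝ) / (s : ℝ))) := by
  obtain ⟨B, hB, hB'⟩ := exists_uniform_bad_event hs hsn hδ hδ1
  set A := noiseThreshold (8 * s) (level n (5 * s) δ) *
    ((Nat.log 2 n + 1 - Nat.clog 2 (4 * s) : ℕ) + 1) with hA
  have hA0 : 0 ≤ A := by
    have := level_nonneg n (5 * s) hδ hδ1
    rw [hA, noiseThreshold]
    positivity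
  have hM : (0 : ℝ) < 2 * n + 1 := by positivity
  have hrisk : ∀ ε > 0, minimaxRisk n δ σ (signalClass s) ≤
      ENNReal.ofReal ((16 * σ ^ 2 * A + 2 * ε) / (2 * n + 1)) := by
    intro ε hε
    obtain ⟨xhat, hmeas, hmem, hmin⟩ :=
      exists_measurable_near_minimizer n ⟨_, zero_mem_signalClass hs⟩ hε
    refine (iInf₂_le_of_le xhat hmeas (iInf_le_of_le hmem le_rfl)).trans
      (deltaRisk_le_of_forall fun x hx => (measure_mono fun ξ hξ => ?_).trans hB)
    by_contra hcon
    obtain ⟨Y, hY, hfin, hd, hu⟩ := exists_shiftInvariant_of_sub (hmem (observe σ x ξ)) hx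
    have h1 := hB' ξ hcon Y hY hfin hd _ hu
    have h2 := sum_sq_sub_le_of_near_minimizer hσ (hmin (observe σ x ξ) x hx) h1
    rw [mul_pow, Real.sq_sqrt hA0] at h2
    refine absurd (show _ < _ from hξ) (not_lt.2 (h2.trans (le_of_eq ?_)))
    ring
  -- No single estimator here has zero tolerance; the infimum over estimators allows the tolerance
  -- to tend to 0.
  refine le_trans (ge_of_tendsto' (x := Filter.atTop (α := ℕ)) (f := fun j : ℕ =>
    ENNReal.ofReal ((16 * σ ^ 2 * A + 2 * (1 / ((j : ℝ) + 1))) / (2 * n + 1))) ?_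
    fun j => hrisk _ (by positivity)) (ENNReal.ofReal_le_ofReal (?_ : 16 * σ ^ 2 * A / (2 * n + 1) ≤ _))
  · refine ENNReal.tendsto_ofReal (Filter.Tendsto.div_const ?_ _)
    simpa using (tendsto_one_div_add_atTop_nhds_zero_nat (𝕜 := ℝ)).const_mul 2 |>.const_add
      (16 * σ ^ 2 * A)
  · have h3 := mul_le_mul_of_nonneg_left (minimax_constant hs hsn hδ hδ1)
      (show 0 ≤ 16 * (σ ^ 2 / (2 * (n : ℝ) + 1)) by positivity)
    rw [← hA] at h3
    calc 16 * σ ^ 2 * A / (2 * n + 1) = 16 * (σ ^ 2 / (2 * (n : ℝ) + 1)) * A := by ring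
      _ ≤ _ := h3
      _ = _ := by ring

end Denoise

/-! ### Assembly of the two claims -/

theorem corollary3p3 :
    (∀ (n s : ℕ), (∃ a : ℕ, n = 3 ^ a) → (∃ b : ℕ, s = 3 ^ b) → 9 * s ≤ n →
      (∃ xhat : (Denoise.Window (2 * n) → ℂ) → ℤ → ℂ, Denoise.IsFullEstimator n s xhat) ∧
      ∀ xhat : (Denoise.Window (2 * n) → ℂ) → ℤ → ℂ, Denoise.IsFullEstimator n s xhat →
        ∀ (δ σ : ℝ), 0 < δ → δ < 1 → 0 ≤ σ →
          (∀ x ∈ Denoise.signalClass s,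
            Denoise.noiseLaw (2 * n)
              {ξ | Denoise.errorBound n s δ σ <
                (Denoise.l2 (2 * n) (fun t => xhat (Denoise.observe σ x ξ) t - x t)) ^ 2} ≤
              ENNReal.ofReal δ) ∧
          Denoise.deltaRisk (2 * n) δ σ xhat (Denoise.signalClass s) ≤
            ENNReal.ofReal (Denoise.errorBound n s δ σ / (4 * (n : ℝ) + 1))) ∧
    (∃ C : ℝ, 0 < C ∧ ∀ (n s : ℕ), 1 ≤ s → s ≤ n → ∀ (δ σ : ℝ), 0 < δ → δ < 1 → 0 ≤ σ →
      Denoise.minimaxRisk n δ σ (Denoise.signalClass s) ≤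
        ENNReal.ofReal (C * (σ ^ 2 / (2 * (n : ℝ) + 1)) *
          ((s : ℝ) * Real.log (Real.exp 1 * (n : ℝ)) + Real.log δ⁻¹) *
          Real.log (Real.exp 1 * (s : ℝ)) ^ 2 *
          Real.log (Real.exp 1 * (n : ℝ) / (s : ℝ)))) := by

  refine ⟨fun n s hn hs h => ⟨?_, fun xhat hx δ σ hδ hδ1 hσ => ?_⟩, ?_⟩
  · choose f hf using fun y : Denoise.Window (2 * n) → ℂ =>
      Denoise.exists_isFullEstimate hn hs h (Denoise.extend y)
    exact ⟨f, hf⟩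
  · have htail := fun x hxs => Denoise.fullEstimator_tail hn hs h hx hδ hδ1 hσ (x := x) hxs
    refine ⟨htail, (Denoise.deltaRisk_le_of_forall htail).trans (le_of_eq ?_)⟩
    congr 2
    push_cast
    ring
  · exact ⟨480000, by norm_num, fun n s hs hsn δ σ hδ hδ1 hσ =>
      Denoise.minimaxRisk_le hs hsn hδ hδ1 hσ⟩
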